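/- A linear recurrence sequence (LRS) is a sequence $(u_n)_{n\ge 1}$ of rational numbers with $u_n=a_1u_{n-1}+\cdots+a_ku_{n-k}$ for all $n>k$, where $a_1,\dots,a_k\in\mathbb{Q}$ and $a_k\neq 0$; it is given as input by the rationals $a_1,\dots,a_k,u_1,\dots,u_k$. Its roots are the distinct complex roots of its characteristic polynomial $x^m-b_1x^{m-1}-\cdots-b_m$, where $u_n=b_1u_{n-1}+\cdots+b_mu_{n-m}$ is the recurrence of smallest order that it satisfies; the dominant roots are those of maximal modulus. The LRS is non-degenerate if no ratio of two distinct roots is a root of unity. It has at most one pair of dominant complex roots if its non-real dominant roots, if any, form a single pair $\{\lambda,\overline\lambda\}$. The density of a set $S\subseteq\mathbb{N}$ is $\lim_{n\to\infty}|S\cap\{1,\dots,n\}|/n$. (1) There is an algorithm (a partial recursive function) that takes as input an LRS $(u_n)$ which is non-degenerate and has at most one pair of dominant complex roots or, more generally, for which there is some $P\ge 1$ such that each of the subsequences $(u_{nP+\ell})_n$, $0\le \ell<P$, is non-degenerate with at most one pair of dominant complex roots (identically zero subsequences, which have no roots, are allowed). On every such input the algorithm halts, the density $\delta$ of the positivity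 set $\{n : u_n>0\}$ exists, and the algorithm decides whether $\delta$ is rational and, if it is, outputs $\delta$ exactly. (2) If $(u_n)$ is a non-degenerate LRS, not identically zero, with at most one pair of dominant complex roots, then there are $\sigma\in\{1,-1\}$, real algebraic numbers $c$ and $r\ge 0$, not both zero, an integer $d\ge 0$, a real $\rho>0$, an irrational $\theta$ and a real $\tau$ with $$\frac{u_n}{n^d\rho^n}-\bigl(c\,\sigma^n+r\cos(2\pi(n\theta+\tau))\bigr)\longrightarrow 0\qquad(n\to\infty),$$ and the density of $\{n: u_n>0\}$ is as follows. If $\sigma=1$, it is $\frac1\pi\arccos(-c/r)$ when $|c|<r$, it is $1$ when $c\ge r$, and it is $0$ when $c\le -r$. If $\sigma=-1$, it is $\frac12$. -/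

import Mathlib

open Filter Topology

namespace LRS

/-- A finite code for a rational number: `(p, q)` stands for `p / (q + 1)`. -/
abbrev RatCode := ℤ × ℕ

/-- The rational number that a code stands for. -/
def RatCode.val (c : RatCode) : ℚ := (c.1 : ℚ) / ((c.2 : ℚ) + 1)

/-- The finite data that describe a linear recurrence sequence: the list
`(a₁, u₁), …, (a_k, u_k)` of coefficients and initial values of the recurrence
`u_n = a₁ u_{n-1} + ⋯ + a_k u_{n-k}`. -/
abbrev Code := List (RatCode × RatCode)

/-- The condition `a_k ≠ 0`. -/
def Code.Valid (I : Code) : Prop := ∀ h : I ≠ [], (I.getLast h).1.val ≠ 0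

/-- The recurrence relation of a code. Mathlib lists the coefficients in the opposite order:
`coeffs i` multiplies `u (n + i)`, so it is `a_{k-i}`. -/
def Code.recurrence (I : Code) : LinearRecurrence ℚ where
  order := I.length
  coeffs i := (I.get i.rev).1.val

/-- The sequence given by a code. Indices start at `0`: the value at `n` is `u_{n+1}`. -/
noncomputable def Code.seq (I : Code) : ℕ → ℚ :=
  I.recurrence.mkSol fun i => (I.get i).2.val

/-- `E` is a recurrence of smallest order satisfied by `u`. For a linear recurrence sequence it
is unique, its order is the order of `u`, and its characteristic polynomial is that of `u`. -/
def IsMinimalRecurrence (E : LinearRecurrence ℚ) (u : ℕ → ℚ) : Prop :=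
  E.IsSolution u ∧ ∀ E' : LinearRecurrence ℚ, E'.IsSolution u → E.order ≤ E'.order

/-- The (complex) roots of a linear recurrence sequence: the roots of its characteristic
polynomial. -/
def IsRoot (u : ℕ → ℚ) (z : ℂ) : Prop :=
  ∃ E : LinearRecurrence ℚ, IsMinimalRecurrence E u ∧ Polynomial.aeval z E.charPoly = 0

/-- Dominant roots: the roots of maximal modulus. -/
def IsDominantRoot (u : ℕ → ℚ) (z : ℂ) : Prop :=
  IsRoot u z ∧ ∀ w : ℂ, IsRoot u w → ‖w‖ ≤ ‖z‖

/-- At most one pair `z, z̄` of distinct dominant roots that are not real. -/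
def AtMostOneDominantPair (u : ℕ → ℚ) : Prop :=
  ∀ z w : ℂ, IsDominantRoot u z → IsDominantRoot u w → z.im ≠ 0 → w.im ≠ 0 →
    w = z ∨ w = (starRingEnd ℂ) z

/-- No ratio of two distinct roots is a root of unity. -/
def NonDegenerate (u : ℕ → ℚ) : Prop :=
  ∀ z w : ℂ, IsRoot u z → IsRoot u w → z ≠ w → ∀ n : ℕ, 0 < n → (z / w) ^ n ≠ 1

/-- `u` splits into finitely many subsequences `u_{nP+ℓ}`, `ℓ < P`, each of which is
non-degenerate with at most one pair of dominant complex roots. (An identically zero subsequence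
has no roots and qualifies.) With `P = 1` these include all non-degenerate sequences `u` with
at most one pair of dominant complex roots. -/
def HasOnePairSplitting (u : ℕ → ℚ) : Prop :=
  ∃ P : ℕ, 0 < P ∧ ∀ l < P,
    NonDegenerate (fun n => u (n * P + l)) ∧ AtMostOneDominantPair (fun n => u (n * P + l))

/-- The set `S` of natural numbers has natural density `δ`. -/
def HasDensity (S : Set ℕ) (δ : ℝ) : Prop :=
  Tendsto (fun n : ℕ => ((S ∩ Set.Iio n).ncard : ℝ) / (n : ℝ)) atTop (𝓝 δ)

/-- The set of indices of the positive entries. -/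
def positivitySet (u : ℕ → ℚ) : Set ℕ := {n | 0 < u n}

/-- Up to the positive factor `n ^ d * ρ ^ n` and a term that tends to zero, `u n` is
`c * σ ^ n + r * cos (2 π (n θ + τ))`, with `θ` irrational and with `c`, `r` not both zero. -/
def HasDominantPart (u : ℕ → ℚ) (σ c r : ℝ) : Prop :=
  (c ≠ 0 ∨ r ≠ 0) ∧ ∃ (d : ℕ) (ρ θ τ : ℝ), 0 < ρ ∧ Irrational θ ∧
    Tendsto (fun n : ℕ => (u n : ℝ) / ((n : ℝ) ^ d * ρ ^ n) -
      (c * σ ^ n + r * Real.cos (2 * Real.pi * (n * θ + τ)))) atTop (𝓝 0)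

end LRS

/-! Along its roots, `u` is a sum of terms `C(n, e) * l ^ n` with algebraic coefficients that are
compatible with complex conjugation. Among the roots of maximal modulus `ρ`, non-degeneracy leaves
at most one real root `σ * ρ`, because `ρ` and `-ρ` have ratio `-1`. The hypothesis on pairs leaves
at most one pair `ρ * ω`, `ρ * conj ω`. Hence the leading part of `u` is `C(n, d) * ρ ^ n * (c * σ ^
n + Re (b * ω ^ n))`, and `ω` is no root of unity if `b ≠ 0` (`exists_isDominantForm`). The angles
of `ω ^ n` are then equidistributed by Weyl's theorem. For `σ = 1` the density of positive terms is
therefore the measure of the set where `c + r * cos (2 π x)` is positive, which is `arccos (-c / r)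
/ π` if `|c| < r` (`hasDensity_pos_of_tendsto_cos`). For `σ = -1` the even and the odd indices see
the constants `c` and `-c`, and the two densities add up to `1` (`hasDensity_half_of_tendsto`).

For the algorithm, let `δ l` be the density on the residue class `l` modulo `P`. The density of the
whole set is the mean of the `δ l` (`HasDensity.of_residues`), and each `exp (i π δ l)` is
algebraic. So the density is rational exactly if the product of these numbers is a root of unity. If
it is, some multiple `N * ∑ δ l` is an integer, found by adding the angles one at a time and
counting the half turns.

The algorithm does not compute with algebraic numbers directly. It searches through all certificates
`IsOutput`, which also guess the period `P`. All numbers in a certificate are polynomials modulo a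
polynomial `m` with a real root. Equality is witnessed by a quotient modulo `m`, non-negativity by a
square root, non-vanishing by an inverse. Not being a root of unity is checked on a single power,
whose exponent is a multiple of all orders that the degree of the field permits. An identity of
sequences is checked on finitely many terms, since both sides satisfy linear recurrences. Soundness
(`IsOutput.sound`) evaluates a certificate at any real root of `m`; `m` need not be irreducible.
Completeness (`exists_isOutput`) collects the finitely many algebraic numbers needed, square roots
included, and takes for `m` the minimal polynomial of a primitive element of the field they
generate. Since `IsOutput` is semidecidable, `SemiDec.exists_partrec` supplies the partial recursive
function. -/

namespace LRS

open MeasureTheory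

/-! ### Equidistribution of irrational rotations -/

/-- The average of the first `N` values of a sequence. -/
noncomputable def average (f : ℕ → ℝ) (N : ℕ) : ℝ := (∑ n ∈ Finset.range N, f n) / N

/-- For `k ≠ 0` the sum is geometric with ratio `q = exp (2 π i k θ)`. Irrationality of `θ` gives `q
≠ 1`, so the sums are bounded by `2 / ‖q - 1‖` and the averages tend to zero, which is the integral.
-/
theorem tendsto_average_fourier {θ τ : ℝ} (hθ : Irrational θ) (k : ℤ) :
    Tendsto (fun N : ℕ => (N : ℂ)⁻¹ * ∑ n ∈ Finset.range N,
      fourier k ((n * θ + τ : ℝ) : UnitAddCircle)) atTop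
      (𝓝 (∫ x, fourier k x ∂(AddCircle.haarAddCircle (T := 1)))) := by
  rcases eq_or_ne k 0 with rfl | hk
  · simp only [fourier_zero, Finset.sum_const, Finset.card_range, nsmul_eq_mul, mul_one,
      integral_const, probReal_univ, one_smul]
    refine tendsto_const_nhds.congr' ?_
    filter_upwards [eventually_gt_atTop 0] with N hN
    have : (N : ℂ) ≠ 0 := by exact_mod_cast hN.ne'
    field_simp
  · have hintegral : ∫ x, fourier k x ∂(AddCircle.haarAddCircle (T := 1)) = 0 := by
      have := congrFun (fourierCoeff_fourier (T := 1) k) 0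
      simpa [fourierCoeff, Pi.single_apply, hk.symm] using this
    rw [hintegral]
    set q : ℂ := Complex.exp (2 * Real.pi * Complex.I * k * θ) with hq
    set s : ℂ := Complex.exp (2 * Real.pi * Complex.I * k * τ) with hs
    have hterm : ∀ n : ℕ, fourier k ((n * θ + τ : ℝ) : UnitAddCircle) = s * q ^ n := by
      intro n
      rw [fourier_coe_apply, hq, hs, ← Complex.exp_nat_mul, ← Complex.exp_add]
      congr 1
      push_cast
      ring
    have hq1 : q ≠ 1 := by
      intro h
      obtain ⟨m, hm⟩ := Complex.exp_eq_one_iff.1 h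
      have h2 : (2 * Real.pi * Complex.I : ℂ) ≠ 0 := Complex.two_pi_I_ne_zero
      have h3 : (k : ℂ) * θ = m := by
        apply mul_left_cancel₀ h2
        linear_combination hm
      have h4 : (k : ℝ) * θ = m := by exact_mod_cast h3
      exact (hθ.intCast_mul hk).ne_int m h4
    have hnorm : ‖q‖ = 1 := by
      rw [hq, show (2 * Real.pi * Complex.I * k * θ : ℂ) = ((2 * Real.pi * k * θ : ℝ) : ℂ) *
        Complex.I by push_cast; ring, Complex.norm_exp_ofReal_mul_I]
    have hsnorm : ‖s‖ = 1 := by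
      rw [hs, show (2 * Real.pi * Complex.I * k * τ : ℂ) = ((2 * Real.pi * k * τ : ℝ) : ℂ) *
        Complex.I by push_cast; ring, Complex.norm_exp_ofReal_mul_I]
    have hbd : ∀ N : ℕ, ‖∑ n ∈ Finset.range N,
        fourier k ((n * θ + τ : ℝ) : UnitAddCircle)‖ ≤ 2 / ‖q - 1‖ := by
      intro N
      simp_rw [hterm]
      rw [← Finset.mul_sum, geom_sum_eq hq1, norm_mul, hsnorm, one_mul, norm_div]
      gcongr
      calc ‖q ^ N - 1‖ ≤ ‖q ^ N‖ + ‖(1 : ℂ)‖ := norm_sub_le _ _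
        _ = 2 := by rw [norm_pow, hnorm]; norm_num
    refine squeeze_zero_norm (a := fun N : ℕ => (2 / ‖q - 1‖) * (N : ℝ)⁻¹) (fun N => ?_) ?_
    · rw [norm_mul, norm_inv, Complex.norm_natCast, mul_comm]
      exact mul_le_mul_of_nonneg_right (hbd N) (by positivity)
    · simpa using (tendsto_inv_atTop_nhds_zero_nat (𝕜 := ℝ)).const_mul (2 / ‖q - 1‖)

/-- Weyl's criterion: trigonometric polynomials inherit the limit by linearity. They are uniformly
dense, and a uniform error of `ε / 3` moves both the averages and the integral by at most `ε / 3`.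
-/
theorem tendsto_average_addCircle {θ τ : ℝ} (hθ : Irrational θ) (f : C(UnitAddCircle, ℂ)) :
    Tendsto (fun N : ℕ => (N : ℂ)⁻¹ * ∑ n ∈ Finset.range N,
      f ((n * θ + τ : ℝ) : UnitAddCircle)) atTop
      (𝓝 (∫ x, f x ∂(AddCircle.haarAddCircle (T := 1)))) := by
  have hintegral : ∀ g : C(UnitAddCircle, ℂ),
      Integrable (fun x => g x) (AddCircle.haarAddCircle (T := 1)) := fun g =>
    g.continuous.integrable_of_hasCompactSupport (HasCompactSupport.of_compactSpace _)
  have hspan : ∀ g ∈ Submodule.span ℂ (Set.range (@fourier 1)),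
      Tendsto (fun N : ℕ => (N : ℂ)⁻¹ * ∑ n ∈ Finset.range N,
        g ((n * θ + τ : ℝ) : UnitAddCircle)) atTop
        (𝓝 (∫ x, g x ∂(AddCircle.haarAddCircle (T := 1)))) := by
    intro g hg
    induction hg using Submodule.span_induction with
    | mem x hx =>
      obtain ⟨k, rfl⟩ := hx
      exact tendsto_average_fourier hθ k
    | zero => simp
    | add x y _ _ hx hy =>
      have := hx.add hy
      rw [← integral_add (hintegral x) (hintegral y)] at this
      refine this.congr fun N => ?_
      simp [Finset.sum_add_distrib, mul_add]
    | smul a x _ hx =>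
      have := hx.const_mul a
      rw [← integral_const_mul] at this
      refine this.congr fun N => ?_
      simp only [ContinuousMap.coe_smul, Pi.smul_apply, smul_eq_mul, ← Finset.mul_sum]
      ring
  have hf : f ∈ closure (Submodule.span ℂ (Set.range (@fourier 1)) : Set C(UnitAddCircle, ℂ)) := by
    have : f ∈ (Submodule.span ℂ (Set.range (@fourier 1))).topologicalClosure := by
      rw [span_fourier_closure_eq_top]; trivial
    exact this
  rw [Metric.tendsto_atTop]
  intro ε hε
  obtain ⟨g, hg, hfg⟩ := Metric.mem_closure_iff.1 hf (ε / 3) (by positivity)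
  obtain ⟨N₀, hN₀⟩ := Metric.tendsto_atTop.1 (hspan g hg) (ε / 3) (by positivity)
  refine ⟨N₀, fun N hN => ?_⟩
  have hpt : ∀ x, ‖f x - g x‖ ≤ ε / 3 := fun x => by
    rw [← dist_eq_norm]
    exact (ContinuousMap.dist_apply_le_dist x).trans hfg.le
  have h1 : ‖(N : ℂ)⁻¹ * ∑ n ∈ Finset.range N, f ((n * θ + τ : ℝ) : UnitAddCircle) -
      (N : ℂ)⁻¹ * ∑ n ∈ Finset.range N, g ((n * θ + τ : ℝ) : UnitAddCircle)‖ ≤ ε / 3 := by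
    rw [← mul_sub, ← Finset.sum_sub_distrib, norm_mul, norm_inv, Complex.norm_natCast]
    rcases Nat.eq_zero_or_pos N with rfl | hpos
    · simp; positivity
    · have hNr : (0 : ℝ) < N := by exact_mod_cast hpos
      rw [inv_mul_le_iff₀ hNr]
      refine (norm_sum_le _ _).trans ?_
      refine (Finset.sum_le_sum fun n _ => hpt _).trans ?_
      simp
  have h2 : ‖∫ x, g x ∂(AddCircle.haarAddCircle (T := 1)) -
      ∫ x, f x ∂(AddCircle.haarAddCircle (T := 1))‖ ≤ ε / 3 := by
    rw [← integral_sub (hintegral g) (hintegral f)]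
    have := norm_integral_le_of_norm_le_const (μ := AddCircle.haarAddCircle (T := 1))
      (f := fun x => g x - f x) (C := ε / 3)
      (Eventually.of_forall fun x => by rw [norm_sub_rev]; exact hpt x)
    simpa using this
  have h3 := hN₀ N hN
  rw [dist_eq_norm] at h3 ⊢
  calc _ = ‖((N : ℂ)⁻¹ * ∑ n ∈ Finset.range N, f ((n * θ + τ : ℝ) : UnitAddCircle) -
      (N : ℂ)⁻¹ * ∑ n ∈ Finset.range N, g ((n * θ + τ : ℝ) : UnitAddCircle)) +
      ((N : ℂ)⁻¹ * ∑ n ∈ Finset.range N, g ((n * θ + τ : ℝ) : UnitAddCircle) -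
        ∫ x, g x ∂(AddCircle.haarAddCircle (T := 1))) +
      (∫ x, g x ∂(AddCircle.haarAddCircle (T := 1)) -
        ∫ x, f x ∂(AddCircle.haarAddCircle (T := 1)))‖ := by congr 1; ring
    _ ≤ _ := norm_add₃_le
    _ < ε := by linarith

theorem tendsto_average_of_continuous_comp_cos {θ τ : ℝ} (hθ : Irrational θ) {F : ℝ → ℝ}
    (hF : Continuous F) :
    Tendsto (average fun n => F (Real.cos (2 * Real.pi * (n * θ + τ)))) atTop
      (𝓝 (∫ x in (0 : ℝ)..1, F (Real.cos (2 * Real.pi * x)))) := by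
  set G : ℝ → ℂ := fun x => (F (Real.cos (2 * Real.pi * x)) : ℂ) with hG
  have hper : Function.Periodic G 1 := by
    intro x
    simp only [hG, mul_add, mul_one, Real.cos_add_two_pi]
  have hcont : Continuous G := by fun_prop
  let g : C(UnitAddCircle, ℂ) := ⟨hper.lift, continuous_coinduced_dom.mpr hcont⟩
  have hg : ∀ x : ℝ, g (x : UnitAddCircle) = G x := fun x => hper.lift_coe x
  have h := tendsto_average_addCircle (τ := τ) hθ g
  have hintegral : ∫ x, g x ∂(AddCircle.haarAddCircle (T := 1)) =
      ((∫ x in (0 : ℝ)..1, F (Real.cos (2 * Real.pi * x)) : ℝ) : ℂ) := by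
    rw [AddCircle.integral_haarAddCircle, inv_one, one_smul,
      ← AddCircle.intervalIntegral_preimage 1 0, zero_add, ← intervalIntegral.integral_ofReal]
    exact intervalIntegral.integral_congr fun x _ => hg x
  rw [hintegral] at h
  have h' := (Complex.continuous_re.tendsto _).comp h
  rw [Complex.ofReal_re] at h'
  refine h'.congr fun N => ?_
  simp only [hg, hG, Function.comp, average]
  rw [← Complex.ofReal_sum, ← Complex.ofReal_natCast, ← Complex.ofReal_inv, ← Complex.ofReal_mul,
    Complex.ofReal_re]
  ring

end LRS

namespace LRS

open MeasureTheory

/-! ### Natural density -/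

theorem hasDensity_iff (S : Set ℕ) (δ : ℝ) :
    HasDensity S δ ↔ Tendsto (average (S.indicator 1)) atTop (𝓝 δ) := by
  classical
  have : (fun n : ℕ => ((S ∩ Set.Iio n).ncard : ℝ) / (n : ℝ)) = average (S.indicator 1) := by
    funext n
    have h : S ∩ Set.Iio n = ((Finset.range n).filter (· ∈ S) : Finset ℕ) := by
      ext x; simp [and_comm]
    rw [average, h, Set.ncard_coe_finset, Finset.card_filter]
    congr 1
    rw [Nat.cast_sum]
    refine Finset.sum_congr rfl fun i _ => ?_
    by_cases hi : i ∈ S <;> simp [hi]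
  rw [HasDensity, this]

/-- The indicator has no continuous description, so it is enclosed between sequences whose averages
are known. The inequalities need only hold eventually: the finitely many exceptions contribute a
constant divided by `N`. -/
theorem hasDensity_of_sandwich {S : Set ℕ} {δ : ℝ}
    (H : ∀ ε > 0, ∃ (f g : ℕ → ℝ) (A B : ℝ), δ - ε < A ∧ B < δ + ε ∧
      Tendsto (average f) atTop (𝓝 A) ∧ Tendsto (average g) atTop (𝓝 B) ∧
      ∀ᶠ n in atTop, f n ≤ S.indicator 1 n ∧ S.indicator 1 n ≤ g n) :
    HasDensity S δ := by
  have key : ∀ (f g : ℕ → ℝ), (∀ᶠ n in atTop, f n ≤ g n) → ∀ η > 0,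
      ∀ᶠ N in atTop, average f N ≤ average g N + η := by
    intro f g hfg η hη
    obtain ⟨n₀, hn₀⟩ := eventually_atTop.1 hfg
    set C : ℝ := ∑ n ∈ Finset.range n₀, (f n - g n)
    have hC : ∀ᶠ N : ℕ in atTop, C / N < η :=
      (tendsto_const_div_atTop_nhds_zero_nat C).eventually_lt_const hη
    filter_upwards [hC, eventually_ge_atTop n₀, eventually_gt_atTop 0] with N h1 h2 h3
    have hNr : (0 : ℝ) < N := by exact_mod_cast h3
    have hsum : ∑ n ∈ Finset.range N, (f n - g n) ≤ C := by
      rw [← Finset.sum_range_add_sum_Ico _ h2]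
      have : ∑ n ∈ Finset.Ico n₀ N, (f n - g n) ≤ 0 :=
        Finset.sum_nonpos fun n hn => sub_nonpos.2 (hn₀ n (Finset.mem_Ico.1 hn).1)
      linarith
    rw [Finset.sum_sub_distrib] at hsum
    have : average f N - average g N ≤ C / N := by
      rw [average, average, ← sub_div]
      gcongr
    linarith
  rw [hasDensity_iff, Metric.tendsto_atTop]
  intro ε hε
  obtain ⟨f, g, A, B, hA, hB, hf, hg, hfg⟩ := H (ε / 3) (by positivity)
  refine eventually_atTop.1 ?_
  filter_upwards [key f (S.indicator 1) (hfg.mono fun _ h => h.1) (ε / 3) (by positivity),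
    key (S.indicator 1) g (hfg.mono fun _ h => h.2) (ε / 3) (by positivity),
    hf.eventually_const_lt hA, hg.eventually_lt_const hB] with N h1 h2 h3 h4
  rw [Real.dist_eq, abs_lt]
  constructor <;> linarith

theorem tendsto_average_const (c : ℝ) : Tendsto (average fun _ => c) atTop (𝓝 c) := by
  refine tendsto_const_nhds.congr' ?_
  filter_upwards [eventually_gt_atTop 0] with N hN
  have : (N : ℝ) ≠ 0 := by exact_mod_cast hN.ne'
  simp only [average, Finset.sum_const, Finset.card_range, nsmul_eq_mul]
  field_simp

theorem hasDensity_one_of_eventually {S : Set ℕ} (h : ∀ᶠ n in atTop, n ∈ S) :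
    HasDensity S 1 := by
  refine hasDensity_of_sandwich fun ε hε => ⟨fun _ => 1, fun _ => 1, 1, 1, by linarith,
    by linarith, tendsto_average_const 1, tendsto_average_const 1, ?_⟩
  filter_upwards [h] with n hn
  simp [hn]

theorem hasDensity_zero_of_eventually {S : Set ℕ} (h : ∀ᶠ n in atTop, n ∉ S) :
    HasDensity S 0 := by
  refine hasDensity_of_sandwich fun ε hε => ⟨fun _ => 0, fun _ => 0, 0, 0, by linarith,
    by linarith, tendsto_average_const 0, tendsto_average_const 0, ?_⟩
  filter_upwards [h] with n hn
  simp [hn]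

/-- The shift by `P - 1 - l` turns the rounding down into the exact count of the `j` with `j * P + l
< N`. -/
theorem sum_filter_mod_eq (f : ℕ → ℝ) {P l : ℕ} (hl : l < P) (N : ℕ) :
    ∑ n ∈ (Finset.range N).filter (fun n => n % P = l), f n =
      ∑ j ∈ Finset.range ((N + (P - 1 - l)) / P), f (j * P + l) := by
  have hP : 0 < P := by omega
  symm
  refine Finset.sum_nbij' (fun j => j * P + l) (fun n => n / P) ?_ ?_ ?_ ?_ ?_
  · intro j hj
    have hj' := Finset.mem_range.1 hj
    rw [Nat.lt_iff_add_one_le, Nat.le_div_iff_mul_le hP] at hj'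
    simp only [Finset.mem_filter, Finset.mem_range]
    refine ⟨?_, ?_⟩
    · have : (j + 1) * P = j * P + P := by ring
      omega
    · rw [mul_comm, Nat.mul_add_mod, Nat.mod_eq_of_lt hl]
  · intro n hn
    simp only [Finset.mem_filter, Finset.mem_range] at hn
    rw [Finset.mem_range, Nat.lt_iff_add_one_le, Nat.le_div_iff_mul_le hP]
    have h1 := Nat.div_add_mod n P
    have : (n / P + 1) * P = P * (n / P) + P := by ring
    omega
  · intro j _
    rw [mul_comm, Nat.mul_add_div hP, Nat.div_eq_of_lt hl, add_zero]
  · intro n hn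
    simp only [Finset.mem_filter, Finset.mem_range] at hn
    have h1 := Nat.div_add_mod n P
    rw [mul_comm, ← hn.2]
    exact h1
  · intro j _
    rfl

/-- The average up to `N` is a weighted sum of the averages over the residue classes. The weight of
a class is its number of elements below `N`, divided by `N`; it differs from `1 / P` by at most `1 /
N`. -/
theorem HasDensity.of_residues {S : Set ℕ} {P : ℕ} (hP : 0 < P) {δ : ℕ → ℝ}
    (h : ∀ l < P, HasDensity {n | n * P + l ∈ S} (δ l)) :
    HasDensity S ((∑ l ∈ Finset.range P, δ l) / P) := by
  have hPr : (0 : ℝ) < P := by exact_mod_cast hP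
  rw [hasDensity_iff]
  set f : ℕ → ℝ := S.indicator 1
  have hdecomp : ∀ N, average f N = ∑ l ∈ Finset.range P,
      average (fun j => f (j * P + l)) ((N + (P - 1 - l)) / P) *
        ((((N + (P - 1 - l)) / P : ℕ) : ℝ) / N) := by
    intro N
    rw [average, ← Finset.sum_fiberwise_of_maps_to (g := fun n => n % P) (t := Finset.range P)
      (fun n _ => Finset.mem_range.2 (Nat.mod_lt _ hP)), Finset.sum_div]
    refine Finset.sum_congr rfl fun l hl => ?_
    rw [sum_filter_mod_eq f (Finset.mem_range.1 hl)]
    simp only [average]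
    rcases Nat.eq_zero_or_pos ((N + (P - 1 - l)) / P) with h0 | h0
    · simp [h0]
    · have : ((((N + (P - 1 - l)) / P : ℕ) : ℝ)) ≠ 0 := by exact_mod_cast h0.ne'
      field_simp
  rw [show average f = _ from funext hdecomp, Finset.sum_div]
  refine tendsto_finsetSum _ fun l hl => ?_
  have hl' := Finset.mem_range.1 hl
  rw [div_eq_mul_inv]
  refine Tendsto.mul ?_ ?_
  · have h1 := (hasDensity_iff _ _).1 (h l hl')
    have h2 : Tendsto (fun N : ℕ => (N + (P - 1 - l)) / P) atTop atTop := by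
      refine tendsto_atTop_mono (f := fun N => N / P) (fun N => ?_)
        (Nat.tendsto_div_const_atTop hP.ne')
      exact Nat.div_le_div_right (by omega)
    have h3 := h1.comp h2
    exact h3
  · have hb : ∀ N : ℕ, (N : ℝ) / P - 1 ≤ (((N + (P - 1 - l)) / P : ℕ) : ℝ) ∧
        (((N + (P - 1 - l)) / P : ℕ) : ℝ) ≤ (N : ℝ) / P + 1 := by
      intro N
      have h1 := Nat.div_mul_le_self (N + (P - 1 - l)) P
      have h2 := Nat.lt_div_mul_add (a := N + (P - 1 - l)) hP
      set q := (N + (P - 1 - l)) / P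
      have h3 : N < q * P + P := by omega
      have h4 : q * P ≤ N + P := by omega
      have h3' : (N : ℝ) < q * P + P := by exact_mod_cast h3
      have h4' : (q : ℝ) * P ≤ N + P := by exact_mod_cast h4
      constructor
      · rw [sub_le_iff_le_add, div_le_iff₀ hPr]; nlinarith
      · rw [← sub_le_iff_le_add, le_div_iff₀ hPr]; nlinarith
    have hz : Tendsto (fun N : ℕ => 1 / (N : ℝ)) atTop (𝓝 0) :=
      tendsto_const_div_atTop_nhds_zero_nat 1
    refine tendsto_of_tendsto_of_tendsto_of_le_of_le'
      (g := fun N : ℕ => (P : ℝ)⁻¹ - 1 / N) (h := fun N : ℕ => (P : ℝ)⁻¹ + 1 / N)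
      (by simpa using tendsto_const_nhds.sub hz) (by simpa using tendsto_const_nhds.add hz) ?_ ?_
    · filter_upwards [eventually_gt_atTop 0] with N hN
      have hNr : (0 : ℝ) < N := by exact_mod_cast hN
      rw [le_div_iff₀ hNr]
      have := (hb N).1
      calc ((P : ℝ)⁻¹ - 1 / N) * N = (N : ℝ) / P - 1 := by field_simp
        _ ≤ _ := this
    · filter_upwards [eventually_gt_atTop 0] with N hN
      have hNr : (0 : ℝ) < N := by exact_mod_cast hN
      rw [div_le_iff₀ hNr]
      have := (hb N).2
      calc _ ≤ (N : ℝ) / P + 1 := this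
        _ = _ := by field_simp

/-! ### The density of positive values -/

/-- For `t` outside `[-1, 1]` either the hypothesis is impossible or the conclusion is trivial.
Hence no relation between the sizes of `c` and `r` is needed when `t = -c / r`. -/
theorem lt_cos_of_lt_arccos {t y : ℝ} (h0 : 0 ≤ y) (h : y < Real.arccos t) : t < Real.cos y := by
  have hpi := Real.arccos_le_pi t
  rcases lt_or_ge t (-1) with h1 | h1
  · linarith [Real.neg_one_le_cos y]
  rcases lt_or_ge 1 t with h2 | h2
  · rw [Real.arccos_of_one_le h2.le] at h; linarith
  rw [← Real.cos_arccos h1 h2]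
  exact Real.cos_lt_cos_of_nonneg_of_le_pi h0 hpi h

theorem cos_lt_of_arccos_lt {t y : ℝ} (hy : y ≤ Real.pi) (h : Real.arccos t < y) :
    Real.cos y < t := by
  have h0 := Real.arccos_nonneg t
  rcases lt_or_ge t (-1) with h1 | h1
  · rw [Real.arccos_of_le_neg_one h1.le] at h; linarith
  rcases lt_or_ge 1 t with h2 | h2
  · linarith [Real.cos_le_one y]
  rw [← Real.cos_arccos h1 h2]
  exact Real.cos_lt_cos_of_nonneg_of_le_pi h0 hy h

/-- The continuous ramp with value `0` for `s ≤ η * a` and `1` for `s ≥ η * (a + 1)`. -/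
noncomputable def ramp (a η s : ℝ) : ℝ := min 1 (max 0 (s / η - a))

theorem continuous_ramp (a η : ℝ) : Continuous (ramp a η) := by
  unfold ramp; fun_prop

theorem ramp_nonneg (a η s : ℝ) : 0 ≤ ramp a η s := by
  simp [ramp]

theorem ramp_le_one (a η s : ℝ) : ramp a η s ≤ 1 := by
  simp [ramp]

theorem ramp_eq_zero {a η s : ℝ} (hη : 0 < η) (h : s ≤ a * η) : ramp a η s = 0 := by
  have : s / η - a ≤ 0 := by rw [sub_nonpos, div_le_iff₀ hη]; exact h
  simp [ramp, this]

theorem ramp_eq_one {a η s : ℝ} (hη : 0 < η) (h : (a + 1) * η ≤ s) : ramp a η s = 1 := by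
  have : 1 ≤ s / η - a := by rw [le_sub_iff_add_le, le_div_iff₀ hη]; linarith
  simp [ramp, this]

theorem tendsto_ramp_of_pos (a : ℝ) {s : ℝ} (hs : 0 < s) :
    Tendsto (fun η => ramp a η s) (𝓝[>] 0) (𝓝 1) := by
  refine tendsto_const_nhds.congr' ?_
  have h1 : Tendsto (fun η : ℝ => (a + 1) * η) (𝓝[>] 0) (𝓝 0) := by
    have : Tendsto (fun η : ℝ => (a + 1) * η) (𝓝 0) (𝓝 ((a + 1) * 0)) :=
      (continuous_const.mul continuous_id).tendsto 0
    rw [mul_zero] at this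
    exact this.mono_left nhdsWithin_le_nhds
  filter_upwards [h1.eventually_lt_const hs, self_mem_nhdsWithin] with η h2 h3
  exact (ramp_eq_one h3 h2.le).symm

theorem tendsto_ramp_of_neg (a : ℝ) {s : ℝ} (hs : s < 0) :
    Tendsto (fun η => ramp a η s) (𝓝[>] 0) (𝓝 0) := by
  refine tendsto_const_nhds.congr' ?_
  have h1 : Tendsto (fun η : ℝ => a * η) (𝓝[>] 0) (𝓝 0) := by
    have : Tendsto (fun η : ℝ => a * η) (𝓝 0) (𝓝 (a * 0)) :=
      (continuous_const.mul continuous_id).tendsto 0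
    rw [mul_zero] at this
    exact this.mono_left nhdsWithin_le_nhds
  filter_upwards [h1.eventually_const_lt hs, self_mem_nhdsWithin] with η h2 h3
  exact (ramp_eq_zero h3 h2.le).symm

/-- As `η` shrinks, the ramp tends to the indicator of positivity at every non-zero argument,
whatever `a` is. On `(0, 1]` the argument is positive on `A` and negative elsewhere, apart from the
two points `α` and `1 - α`. Dominated convergence then gives the measure of `A`, which is `2 * α`.
-/
theorem tendsto_integral_ramp (a c : ℝ) {r : ℝ} (hr : 0 < r) :
    Tendsto (fun η => ∫ x in (0 : ℝ)..1, ramp a η (c + r * Real.cos (2 * Real.pi * x)))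
      (𝓝[>] 0) (𝓝 (Real.arccos (-c / r) / Real.pi)) := by
  set t := -c / r with ht
  set α := Real.arccos t / (2 * Real.pi) with hα
  have hpi := Real.pi_pos
  have hα0 : 0 ≤ α := div_nonneg (Real.arccos_nonneg _) (by positivity)
  have hα1 : α ≤ 1 / 2 := by
    rw [hα, div_le_iff₀ (by positivity)]
    linarith [Real.arccos_le_pi t]
  have hαt : Real.arccos t = 2 * Real.pi * α := by rw [hα]; field_simp
  set A : Set ℝ := Set.Iio α ∪ Set.Ioi (1 - α) with hA
  have hAm : MeasurableSet A := measurableSet_Iio.union measurableSet_Ioi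
  have hval : ∫ x in (0 : ℝ)..1, A.indicator (fun _ => (1 : ℝ)) x =
      Real.arccos t / Real.pi := by
    rw [intervalIntegral.integral_of_le zero_le_one, integral_indicator hAm, setIntegral_const,
      smul_eq_mul, mul_one, measureReal_restrict_apply hAm, hA, Set.union_inter_distrib_right,
      measureReal_union (hd := ?_) (h := ?_)
        (h₁ := measure_inter_ne_top_of_right_ne_top measure_Ioc_lt_top.ne)
        (h₂ := measure_inter_ne_top_of_right_ne_top measure_Ioc_lt_top.ne)]
    · have e1 : Set.Iio α ∩ Set.Ioc 0 1 = Set.Ioo 0 α := by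
        ext x; simp only [Set.mem_inter_iff, Set.mem_Iio, Set.mem_Ioc, Set.mem_Ioo]
        constructor
        · rintro ⟨h1, h2, h3⟩; exact ⟨h2, h1⟩
        · rintro ⟨h1, h2⟩; exact ⟨h2, h1, by linarith⟩
      have e2 : Set.Ioi (1 - α) ∩ Set.Ioc 0 1 = Set.Ioc (1 - α) 1 := by
        ext x; simp only [Set.mem_inter_iff, Set.mem_Ioi, Set.mem_Ioc]
        constructor
        · rintro ⟨h1, h2, h3⟩; exact ⟨h1, h3⟩
        · rintro ⟨h1, h2⟩; exact ⟨h1, by linarith, h2⟩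
      rw [e1, e2, Real.volume_real_Ioo_of_le hα0, Real.volume_real_Ioc_of_le (by linarith), hαt]
      field_simp
      ring
    · rw [Set.disjoint_left]
      intro x hx hx'
      simp only [Set.mem_inter_iff, Set.mem_Iio, Set.mem_Ioi] at hx hx'
      linarith [hx.1, hx'.1]
    · exact measurableSet_Ioi.inter measurableSet_Ioc
  rw [← hval]
  refine intervalIntegral.tendsto_integral_filter_of_dominated_convergence (fun _ => (1 : ℝ))
    ?_ ?_ ?_ ?_
  · refine Eventually.of_forall fun η => ?_
    have : Continuous fun x => ramp a η (c + r * Real.cos (2 * Real.pi * x)) :=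
      (continuous_ramp a η).comp (by fun_prop)
    exact this.aestronglyMeasurable
  · refine Eventually.of_forall fun η => Eventually.of_forall fun x _ => ?_
    rw [Real.norm_of_nonneg (ramp_nonneg _ _ _)]
    exact ramp_le_one _ _ _
  · exact intervalIntegrable_const
  · have hne : ∀ᵐ x : ℝ, x ≠ α ∧ x ≠ 1 - α := by
      have h1 : ∀ᵐ x : ℝ, x ≠ α := by simp [ae_iff, measure_singleton]
      have h2 : ∀ᵐ x : ℝ, x ≠ 1 - α := by simp [ae_iff, measure_singleton]
      exact h1.and h2
    filter_upwards [hne] with x hx hx01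
    rw [Set.uIoc_of_le zero_le_one] at hx01
    have hlow : ∀ y, 0 ≤ y → y < α → 0 < c + r * Real.cos (2 * Real.pi * y) := by
      intro y h0 h1
      have := lt_cos_of_lt_arccos (t := t) (y := 2 * Real.pi * y) (by positivity)
        (by rw [hαt]; exact (mul_lt_mul_iff_right₀ (by positivity)).2 h1)
      rw [ht, div_lt_iff₀ hr] at this
      linarith
    have hhigh : ∀ y, α < y → y ≤ 1 / 2 → c + r * Real.cos (2 * Real.pi * y) < 0 := by
      intro y h0 h1
      have := cos_lt_of_arccos_lt (t := t) (y := 2 * Real.pi * y) (by nlinarith)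
        (by rw [hαt]; exact (mul_lt_mul_iff_right₀ (by positivity)).2 h0)
      rw [ht, lt_div_iff₀ hr] at this
      linarith
    have hsymm : Real.cos (2 * Real.pi * (1 - x)) = Real.cos (2 * Real.pi * x) := by
      rw [mul_sub, mul_one, Real.cos_two_pi_sub]
    rcases lt_or_gt_of_ne hx.1 with h1 | h1
    · rw [Set.indicator_of_mem (show x ∈ A from Or.inl h1)]
      exact tendsto_ramp_of_pos a (hlow x hx01.1.le h1)
    rcases lt_or_gt_of_ne hx.2 with h2 | h2
    · rw [Set.indicator_of_notMem (by
        rintro (h | h)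
        · exact absurd h (not_lt.2 h1.le)
        · exact absurd h (not_lt.2 h2.le))]
      apply tendsto_ramp_of_neg a
      rcases le_total x (1 / 2) with h3 | h3
      · exact hhigh x h1 h3
      · rw [← hsymm]
        exact hhigh (1 - x) (by linarith) (by linarith)
    · rw [Set.indicator_of_mem (show x ∈ A from Or.inr h2)]
      apply tendsto_ramp_of_pos a
      rw [← hsymm]
      exact hlow (1 - x) (by linarith [hx01.2]) (by linarith)

/-- Once the error is below `η`, the indicator of positivity lies between two ramps. The one with `a
= 1` vanishes up to `η`, the one with `a = -2` is equal to `1` from `-η` on. Equidistribution gives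
the averages of both, and for small `η` both limits are close to the claimed density. -/
theorem hasDensity_pos_of_tendsto_cos {x : ℕ → ℝ} {c r θ τ : ℝ} (hr : 0 < r) (hθ : Irrational θ)
    (h : Tendsto (fun n : ℕ => x n - (c + r * Real.cos (2 * Real.pi * (n * θ + τ)))) atTop (𝓝 0)) :
    HasDensity {n | 0 < x n} (Real.arccos (-c / r) / Real.pi) := by
  refine hasDensity_of_sandwich fun ε hε => ?_
  have h1 := (tendsto_integral_ramp 1 c hr).eventually_const_lt
    (show Real.arccos (-c / r) / Real.pi - ε < _ by linarith)
  have h2 := (tendsto_integral_ramp (-2) c hr).eventually_lt_const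
    (show _ < Real.arccos (-c / r) / Real.pi + ε by linarith)
  obtain ⟨η, ⟨hA, hB⟩, hη⟩ := ((h1.and h2).and self_mem_nhdsWithin).exists
  have hη : 0 < η := hη
  have hcont : ∀ a, Continuous fun s => ramp a η (c + r * s) := fun a =>
    (continuous_ramp a η).comp (by fun_prop)
  refine ⟨_, _, _, _, hA, hB, tendsto_average_of_continuous_comp_cos (τ := τ) hθ (hcont 1),
    tendsto_average_of_continuous_comp_cos (τ := τ) hθ (hcont (-2)), ?_⟩
  have hsmall := (Metric.tendsto_atTop'.1 h η hη)
  obtain ⟨N, hN⟩ := hsmall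
  filter_upwards [eventually_gt_atTop N] with n hn
  have hd := hN n hn
  rw [Real.dist_eq, sub_zero, abs_lt] at hd
  set y := c + r * Real.cos (2 * Real.pi * (n * θ + τ))
  by_cases hx : 0 < x n
  · have hmem : n ∈ {n | 0 < x n} := hx
    rw [Set.indicator_of_mem hmem]
    refine ⟨ramp_le_one _ _ _, ?_⟩
    rw [ramp_eq_one hη (by linarith)]
    rfl
  · have hmem : n ∉ {n | 0 < x n} := hx
    rw [Set.indicator_of_notMem hmem]
    refine ⟨?_, ramp_nonneg _ _ _⟩
    rw [ramp_eq_zero hη (by linarith)]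

theorem hasDensity_pos_of_tendsto_pos {x : ℕ → ℝ} {c : ℝ} (hc : 0 < c)
    (h : Tendsto x atTop (𝓝 c)) : HasDensity {n | 0 < x n} 1 :=
  hasDensity_one_of_eventually (h.eventually_const_lt hc)

theorem hasDensity_pos_of_tendsto_neg {x : ℕ → ℝ} {c : ℝ} (hc : c < 0)
    (h : Tendsto x atTop (𝓝 c)) : HasDensity {n | 0 < x n} 0 :=
  hasDensity_zero_of_eventually ((h.eventually_lt_const hc).mono fun _ h => not_lt.2 h.le)

end LRS

namespace LRS

open Polynomial

/-! ### The shift operator on sequences -/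

section Shift

variable {F : Type*} [Field F]

/-- The shift operator on sequences. -/
def shift (F : Type*) [Field F] : Module.End F (ℕ → F) := LinearMap.funLeft F F Nat.succ

@[simp]
theorem shift_apply (w : ℕ → F) (n : ℕ) : shift F w n = w (n + 1) := rfl

theorem shift_pow_apply (i : ℕ) (w : ℕ → F) (n : ℕ) : (shift F ^ i) w n = w (n + i) := by
  induction i generalizing n with
  | zero => simp
  | succ i ih => rw [pow_succ', Module.End.mul_apply, shift_apply, ih]; congr 1; ring

theorem aeval_shift_apply (p : F[X]) (w : ℕ → F) (n : ℕ) :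
    aeval (shift F) p w n = ∑ i ∈ Finset.range (p.natDegree + 1), p.coeff i * w (n + i) := by
  rw [aeval_eq_sum_range]
  simp [LinearMap.sum_apply, shift_pow_apply]

theorem aeval_shift_mul_apply (p q : F[X]) (w : ℕ → F) :
    aeval (shift F) (p * q) w = aeval (shift F) p (aeval (shift F) q w) := by
  rw [map_mul, Module.End.mul_apply]

theorem aeval_shift_eq_zero_of_dvd {p q : F[X]} (h : p ∣ q) {w : ℕ → F}
    (hw : aeval (shift F) p w = 0) : aeval (shift F) q w = 0 := by
  obtain ⟨r, rfl⟩ := h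
  rw [mul_comm, aeval_shift_mul_apply, hw, map_zero]

theorem aeval_shift_X_sub_C (l : F) (w : ℕ → F) (n : ℕ) :
    aeval (shift F) (X - C l) w n = w (n + 1) - l * w n := by
  simp [Algebra.algebraMap_eq_smul_one]

/-- The recurrence whose characteristic polynomial is a given monic polynomial. -/
def recurrenceOf (p : F[X]) : LinearRecurrence F where
  order := p.natDegree
  coeffs i := -p.coeff i

theorem charPoly_recurrenceOf {p : F[X]} (hp : p.Monic) : (recurrenceOf p).charPoly = p := by
  conv_rhs => rw [p.as_sum_range_C_mul_X_pow, Finset.sum_range_succ, ← leadingCoeff,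
    hp.leadingCoeff]
  simp only [LinearRecurrence.charPoly, recurrenceOf, ← C_mul_X_pow_eq_monomial]
  rw [← Fin.sum_univ_eq_sum_range (fun i => C (p.coeff i) * X ^ i)]
  simp only [map_neg, neg_mul, Finset.sum_neg_distrib, sub_neg_eq_add, map_one, one_mul]
  exact add_comm _ _

/-- This makes sequences a module over polynomials in the shift, so that divisibility, coprimality
and minimality can be used on recurrences. -/
theorem isSolution_iff (E : LinearRecurrence F) (w : ℕ → F) :
    E.IsSolution w ↔ aeval (shift F) E.charPoly w = 0 := by
  rw [funext_iff]
  refine forall_congr' fun n => ?_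
  simp only [LinearRecurrence.charPoly, map_sub, map_sum, aeval_monomial, LinearMap.sub_apply,
    LinearMap.sum_apply, Module.End.mul_apply, Pi.sub_apply, Finset.sum_apply, Pi.zero_apply,
    Algebra.algebraMap_eq_smul_one, LinearMap.smul_apply, Module.End.one_apply, Pi.smul_apply,
    shift_pow_apply, smul_eq_mul, one_mul, sub_eq_zero]

theorem isSolution_recurrenceOf {p : F[X]} (hp : p.Monic) {w : ℕ → F}
    (hw : aeval (shift F) p w = 0) : (recurrenceOf p).IsSolution w := by
  rw [isSolution_iff, charPoly_recurrenceOf hp, hw]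

/-- A sequence annihilated by a monic polynomial vanishes if its first terms do. -/
theorem eq_zero_of_aeval_shift {p : F[X]} (hp : p.Monic) {w : ℕ → F}
    (hw : aeval (shift F) p w = 0) (h0 : ∀ n < p.natDegree, w n = 0) : w = 0 := by
  have h := isSolution_recurrenceOf hp hw
  rw [(recurrenceOf p).eq_iff_eqOn_range_order w 0 h (recurrenceOf p).solSpace.zero_mem]
  intro n hn
  exact h0 n (by simpa [recurrenceOf] using hn)

/-! ### Exponential polynomials -/

/-- Pascal's rule: the shift minus `l` lowers the degree of the binomial coefficient by one, up to
the factor `l`. -/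
theorem choose_mul_pow_step (l : F) (e n : ℕ) :
    ((n + 1).choose (e + 1) : F) * l ^ (n + 1) - l * ((n.choose (e + 1) : F) * l ^ n) =
      l * ((n.choose e : F) * l ^ n) := by
  rw [Nat.choose_succ_succ]; push_cast; ring

theorem aeval_shift_choose_mul_pow (l : F) (e : ℕ) :
    aeval (shift F) ((X - C l) ^ (e + 1)) (fun n => (n.choose e : F) * l ^ n) = 0 := by
  induction e with
  | zero =>
    funext n
    rw [zero_add, pow_one, aeval_shift_X_sub_C]
    simp only [Nat.choose_zero_right, Nat.cast_one, one_mul, Pi.zero_apply]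
    ring
  | succ e ih =>
    have h : aeval (shift F) (X - C l) (fun n => (n.choose (e + 1) : F) * l ^ n) =
        l • fun n => (n.choose e : F) * l ^ n := by
      funext n
      rw [aeval_shift_X_sub_C, choose_mul_pow_step]
      rfl
    rw [pow_succ, aeval_shift_mul_apply, h, map_smul, ih, smul_zero]

theorem aeval_shift_choose_mul_pow_of_lt {l : F} {e a : ℕ} (h : e < a) :
    aeval (shift F) ((X - C l) ^ a) (fun n => (n.choose e : F) * l ^ n) = 0 :=
  aeval_shift_eq_zero_of_dvd (pow_dvd_pow _ h) (aeval_shift_choose_mul_pow l e)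

/-- Induction on `a`: the image of `w` under the shift minus `l` is known, and `choose_mul_pow_step`
provides a preimage of it, at the price of a division by `l`. The difference `y` between `w` and
this preimage is geometric and supplies the coefficient with `e = 0`. Binomial coefficients instead
of powers of `n` keep the argument free of any assumption on the characteristic. -/
theorem exists_coeff_of_aeval_shift_pow {l : F} (hl : l ≠ 0) {a : ℕ} {w : ℕ → F}
    (hw : aeval (shift F) ((X - C l) ^ a) w = 0) :
    ∃ b : ℕ → F, ∀ n, w n = ∑ e ∈ Finset.range a, b e * ((n.choose e : F) * l ^ n) := by
  induction a generalizing w with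
  | zero =>
    refine ⟨0, fun n => ?_⟩
    rw [pow_zero, map_one] at hw
    simpa using congrFun hw n
  | succ a ih =>
    rw [pow_succ, aeval_shift_mul_apply] at hw
    obtain ⟨b, hb⟩ := ih hw
    simp_rw [aeval_shift_X_sub_C] at hb
    set y : ℕ → F := fun n =>
      w n - ∑ e ∈ Finset.range a, b e / l * ((n.choose (e + 1) : F) * l ^ n) with hy
    have hstep : ∀ n, y (n + 1) = l * y n := by
      intro n
      have h2 : ∑ e ∈ Finset.range a, b e / l * (((n + 1).choose (e + 1) : F) * l ^ (n + 1)) -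
          l * ∑ e ∈ Finset.range a, b e / l * ((n.choose (e + 1) : F) * l ^ n) =
          ∑ e ∈ Finset.range a, b e * ((n.choose e : F) * l ^ n) := by
        rw [Finset.mul_sum, ← Finset.sum_sub_distrib]
        refine Finset.sum_congr rfl fun e _ => ?_
        calc _ = b e / l * (((n + 1).choose (e + 1) : F) * l ^ (n + 1) -
              l * ((n.choose (e + 1) : F) * l ^ n)) := by ring
          _ = _ := by rw [choose_mul_pow_step]; field_simp
      simp only [hy]
      linear_combination hb n - h2
    have hgeom : ∀ n, y n = y 0 * l ^ n := by
      intro n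
      induction n with
      | zero => simp
      | succ n ihn => rw [hstep, ihn]; ring
    refine ⟨fun e => Nat.casesOn e (y 0) fun e => b e / l, fun n => ?_⟩
    rw [Finset.sum_range_succ']
    have := hgeom n
    rw [Nat.choose_zero_right, Nat.cast_one, one_mul]
    change w n = ∑ e ∈ Finset.range a, b e / l * ((n.choose (e + 1) : F) * l ^ n) + y 0 * l ^ n
    rw [← this]
    simp only [hy]
    ring

/-- The kernel of a product of coprime polynomials in an operator is the sum of the kernels of the
factors; powers of distinct linear factors are coprime. -/
theorem exists_decomposition_of_aeval_shift (s : Finset F) (a : F → ℕ) {w : ℕ → F}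
    (hw : aeval (shift F) (∏ l ∈ s, (X - C l) ^ a l) w = 0) :
    ∃ W : F → ℕ → F, w = ∑ l ∈ s, W l ∧
      ∀ l ∈ s, aeval (shift F) ((X - C l) ^ a l) (W l) = 0 := by
  classical
  induction s using Finset.induction_on generalizing w with
  | empty => exact ⟨0, by simpa using hw, by simp⟩
  | insert l s hl ih =>
    rw [Finset.prod_insert hl] at hw
    have hcop : IsCoprime ((X - C l) ^ a l) (∏ m ∈ s, (X - C m) ^ a m) := by
      refine IsCoprime.prod_right fun m hm => ?_
      refine IsCoprime.pow ?_
      exact isCoprime_X_sub_C_of_isUnit_sub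
        (sub_ne_zero.2 (ne_of_mem_of_not_mem hm hl).symm).isUnit
    have hmem : w ∈ LinearMap.ker (aeval (shift F) ((X - C l) ^ a l)) ⊔
        LinearMap.ker (aeval (shift F) (∏ m ∈ s, (X - C m) ^ a m)) := by
      rw [sup_ker_aeval_eq_ker_aeval_mul_of_coprime _ hcop]
      exact hw
    obtain ⟨y, hy, z, hz, rfl⟩ := Submodule.mem_sup.1 hmem
    obtain ⟨W, hW, hW'⟩ := ih hz
    refine ⟨fun m => if m = l then y else W m, ?_, ?_⟩
    · rw [Finset.sum_insert hl, if_pos rfl, hW]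
      congr 1
      refine Finset.sum_congr rfl fun m hm => ?_
      rw [if_neg (ne_of_mem_of_not_mem hm hl)]
    · intro m hm
      rcases Finset.mem_insert.1 hm with rfl | hm
      · simpa using hy
      · simp only [if_neg (ne_of_mem_of_not_mem hm hl)]
        exact hW' m hm

end Shift

/-! ### Rational sequences in larger fields -/

section Rational

variable {F : Type*} [Field F] [Algebra ℚ F]

/-- A rational sequence, seen in a larger field. -/
def castSeq (F : Type*) [Field F] [Algebra ℚ F] (u : ℕ → ℚ) : ℕ → F :=
  fun n => algebraMap ℚ F (u n)

theorem aeval_shift_castSeq (p : ℚ[X]) (u : ℕ → ℚ) :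
    aeval (shift F) (p.map (algebraMap ℚ F)) (castSeq F u) =
      castSeq F (aeval (shift ℚ) p u) := by
  funext n
  simp only [aeval_shift_apply, castSeq, natDegree_map, coeff_map, map_sum, map_mul]

/-- A rational sequence that satisfies a recurrence over a larger field satisfies a rational
recurrence of the same order. -/
theorem exists_rational_annihilator {p : F[X]} (hp : p.Monic) {u : ℕ → ℚ}
    (hu : aeval (shift F) p (castSeq F u) = 0) :
    ∃ q : ℚ[X], q.Monic ∧ q.natDegree = p.natDegree ∧ aeval (shift ℚ) q u = 0 := by
  -- A `ℚ`-linear retraction of `F` onto `ℚ` is applied to every coefficient. It fixes the leading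
  -- coefficient `1` and respects the relation, because the terms of `u` are rational scalars.
  obtain ⟨φ, hφ⟩ := (Algebra.linearMap ℚ F).exists_leftInverse_of_injective
    (LinearMap.ker_eq_bot.2 (algebraMap ℚ F).injective)
  have hφ' : ∀ x : ℚ, φ (algebraMap ℚ F x) = x := fun x => LinearMap.congr_fun hφ x
  set q : ℚ[X] := ∑ i ∈ Finset.range (p.natDegree + 1), monomial i (φ (p.coeff i)) with hq
  have hcoeff : ∀ i, q.coeff i = φ (p.coeff i) := by
    intro i
    rw [hq, finsetSum_coeff]
    simp only [coeff_monomial, Finset.sum_ite_eq', Finset.mem_range]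
    split_ifs with h
    · rfl
    · rw [coeff_eq_zero_of_natDegree_lt (by omega), map_zero]
  have hlead : q.coeff p.natDegree = 1 := by
    rw [hcoeff, ← leadingCoeff, hp.leadingCoeff, ← (algebraMap ℚ F).map_one, hφ']
  have hdeg : q.natDegree = p.natDegree := by
    refine le_antisymm ?_ (le_natDegree_of_ne_zero (by rw [hlead]; exact one_ne_zero))
    refine natDegree_le_iff_coeff_eq_zero.2 fun N hN => ?_
    rw [hcoeff, coeff_eq_zero_of_natDegree_lt hN, map_zero]
  refine ⟨q, ?_, hdeg, ?_⟩
  · rw [Monic, leadingCoeff, hdeg, hlead]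
  · funext n
    have h := congrArg φ (congrFun hu n)
    rw [aeval_shift_apply, map_sum] at h
    rw [aeval_shift_apply, hdeg]
    simp only [Pi.zero_apply, map_zero] at h ⊢
    rw [← h]
    refine Finset.sum_congr rfl fun i _ => ?_
    rw [hcoeff, castSeq, mul_comm (p.coeff i), ← Algebra.smul_def, map_smul, smul_eq_mul, mul_comm]

/-- Annihilators over `F` descend to rational ones of the same degree, so a larger field does not
permit a shorter recurrence. -/
theorem IsMinimalRecurrence.order_le {E : LinearRecurrence ℚ} {u : ℕ → ℚ}
    (hE : IsMinimalRecurrence E u) {p : F[X]} (hp : p.Monic)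
    (hu : aeval (shift F) p (castSeq F u) = 0) : E.order ≤ p.natDegree := by
  obtain ⟨q, hq, hdeg, hqu⟩ := exists_rational_annihilator hp hu
  rw [← hdeg]
  exact hE.2 _ (isSolution_recurrenceOf hq hqu)

theorem exists_isMinimalRecurrence {p : F[X]} (hp : p.Monic) {u : ℕ → ℚ}
    (hu : aeval (shift F) p (castSeq F u) = 0) : ∃ E, IsMinimalRecurrence E u := by
  obtain ⟨q, hq, -, hqu⟩ := exists_rational_annihilator hp hu
  classical
  have hex : ∃ n, ∃ E : LinearRecurrence ℚ, E.IsSolution u ∧ E.order = n :=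
    ⟨_, _, isSolution_recurrenceOf hq hqu, rfl⟩
  obtain ⟨E, hE, hn⟩ := Nat.find_spec hex
  exact ⟨E, hE, fun E' hE' => hn.le.trans (Nat.find_min' hex ⟨E', hE', rfl⟩)⟩

theorem natDegree_charPoly (E : LinearRecurrence ℚ) : E.charPoly.natDegree = E.order :=
  natDegree_eq_of_degree_eq_some E.charPoly_degree_eq_order

theorem aeval_shift_charPoly_castSeq {E : LinearRecurrence ℚ} {u : ℕ → ℚ} (hE : E.IsSolution u) :
    aeval (shift F) (E.charPoly.map (algebraMap ℚ F)) (castSeq F u) = 0 := by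
  rw [aeval_shift_castSeq, (isSolution_iff E u).1 hE]
  funext n
  simp [castSeq]

/-- The minimal characteristic polynomial does not vanish at zero if some annihilating
polynomial does not. -/
theorem IsMinimalRecurrence.eval_zero_ne_zero {E : LinearRecurrence ℚ} {u : ℕ → ℚ}
    (hE : IsMinimalRecurrence E u) {g : F[X]} (hg0 : g.eval 0 ≠ 0)
    (hu : aeval (shift F) g (castSeq F u) = 0) :
    (E.charPoly.map (algebraMap ℚ F)).eval 0 ≠ 0 := by
  intro h0
  set p := E.charPoly.map (algebraMap ℚ F) with hp
  have hpm : p.Monic := E.charPoly_monic.map _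
  obtain ⟨q, hq⟩ : X ∣ p := by rw [X_dvd_iff, coeff_zero_eq_eval_zero, h0]
  have hqm : q.Monic := by
    rw [hq, mul_comm] at hpm
    exact monic_X.of_mul_monic_right hpm
  -- Bézout's identity for `X` and `g` writes `q` as a combination of the annihilators `X * q` and
  -- `g`. So `q` annihilates as well, in degree one less than the minimum.
  have hcop : IsCoprime (X : F[X]) g := by
    rw [Irreducible.coprime_iff_not_dvd irreducible_X, X_dvd_iff, coeff_zero_eq_eval_zero]
    exact hg0
  have hq0 : aeval (shift F) q (castSeq F u) = 0 := by
    obtain ⟨a, b, hab⟩ := hcop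
    have h1 : aeval (shift F) (a * p + b * q * g) (castSeq F u) = 0 := by
      rw [map_add, LinearMap.add_apply, aeval_shift_mul_apply, aeval_shift_mul_apply,
        hp, aeval_shift_charPoly_castSeq hE.1, hu, map_zero, map_zero, add_zero]
    have h2 : a * p + b * q * g = q := by
      rw [hq]; linear_combination q * hab
    rwa [h2] at h1
  have hle := hE.order_le hqm hq0
  have hdeg : p.natDegree = q.natDegree + 1 := by
    rw [hq, monic_X.natDegree_mul hqm, natDegree_X, add_comm]
  rw [hp, natDegree_map, natDegree_charPoly] at hdeg
  omega

end Rational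

end LRS

namespace LRS

open Polynomial

/-! ### The decomposition of a rational sequence along its roots -/

/-- The exponential polynomial with coefficients `b l e` for the functions `C(n, e) * l ^ n`. -/
def expPoly {F : Type*} [Field F] (R : Finset F) (A : ℕ) (b : F → ℕ → F) (n : ℕ) : F :=
  ∑ l ∈ R, ∑ e ∈ Finset.range A, b l e * ((n.choose e : F) * l ^ n)

/-- The divisibility is required only at those `l` that occur with a non-zero coefficient. This is
what allows a root without coefficients to be removed from an annihilator. -/
theorem aeval_shift_expPoly_eq_zero {F : Type*} [Field F] (R : Finset F) {A : ℕ}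
    {b : F → ℕ → F} {a : F → ℕ} (hb : ∀ l ∈ R, ∀ e, a l ≤ e → b l e = 0) {p : F[X]}
    (hp : ∀ l ∈ R, (∃ e < A, b l e ≠ 0) → (X - C l) ^ a l ∣ p) :
    aeval (shift F) p (expPoly R A b) = 0 := by
  have h : expPoly R A b = ∑ l ∈ R, ∑ e ∈ Finset.range A,
      b l e • fun n : ℕ => ((n.choose e : F) * l ^ n) := by
    funext n
    simp [expPoly]
  rw [h, map_sum]
  refine Finset.sum_eq_zero fun l hl => ?_
  rw [map_sum]
  refine Finset.sum_eq_zero fun e he => ?_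
  rw [map_smul]
  by_cases h0 : b l e = 0
  · rw [h0, zero_smul]
  · have hlt : e < a l := by
      by_contra hge
      exact h0 (hb l hl e (not_lt.1 hge))
    rw [aeval_shift_eq_zero_of_dvd (hp l hl ⟨e, Finset.mem_range.1 he, h0⟩)
      (aeval_shift_choose_mul_pow_of_lt hlt), smul_zero]

theorem exists_expPoly {F : Type*} [Field F] [IsAlgClosed F] [DecidableEq F] {p : F[X]}
    (hp : p.Monic)
    (hp0 : p.eval 0 ≠ 0) {w : ℕ → F} (hw : aeval (shift F) p w = 0) :
    ∃ (A : ℕ) (b : F → ℕ → F), w = expPoly p.roots.toFinset A b ∧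
      (∀ l e, p.rootMultiplicity l ≤ e → b l e = 0) := by
  classical
  have hprod : p = ∏ l ∈ p.roots.toFinset, (X - C l) ^ p.rootMultiplicity l := by
    conv_lhs => rw [(IsAlgClosed.splits p).eq_prod_roots_of_monic hp]
    rw [Finset.prod_multiset_map_count]
    simp [count_roots]
  rw [hprod] at hw
  obtain ⟨W, hW, hW'⟩ := exists_decomposition_of_aeval_shift _ _ hw
  have hne : ∀ l ∈ p.roots.toFinset, l ≠ 0 := by
    rintro l hl rfl
    rw [Multiset.mem_toFinset, mem_roots hp.ne_zero] at hl
    exact hp0 hl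
  have hex : ∀ l, ∃ b : ℕ → F, l ∈ p.roots.toFinset → ∀ n, W l n =
      ∑ e ∈ Finset.range (p.rootMultiplicity l), b e * ((n.choose e : F) * l ^ n) := by
    intro l
    by_cases hl : l ∈ p.roots.toFinset
    · obtain ⟨b, hb⟩ := exists_coeff_of_aeval_shift_pow (hne l hl) (hW' l hl)
      exact ⟨b, fun _ => hb⟩
    · exact ⟨0, fun h => absurd h hl⟩
  choose b hb using hex
  -- The degree bounds all multiplicities, so one range of exponents serves all roots; coefficients
  -- beyond the multiplicity are filled up with zeros.
  refine ⟨p.natDegree, fun l e => if e < p.rootMultiplicity l then b l e else 0, ?_, ?_⟩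
  · rw [hW]
    funext n
    rw [expPoly, Finset.sum_apply]
    refine Finset.sum_congr rfl fun l hl => ?_
    rw [hb l hl n]
    have hle : p.rootMultiplicity l ≤ p.natDegree := by
      rw [← count_roots]
      exact (Multiset.count_le_card _ _).trans (card_roots' p)
    rw [← Finset.sum_subset (Finset.range_subset_range.2 hle)]
    · refine Finset.sum_congr rfl fun e he => ?_
      rw [if_pos (Finset.mem_range.1 he)]
    · intro e _ he
      rw [if_neg (by simpa using he), zero_mul]
  · intro l e h
    simp only [if_neg (not_lt.2 h)]

open ComplexConjugate in
/-- The decomposition of a rational linear recurrence sequence along its roots, with algebraic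
coefficients and compatible with complex conjugation. -/
theorem IsMinimalRecurrence.exists_decomposition {E : LinearRecurrence ℚ} {u : ℕ → ℚ}
    (hE : IsMinimalRecurrence E u)
    (h0 : (E.charPoly.map (algebraMap ℚ ℂ)).eval 0 ≠ 0) :
    ∃ (R : Finset ℂ) (A : ℕ) (b : ℂ → ℕ → ℂ), castSeq ℂ u = expPoly R A b ∧
      (∀ l, l ∈ R ↔ aeval l E.charPoly = 0) ∧ (∀ l ∈ R, l ≠ 0 ∧ IsAlgebraic ℚ l) ∧
      (∀ l e, IsAlgebraic ℚ (b l e)) ∧ (∀ l e, b (conj l) e = conj (b l e)) ∧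
      (∀ l, l ∉ R → ∀ e, b l e = 0) ∧ (∀ l ∈ R, ∃ e < A, b l e ≠ 0) := by
  classical
  have : Algebra.IsAlgebraic ℚ (AlgebraicClosure ℚ) := by
    convert AlgebraicClosure.isAlgebraic ℚ
    · rfl
    · exact Subsingleton.elim _ _
  -- The decomposition is made over the algebraic closure of `ℚ` and transported to `ℂ`, which makes
  -- all coefficients algebraic at no cost.
  let ι : AlgebraicClosure ℚ →ₐ[ℚ] ℂ := IsAlgClosed.lift
  have hι : Function.Injective ι := ι.toRingHom.injective
  set p : ℂ[X] := E.charPoly.map (algebraMap ℚ ℂ) with hp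
  set q : (AlgebraicClosure ℚ)[X] := E.charPoly.map (algebraMap ℚ (AlgebraicClosure ℚ)) with hq
  have hqp : q.map ι.toRingHom = p := by
    rw [hq, hp, Polynomial.map_map]
    congr 1
    exact ι.comp_algebraMap
  have hpm : p.Monic := E.charPoly_monic.map _
  have hqm : q.Monic := E.charPoly_monic.map _
  have hq0 : q.eval 0 ≠ 0 := by
    intro h
    apply h0
    rw [← hqp, ← map_zero ι.toRingHom, eval_map_apply, h, map_zero]
  obtain ⟨A, b, hw, hb⟩ := exists_expPoly hqm hq0
    (aeval_shift_charPoly_castSeq (F := AlgebraicClosure ℚ) hE.1)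
  have hmult : ∀ l : AlgebraicClosure ℚ, p.rootMultiplicity (ι l) = q.rootMultiplicity l := by
    intro l
    rw [← hqp]
    exact (eq_rootMultiplicity_map hι l).symm
  have hconjp : p.map (starRingEnd ℂ) = p := by
    rw [hp, Polynomial.map_map]
    congr 1
    exact Subsingleton.elim _ _
  have hmultc : ∀ l : ℂ, p.rootMultiplicity (conj l) = p.rootMultiplicity l := by
    intro l
    conv_lhs => rw [← hconjp]
    exact (eq_rootMultiplicity_map (starRingEnd ℂ).injective l).symm
  set R : Finset ℂ := p.roots.toFinset with hR
  have hRroot : ∀ l, l ∈ R ↔ aeval l E.charPoly = 0 := by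
    intro l
    rw [hR, Multiset.mem_toFinset, mem_roots hpm.ne_zero, Polynomial.IsRoot, hp,
      eval_map_algebraMap]
  have hRconj : ∀ l, conj l ∈ R ↔ l ∈ R := by
    intro l
    rw [hR, Multiset.mem_toFinset, Multiset.mem_toFinset, ← Multiset.count_pos,
      ← Multiset.count_pos, count_roots, count_roots, hmultc]
  have hRq : R = q.roots.toFinset.map ⟨ι, hι⟩ := by
    ext l
    simp only [Finset.mem_map, Multiset.mem_toFinset, Function.Embedding.coeFn_mk]
    rw [hRroot]
    constructor
    · intro hl
      have hl' : l ∈ (q.map ι.toRingHom).roots := by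
        rw [hqp, mem_roots hpm.ne_zero, Polynomial.IsRoot, hp,
      eval_map_algebraMap, hl]
      rw [(IsAlgClosed.splits q).roots_map] at hl'
      obtain ⟨x, hx, hx'⟩ := Multiset.mem_map.1 hl'
      exact ⟨x, hx, hx'⟩
    · rintro ⟨x, hx, rfl⟩
      rw [mem_roots hqm.ne_zero, Polynomial.IsRoot, hq, eval_map_algebraMap] at hx
      have := aeval_algHom_apply ι x E.charPoly
      rw [this, hx, map_zero]
  have hw' : castSeq ℂ u = expPoly R A (fun l e => ι (b (Function.invFun ι l) e)) := by
    funext n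
    have := congrArg ι (congrFun hw n)
    rw [castSeq, AlgHom.commutes] at this
    rw [castSeq, this, hRq, expPoly, expPoly, Finset.sum_map, map_sum]
    refine Finset.sum_congr rfl fun l _ => ?_
    rw [map_sum]
    refine Finset.sum_congr rfl fun e _ => ?_
    simp [Function.leftInverse_invFun hι l]
  set b₁ : ℂ → ℕ → ℂ := fun l e => if l ∈ R then ι (b (Function.invFun ι l) e) else 0 with hb₁
  have hw₁ : castSeq ℂ u = expPoly R A b₁ := by
    rw [hw']
    funext n
    rw [expPoly, expPoly]
    refine Finset.sum_congr rfl fun l hl => Finset.sum_congr rfl fun e _ => ?_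
    simp only [hb₁]
    rw [if_pos hl]
  have hb₁0 : ∀ l e, p.rootMultiplicity l ≤ e → b₁ l e = 0 := by
    intro l e h
    simp only [hb₁]
    split_ifs with hl
    · rw [hRq] at hl
      obtain ⟨x, _, rfl⟩ := Finset.mem_map.1 hl
      simp only [Function.Embedding.coeFn_mk] at h ⊢
      rw [Function.leftInverse_invFun hι x, hb, map_zero]
      rwa [← hmult]
    · rfl
  have halg : ∀ x : AlgebraicClosure ℚ, IsAlgebraic ℚ (ι x) := fun x =>
    (Algebra.IsAlgebraic.isAlgebraic x).algHom ι
  have hb₁alg : ∀ l e, IsAlgebraic ℚ (b₁ l e) := by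
    intro l e
    simp only [hb₁]
    split_ifs
    · exact halg _
    · exact isAlgebraic_zero
  have hconjalg : ∀ z : ℂ, IsAlgebraic ℚ z → IsAlgebraic ℚ (conj z) := fun z hz =>
    hz.algHom (Complex.conjAe.toAlgHom.restrictScalars ℚ)
  -- Since `u` is real, the conjugated coefficients represent `u` too. The mean of both
  -- representations is symmetric under conjugation, so uniqueness of the coefficients is not
  -- needed.
  set B : ℂ → ℕ → ℂ := fun l e => (b₁ l e + conj (b₁ (conj l) e)) / 2 with hB
  have hB0 : ∀ l ∈ R, ∀ e, p.rootMultiplicity l ≤ e → B l e = 0 := by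
    intro l _ e h
    simp only [hB]
    rw [hb₁0 l e h, hb₁0 (conj l) e (by rwa [hmultc])]
    simp
  have hwB : castSeq ℂ u = expPoly R A B := by
    funext n
    have h1 := congrFun hw₁ n
    have h2 : castSeq ℂ u n = expPoly R A (fun l e => conj (b₁ (conj l) e)) n := by
      have h3 : castSeq ℂ u n = conj (castSeq ℂ u n) := by simp [castSeq]
      rw [h3, h1, expPoly, expPoly, map_sum]
      refine Finset.sum_nbij' (fun l => conj l) (fun l => conj l) ?_ ?_ ?_ ?_ ?_
      · intro l hl; exact (hRconj l).2 hl
      · intro l hl; exact (hRconj l).2 hl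
      · intro l _; simp
      · intro l _; simp
      · intro l _
        simp
    have h4 : castSeq ℂ u n = (castSeq ℂ u n + castSeq ℂ u n) / 2 := by ring
    rw [h4]
    nth_rewrite 1 [h1]
    rw [h2]
    simp only [expPoly, hB]
    rw [← Finset.sum_add_distrib, Finset.sum_div]
    refine Finset.sum_congr rfl fun l _ => ?_
    rw [← Finset.sum_add_distrib, Finset.sum_div]
    refine Finset.sum_congr rfl fun e _ => ?_
    ring
  refine ⟨R, A, B, hwB, hRroot, ?_, ?_, ?_, ?_, ?_⟩
  · intro l hl
    refine ⟨?_, ?_⟩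
    · rintro rfl
      rw [hRroot] at hl
      apply h0
      rw [eval_map_algebraMap, hl]
    · rw [hRq] at hl
      obtain ⟨x, _, rfl⟩ := Finset.mem_map.1 hl
      exact halg x
  · intro l e
    simp only [hB]
    rw [div_eq_mul_inv]
    refine ((hb₁alg _ _).add (hconjalg _ (hb₁alg _ _))).mul ?_
    exact IsAlgebraic.inv (by exact_mod_cast isAlgebraic_natCast (R := ℚ) (A := ℂ) 2)
  · intro l e
    simp only [hB]
    simp [add_comm, map_div₀, Complex.conj_ofNat]
  · intro l hl e
    have hl' : conj l ∉ R := by rwa [hRconj]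
    simp [hB, hb₁, hl, hl']
  · intro l hl
    -- If all coefficients at `l` were zero, the characteristic polynomial divided by `X - C l`
    -- would still annihilate `u`, against minimality.
    by_contra hcon
    push Not at hcon
    obtain ⟨g, hg⟩ : (X - C l) ∣ p := by
      rw [dvd_iff_isRoot]
      rw [hR, Multiset.mem_toFinset, mem_roots hpm.ne_zero] at hl
      exact hl
    have hgm : g.Monic := by
      rw [hg] at hpm
      exact (monic_X_sub_C l).of_mul_monic_left hpm
    have hkill : aeval (shift ℂ) g (castSeq ℂ u) = 0 := by
      rw [hwB]
      refine aeval_shift_expPoly_eq_zero R hB0 fun m hm hne => ?_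
      have hml : m ≠ l := by
        rintro rfl
        obtain ⟨e, he, hne⟩ := hne
        exact hne (hcon e he)
      have hcop : IsCoprime ((X - C m) ^ p.rootMultiplicity m) (X - C l) :=
        IsCoprime.pow_left (isCoprime_X_sub_C_of_isUnit_sub (sub_ne_zero.2 hml).isUnit)
      refine hcop.dvd_of_dvd_mul_left ?_
      rw [← hg]
      exact pow_rootMultiplicity_dvd p m
    have hle := hE.order_le hgm hkill
    have hdeg : p.natDegree = 1 + g.natDegree := by
      rw [hg, (monic_X_sub_C l).natDegree_mul hgm, natDegree_X_sub_C]
    rw [hp, natDegree_map, natDegree_charPoly] at hdeg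
    omega

end LRS

namespace LRS

/-! ### Dominant forms -/

theorem HasDensity.congr {S S' : Set ℕ} {δ : ℝ} (h : HasDensity S δ)
    (hS : ∀ᶠ n in atTop, n ∈ S ↔ n ∈ S') : HasDensity S' δ := by
  rw [hasDensity_iff] at h
  refine hasDensity_of_sandwich fun ε hε =>
    ⟨_, _, δ, δ, by linarith, by linarith, h, h, ?_⟩
  filter_upwards [hS] with n hn
  by_cases hn' : n ∈ S
  · simp [hn', hn.1 hn']
  · have hmem : n ∉ S' := fun h => hn' (hn.2 h)
    simp [hn', hmem]

/-- The sequence `C(n, e) * Re (b * μ ^ n)` of a triple `(e, b, μ)`. -/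
noncomputable def termSeq (t : ℕ × ℂ × ℂ) (n : ℕ) : ℝ :=
  (n.choose t.1 : ℝ) * (t.2.1 * t.2.2 ^ n).re

/-- The sequence `x` is `C(n, d) * ρ ^ n * (c * σ ^ n + Re (b * ω ^ n))`, with `ω` on the unit
circle and no root of unity, up to terms of smaller growth. -/
structure IsDominantForm (x : ℕ → ℝ) (σ : ℝ) (d : ℕ) (ρ c : ℝ) (b ω : ℂ)
    (ts : List (ℕ × ℂ × ℂ)) : Prop where
  pos : 0 < ρ
  norm_eq_one : ‖ω‖ = 1
  ne_zero : c ≠ 0 ∨ b ≠ 0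
  pow_ne_one : b ≠ 0 → ∀ n : ℕ, 0 < n → ω ^ n ≠ 1
  negligible : ∀ t ∈ ts, ‖t.2.2‖ < ρ ∨ (‖t.2.2‖ = ρ ∧ t.1 < d)
  eq : ∀ n, x n = (n.choose d : ℝ) * ρ ^ n * (c * σ ^ n + (b * ω ^ n).re) +
    (ts.map fun t => termSeq t n).sum

theorem tendsto_choose_div_pow (d : ℕ) :
    Tendsto (fun n : ℕ => (n.choose d : ℝ) / (n : ℝ) ^ d) atTop (𝓝 (1 / d.factorial)) := by
  induction d with
  | zero => simp
  | succ d ih =>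
    have h : Tendsto (fun n : ℕ => (n.choose d : ℝ) / (n : ℝ) ^ d *
        ((1 - (d : ℝ) / n) * (1 / ((d : ℝ) + 1)))) atTop
        (𝓝 (1 / d.factorial * ((1 - 0) * (1 / ((d : ℝ) + 1))))) :=
      ih.mul ((tendsto_const_nhds.sub (tendsto_const_div_atTop_nhds_zero_nat (d : ℝ))).mul
        tendsto_const_nhds)
    have h2 : 1 / ((d + 1).factorial : ℝ) = 1 / d.factorial * ((1 - 0) * (1 / ((d : ℝ) + 1))) := by
      rw [Nat.factorial_succ]
      push_cast
      field_simp
      ring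
    rw [h2]
    refine h.congr' ?_
    filter_upwards [eventually_ge_atTop (d + 1)] with n hn
    have hn0 : (n : ℝ) ≠ 0 := by
      have : 0 < n := by omega
      exact_mod_cast this.ne'
    have key : (n.choose (d + 1) : ℝ) * (d + 1) = n.choose d * (n - d) := by
      have := Nat.choose_succ_right_eq n d
      have h3 : ((n - d : ℕ) : ℝ) = n - d := by
        rw [Nat.cast_sub (by omega)]
      rw [← h3]
      exact_mod_cast this
    have hd : (d : ℝ) + 1 ≠ 0 := by positivity
    have : (n.choose (d + 1) : ℝ) = n.choose d * (n - d) / (d + 1) := by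
      rw [← key]; field_simp
    rw [this]
    field_simp
    ring

/-- The quotient is bounded by `‖b‖ * (n ^ e / n ^ d) * (‖μ‖ / ρ) ^ n`. If `‖μ‖ < ρ`, geometric
decay beats the power `n ^ e`; if `‖μ‖ = ρ` and `e < d`, a factor of at most `1 / n` remains. -/
theorem tendsto_termSeq_div {t : ℕ × ℂ × ℂ} {ρ : ℝ} {d : ℕ} (hρ : 0 < ρ)
    (ht : ‖t.2.2‖ < ρ ∨ (‖t.2.2‖ = ρ ∧ t.1 < d)) :
    Tendsto (fun n : ℕ => termSeq t n / ((n : ℝ) ^ d * ρ ^ n)) atTop (𝓝 0) := by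
  obtain ⟨e, b, μ⟩ := t
  simp only at ht
  have hbound : ∀ n : ℕ, ‖termSeq (e, b, μ) n / ((n : ℝ) ^ d * ρ ^ n)‖ ≤
      ‖b‖ * ((n : ℝ) ^ e / (n : ℝ) ^ d * (‖μ‖ / ρ) ^ n) := by
    intro n
    rw [termSeq, norm_div, norm_mul, Real.norm_of_nonneg (by positivity : (0 : ℝ) ≤ n.choose e),
      Real.norm_of_nonneg (by positivity : (0 : ℝ) ≤ (n : ℝ) ^ d * ρ ^ n)]
    have h1 : ‖(b * μ ^ n).re‖ ≤ ‖b‖ * ‖μ‖ ^ n := by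
      rw [← norm_pow, ← norm_mul]
      exact Complex.abs_re_le_norm _
    have h2 : (n.choose e : ℝ) ≤ (n : ℝ) ^ e := by exact_mod_cast Nat.choose_le_pow n e
    calc (n.choose e : ℝ) * ‖(b * μ ^ n).re‖ / ((n : ℝ) ^ d * ρ ^ n)
        ≤ (n : ℝ) ^ e * (‖b‖ * ‖μ‖ ^ n) / ((n : ℝ) ^ d * ρ ^ n) := by gcongr
      _ = _ := by rw [div_pow]; ring
  refine squeeze_zero_norm hbound ?_
  rw [show (0 : ℝ) = ‖b‖ * 0 by ring]
  refine Tendsto.const_mul _ ?_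
  rcases ht with h | ⟨h, hed⟩
  · have hq : |‖μ‖ / ρ| < 1 := by
      rw [abs_of_nonneg (by positivity), div_lt_one hρ]; exact h
    refine squeeze_zero' (Eventually.of_forall fun n => by positivity) ?_
      (tendsto_pow_const_mul_const_pow_of_abs_lt_one e hq)
    filter_upwards [eventually_ge_atTop 1] with n hn
    have hn1 : (1 : ℝ) ≤ n := by exact_mod_cast hn
    gcongr
    exact div_le_self (by positivity) (one_le_pow₀ hn1)
  · rw [h, div_self hρ.ne']
    simp only [one_pow, mul_one]
    refine squeeze_zero' (Eventually.of_forall fun n => by positivity) ?_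
      (tendsto_const_div_atTop_nhds_zero_nat 1)
    filter_upwards [eventually_ge_atTop 1] with n hn
    have hn1 : (1 : ℝ) ≤ n := by exact_mod_cast hn
    rw [div_le_div_iff₀ (by positivity) (by positivity), one_mul, ← pow_succ]
    exact pow_le_pow_right₀ hn1 hed

theorem re_mul_pow_eq (b : ℂ) {ω : ℂ} (hω : ‖ω‖ = 1) (n : ℕ) :
    (b * ω ^ n).re = ‖b‖ * Real.cos (n * ω.arg + b.arg) := by
  have h1 : ω = Complex.exp (ω.arg * Complex.I) := by
    conv_lhs => rw [← Complex.norm_mul_exp_arg_mul_I ω, hω]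
    simp
  conv_lhs => rw [← Complex.norm_mul_exp_arg_mul_I b, h1]
  rw [← Complex.exp_nat_mul, mul_assoc, ← Complex.exp_add, Complex.re_ofReal_mul,
    show b.arg * Complex.I + n * (ω.arg * Complex.I) =
      ((n * ω.arg + b.arg : ℝ) : ℂ) * Complex.I by push_cast; ring,
    Complex.exp_ofReal_mul_I_re]

/-- If the quotient were a rational number `q`, the power of `ω` with exponent `q.den` would be `1`.
-/
theorem irrational_arg_div {ω : ℂ} (hω : ‖ω‖ = 1) (h : ∀ n : ℕ, 0 < n → ω ^ n ≠ 1) :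
    Irrational (ω.arg / (2 * Real.pi)) := by
  rintro ⟨q, hq⟩
  apply h q.den q.den_pos
  have h1 : ω = Complex.exp (ω.arg * Complex.I) := by
    conv_lhs => rw [← Complex.norm_mul_exp_arg_mul_I ω, hω]
    simp
  have h2 : ω.arg = q * (2 * Real.pi) := by rw [hq]; field_simp
  rw [h1, ← Complex.exp_nat_mul, Complex.exp_eq_one_iff]
  refine ⟨q.num, ?_⟩
  have h3 : (q.den : ℂ) * (q : ℂ) = q.num := by exact_mod_cast Rat.den_mul_eq_num q
  rw [h2]
  push_cast
  linear_combination (2 * Real.pi * Complex.I) * h3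

theorem IsDominantForm.exists_tendsto {x : ℕ → ℝ} {σ : ℝ} {d : ℕ} {ρ c : ℝ} {b ω : ℂ}
    {ts : List (ℕ × ℂ × ℂ)} (h : IsDominantForm x σ d ρ c b ω ts) (hσ : |σ| = 1) :
    ∃ θ τ : ℝ, Irrational θ ∧ Tendsto (fun n : ℕ => x n / ((n : ℝ) ^ d * ρ ^ n) -
      (c / d.factorial * σ ^ n + ‖b‖ / d.factorial * Real.cos (2 * Real.pi * (n * θ + τ))))
      atTop (𝓝 0) := by
  have hmain : Tendsto (fun n : ℕ => x n / ((n : ℝ) ^ d * ρ ^ n) -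
      1 / d.factorial * (c * σ ^ n + (b * ω ^ n).re)) atTop (𝓝 0) := by
    have h1 : Tendsto (fun n : ℕ => ((n.choose d : ℝ) / (n : ℝ) ^ d - 1 / d.factorial) *
        (c * σ ^ n + (b * ω ^ n).re)) atTop (𝓝 0) := by
      have h2 : Tendsto (fun n : ℕ => (n.choose d : ℝ) / (n : ℝ) ^ d - 1 / d.factorial)
          atTop (𝓝 0) := by
        simpa using (tendsto_choose_div_pow d).sub_const (1 / (d.factorial : ℝ))
      refine h2.zero_mul_isBoundedUnder_le ⟨|c| + ‖b‖, ?_⟩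
      rw [eventually_map]
      refine Eventually.of_forall fun n => ?_
      simp only [Function.comp]
      refine (norm_add_le _ _).trans (add_le_add ?_ ?_)
      · rw [norm_mul, norm_pow, Real.norm_eq_abs σ, hσ, one_pow, mul_one, Real.norm_eq_abs]
      · refine (Complex.abs_re_le_norm _).trans ?_
        rw [norm_mul, norm_pow, h.norm_eq_one, one_pow, mul_one]
    have h3 : Tendsto (fun n : ℕ => (ts.map fun t => termSeq t n / ((n : ℝ) ^ d * ρ ^ n)).sum)
        atTop (𝓝 0) := by
      have hts := h.negligible
      have hρ := h.pos
      clear h h1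
      induction ts with
      | nil => simp
      | cons t ts ih =>
        simp only [List.map_cons, List.sum_cons]
        rw [show (0 : ℝ) = 0 + 0 by ring]
        exact (tendsto_termSeq_div hρ (hts t (by simp))).add
          (ih fun t ht => hts t (by simp [ht]))
    have h4 := h1.add h3
    rw [add_zero] at h4
    refine h4.congr' ?_
    filter_upwards [eventually_ge_atTop 1] with n hn
    have hn0 : (n : ℝ) ^ d ≠ 0 := by
      have : (0 : ℝ) < n := by exact_mod_cast hn
      positivity
    have hρ0 : ρ ^ n ≠ 0 := pow_ne_zero _ h.pos.ne'
    rw [h.eq n, add_div]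
    have hsum : (ts.map fun t => termSeq t n / ((n : ℝ) ^ d * ρ ^ n)).sum =
        (ts.map fun t => termSeq t n).sum / ((n : ℝ) ^ d * ρ ^ n) := by
      simp only [div_eq_mul_inv]
      rw [List.sum_map_mul_right]
    rw [hsum]
    field_simp
    ring
  by_cases hb : b = 0
  -- Without an oscillating part the amplitude is zero, and any irrational number serves as `θ`.
  · refine ⟨√2, 0, irrational_sqrt_two, ?_⟩
    refine hmain.congr fun n => ?_
    simp [hb]
    ring
  · refine ⟨ω.arg / (2 * Real.pi), b.arg / (2 * Real.pi),
      irrational_arg_div h.norm_eq_one (h.pow_ne_one hb), ?_⟩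
    refine hmain.congr fun n => ?_
    rw [re_mul_pow_eq b h.norm_eq_one,
      show 2 * Real.pi * (n * (ω.arg / (2 * Real.pi)) + b.arg / (2 * Real.pi)) =
        n * ω.arg + b.arg by field_simp]
    ring

/-! ### Densities from dominant parts -/

theorem hasDensity_of_tendsto_div {x : ℕ → ℝ} {d : ℕ} {ρ δ : ℝ} (hρ : 0 < ρ)
    (h : HasDensity {n | 0 < x n / ((n : ℝ) ^ d * ρ ^ n)} δ) : HasDensity {n | 0 < x n} δ := by
  refine h.congr ?_
  filter_upwards [eventually_ge_atTop 1] with n hn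
  have : (0 : ℝ) < n := by exact_mod_cast hn
  have : 0 < (n : ℝ) ^ d * ρ ^ n := by positivity
  simp [div_pos_iff_of_pos_right this]

/-- The density of the positive values of a sequence close to `c + r * cos`, with its value
when `r = 0`. -/
theorem hasDensity_pos_cases {y : ℕ → ℝ} {c r θ τ : ℝ} (hr : 0 ≤ r) (hcr : c ≠ 0 ∨ r ≠ 0)
    (hθ : Irrational θ)
    (h : Tendsto (fun n : ℕ => y n - (c + r * Real.cos (2 * Real.pi * (n * θ + τ)))) atTop (𝓝 0)) :
    (r ≠ 0 → HasDensity {n | 0 < y n} (Real.arccos (-c / r) / Real.pi)) ∧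
    (r ≤ c → HasDensity {n | 0 < y n} 1) ∧ (r ≤ -c → HasDensity {n | 0 < y n} 0) := by
  have h0 : r ≠ 0 → HasDensity {n | 0 < y n} (Real.arccos (-c / r) / Real.pi) := fun hr0 =>
    hasDensity_pos_of_tendsto_cos (lt_of_le_of_ne hr (Ne.symm hr0)) hθ h
  have hlim : r = 0 → Tendsto y atTop (𝓝 c) := by
    rintro rfl
    have := h.add_const c
    rw [zero_add] at this
    refine this.congr fun n => ?_
    ring
  refine ⟨h0, fun hc => ?_, fun hc => ?_⟩
  · by_cases hr0 : r = 0
    · have hc0 : c ≠ 0 := hcr.resolve_right (not_not.2 hr0)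
      exact hasDensity_pos_of_tendsto_pos (lt_of_le_of_ne (hr.trans hc) hc0.symm) (hlim hr0)
    · have hrp := lt_of_le_of_ne hr (Ne.symm hr0)
      have := h0 hr0
      rwa [Real.arccos_of_le_neg_one, div_self Real.pi_ne_zero] at this
      rw [div_le_iff₀ hrp]; linarith
  · by_cases hr0 : r = 0
    · have hc0 : c ≠ 0 := hcr.resolve_right (not_not.2 hr0)
      exact hasDensity_pos_of_tendsto_neg (lt_of_le_of_ne (by linarith) hc0) (hlim hr0)
    · have hrp := lt_of_le_of_ne hr (Ne.symm hr0)
      have := h0 hr0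
      rwa [Real.arccos_of_one_le, zero_div] at this
      rw [le_div_iff₀ hrp]; linarith

/-- Along the even indices the constant is `c`, along the odd ones it is `-c`, and both subsequences
rotate by `2 * θ` with the same `r`. Because `arccos (-t) = π - arccos t`, the two densities add up
to `1`; for `r = 0` they are `1` and `0` in some order. -/
theorem hasDensity_half_of_tendsto {y : ℕ → ℝ} {c r θ τ : ℝ} (hr : 0 ≤ r) (hcr : c ≠ 0 ∨ r ≠ 0)
    (hθ : Irrational θ)
    (h : Tendsto (fun n : ℕ => y n - (c * (-1) ^ n + r * Real.cos (2 * Real.pi * (n * θ + τ))))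
      atTop (𝓝 0)) : HasDensity {n | 0 < y n} (1 / 2) := by
  have hsub : ∀ l : ℕ, Tendsto (fun n : ℕ => y (n * 2 + l) - (c * (-1) ^ l +
      r * Real.cos (2 * Real.pi * (n * (2 * θ) + (l * θ + τ))))) atTop (𝓝 0) := by
    intro l
    have ht : Tendsto (fun n : ℕ => n * 2 + l) atTop atTop :=
      tendsto_atTop_mono (fun n => by simp only [id]; omega) tendsto_id
    refine (h.comp ht).congr fun n => ?_
    simp only [Function.comp]
    rw [pow_add, mul_comm n 2, pow_mul, neg_one_sq, one_pow, one_mul]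
    push_cast
    ring_nf
  have hθ2 : Irrational (2 * θ) := by exact_mod_cast hθ.natCast_mul two_ne_zero
  have c0 := hasDensity_pos_cases hr (c := c * (-1) ^ 0) (by simpa using hcr) hθ2 (hsub 0)
  have c1 := hasDensity_pos_cases hr (c := c * (-1) ^ 1) (by simpa using hcr) hθ2 (hsub 1)
  simp only [pow_zero, mul_one, pow_one, mul_neg, neg_neg] at c0 c1
  have key : ∀ δ₀ δ₁ : ℝ, HasDensity {n | 0 < y (n * 2 + 0)} δ₀ →
      HasDensity {n | 0 < y (n * 2 + 1)} δ₁ → δ₀ + δ₁ = 1 → HasDensity {n | 0 < y n} (1 / 2) := by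
    intro δ₀ δ₁ h0 h1 hs
    have := HasDensity.of_residues (S := {n | 0 < y n}) (P := 2) two_pos
      (δ := fun l => if l = 0 then δ₀ else δ₁) (by
        intro l hl
        interval_cases l
        · simpa using h0
        · simpa using h1)
    simpa [Finset.sum_range_succ, hs] using this
  by_cases hr0 : r = 0
  · rcases le_total 0 c with hc | hc
    · exact key 1 0 (c0.2.1 (by linarith)) (c1.2.2 (by linarith)) (by ring)
    · exact key 0 1 (c0.2.2 (by linarith)) (c1.2.1 (by linarith)) (by ring)
  · refine key _ _ (c0.1 hr0) (c1.1 hr0) ?_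
    rw [neg_div, Real.arccos_neg]
    field_simp
    ring

end LRS

namespace LRS

open Polynomial

/-! ### Algebraic real and complex numbers -/

theorem isAlgebraic_ofReal {x : ℝ} : IsAlgebraic ℚ (x : ℂ) ↔ IsAlgebraic ℚ x :=
  isAlgebraic_algebraMap_iff (R := ℚ) (S := ℝ) (A := ℂ) Complex.ofReal_injective

open ComplexConjugate in
theorem IsAlgebraic.conj {z : ℂ} (hz : IsAlgebraic ℚ z) : IsAlgebraic ℚ (conj z) :=
  hz.algHom (Complex.conjAe.toAlgHom.restrictScalars ℚ)

theorem isAlgebraic_two : IsAlgebraic ℚ (2 : ℂ) := by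
  exact_mod_cast isAlgebraic_natCast (R := ℚ) (A := ℂ) 2

theorem IsAlgebraic.re {z : ℂ} (hz : IsAlgebraic ℚ z) : IsAlgebraic ℚ z.re := by
  rw [← isAlgebraic_ofReal, Complex.re_eq_add_conj, div_eq_mul_inv]
  exact (hz.add (IsAlgebraic.conj hz)).mul isAlgebraic_two.inv

theorem isAlgebraic_I : IsAlgebraic ℚ Complex.I := by
  refine ⟨X ^ 2 + 1, ?_, by simp⟩
  exact (monic_X_pow_add_C (1 : ℚ) two_ne_zero).ne_zero

theorem IsAlgebraic.im {z : ℂ} (hz : IsAlgebraic ℚ z) : IsAlgebraic ℚ z.im := by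
  have h := IsAlgebraic.re (hz.mul isAlgebraic_I)
  simpa using h.neg

theorem IsAlgebraic.norm {z : ℂ} (hz : IsAlgebraic ℚ z) : IsAlgebraic ℚ ‖z‖ := by
  have h : IsAlgebraic ℚ (‖z‖ ^ 2) := by
    rw [← isAlgebraic_ofReal]
    push_cast
    rw [← Complex.mul_conj']
    exact hz.mul (IsAlgebraic.conj hz)
  exact IsAlgebraic.of_pow two_pos h

/-- Two monic annihilators of equal degree differ by an annihilator of smaller degree. If it were
non-zero, dividing by its leading coefficient would give a shorter recurrence. -/
theorem IsMinimalRecurrence.charPoly_eq {E E' : LinearRecurrence ℚ} {u : ℕ → ℚ}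
    (hE : IsMinimalRecurrence E u) (hE' : IsMinimalRecurrence E' u) :
    E.charPoly = E'.charPoly := by
  by_contra hne
  have hord : E.order = E'.order := le_antisymm (hE.2 _ hE'.1) (hE'.2 _ hE.1)
  set q := E.charPoly - E'.charPoly with hq
  have hq0 : q ≠ 0 := sub_ne_zero.2 hne
  have hdeg : q.natDegree < E.order := by
    have h1 : q.degree < E.charPoly.degree :=
      degree_sub_lt_left (by simp [hord]) E.charPoly_monic.ne_zero
        (by rw [E.charPoly_monic.leadingCoeff, E'.charPoly_monic.leadingCoeff])
    rw [E.charPoly_degree_eq_order] at h1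
    exact (natDegree_lt_iff_degree_lt hq0).2 h1
  have hkill : aeval (shift ℚ) q u = 0 := by
    rw [hq, map_sub, LinearMap.sub_apply, (isSolution_iff E u).1 hE.1,
      (isSolution_iff E' u).1 hE'.1, sub_zero]
  have hm : (q * C q.leadingCoeff⁻¹).Monic := monic_mul_leadingCoeff_inv hq0
  have hkill' : aeval (shift ℚ) (q * C q.leadingCoeff⁻¹) u = 0 :=
    aeval_shift_eq_zero_of_dvd (dvd_mul_right _ _) hkill
  have hle : E.order ≤ (q * C q.leadingCoeff⁻¹).natDegree :=
    hE.2 _ (isSolution_recurrenceOf hm hkill')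
  rw [natDegree_mul_leadingCoeff_inv q hq0] at hle
  omega

theorem IsMinimalRecurrence.isRoot_iff {E : LinearRecurrence ℚ} {u : ℕ → ℚ}
    (hE : IsMinimalRecurrence E u) (z : ℂ) : IsRoot u z ↔ aeval z E.charPoly = 0 := by
  constructor
  · rintro ⟨E', hE', h⟩
    rwa [hE.charPoly_eq hE']
  · exact fun h => ⟨E, hE, h⟩

open ComplexConjugate in
-- The dominant roots lie among a real number `l₀ = σ * ρ` and a pair `l₁`, `conj l₁`. With `d` the
-- highest exponent that occurs at a dominant root, the terms of this exponent form the leading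
-- part. The symmetry of the coefficients makes the one at `l₀` real and merges the pair into twice
-- a real part, whence the factor `2` in `b`.
theorem exists_isDominantForm {u : ℕ → ℚ} {g : ℂ[X]} (hg : g.Monic) (hg0 : g.eval 0 ≠ 0)
    (hu : aeval (shift ℂ) g (castSeq ℂ u) = 0) (hnd : NonDegenerate u)
    (hone : AtMostOneDominantPair u) (hne : ∃ n, u n ≠ 0) :
    ∃ (σ : ℝ) (d : ℕ) (ρ c : ℝ) (b ω : ℂ) (ts : List (ℕ × ℂ × ℂ)), (σ = 1 ∨ σ = -1) ∧
      IsDominantForm (fun n => (u n : ℝ)) σ d ρ c b ω ts ∧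
      IsAlgebraic ℚ ρ ∧ IsAlgebraic ℚ c ∧ IsAlgebraic ℚ b ∧ IsAlgebraic ℚ ω ∧
      ∀ t ∈ ts, IsAlgebraic ℚ t.2.1 ∧ IsAlgebraic ℚ t.2.2 := by
  classical
  obtain ⟨E, hE⟩ := exists_isMinimalRecurrence hg hu
  obtain ⟨R, A, B, hdec, hR, hRne, hBalg, hBconj, hBout, hBne⟩ :=
    hE.exists_decomposition (hE.eval_zero_ne_zero hg0 hu)
  have hroot : ∀ z, IsRoot u z ↔ z ∈ R := fun z => by rw [hE.isRoot_iff, hR]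
  have hRnonempty : R.Nonempty := by
    rw [Finset.nonempty_iff_ne_empty]
    rintro rfl
    obtain ⟨n, hn⟩ := hne
    have := congrFun hdec n
    simp [castSeq, expPoly, hn] at this
  obtain ⟨m₀, hm₀, hmax⟩ := R.exists_max_image (fun z => ‖z‖) hRnonempty
  set ρ : ℝ := ‖m₀‖ with hρdef
  have hρ : 0 < ρ := norm_pos_iff.2 (hRne m₀ hm₀).1
  have hρc : (ρ : ℂ) ≠ 0 := Complex.ofReal_ne_zero.2 hρ.ne'
  have hρalg : IsAlgebraic ℚ (ρ : ℂ) := isAlgebraic_ofReal.2 (IsAlgebraic.norm (hRne m₀ hm₀).2)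
  have hdom : ∀ z ∈ R, ‖z‖ = ρ → IsDominantRoot u z := fun z hz hzn =>
    ⟨(hroot z).2 hz, fun w hw => by rw [hzn]; exact hmax w ((hroot w).1 hw)⟩
  -- the non-real dominant roots
  obtain ⟨l₁, hl₁im, hl₁norm, hl₁alg, hl₁⟩ : ∃ l₁ : ℂ, l₁.im ≠ 0 ∧ ‖l₁‖ = ρ ∧
      IsAlgebraic ℚ l₁ ∧
      ∀ z ∈ R, ‖z‖ = ρ → z.im ≠ 0 → z = l₁ ∨ z = conj l₁ := by
    by_cases h : ∃ z ∈ R, ‖z‖ = ρ ∧ z.im ≠ 0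
    · obtain ⟨z, hz, hzn, hzi⟩ := h
      exact ⟨z, hzi, hzn, (hRne z hz).2, fun w hw hwn hwi =>
        hone z w (hdom z hz hzn) (hdom w hw hwn) hzi hwi⟩
    · push Not at h
      -- If all dominant roots are real, a non-real number of modulus `ρ` takes the place of `l₁`.
      -- It is no root, so its coefficients are zero.
      refine ⟨ρ * Complex.I, ?_, ?_, hρalg.mul isAlgebraic_I,
        fun z hz hzn hzi => absurd (h z hz hzn) hzi⟩
      · simpa using hρ.ne'
      · simp [abs_of_pos hρ]
  -- the real dominant root
  obtain ⟨σ, hσ, hσR⟩ : ∃ σ : ℝ, (σ = 1 ∨ σ = -1) ∧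
      ∀ z ∈ R, ‖z‖ = ρ → z.im = 0 → z = ((σ * ρ : ℝ) : ℂ) := by
    have hreal : ∀ z : ℂ, ‖z‖ = ρ → z.im = 0 → z = (ρ : ℂ) ∨ z = ((-ρ : ℝ) : ℂ) := by
      intro z hz hzi
      have hzre : z = (z.re : ℂ) := Complex.ext (by simp) (by simp [hzi])
      rw [hzre, Complex.norm_real, Real.norm_eq_abs] at hz
      rw [hzre]
      rcases abs_eq hρ.le |>.1 hz with h | h
      · left; rw [h]
      · right; rw [h]
    -- If `-ρ` is a root, then `ρ` is not, since the square of their ratio is `1`. The value `σ = 1`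
    -- also covers the case without a real dominant root.
    by_cases h : ((-ρ : ℝ) : ℂ) ∈ R
    · refine ⟨-1, Or.inr rfl, fun z hz hzn hzi => ?_⟩
      rcases hreal z hzn hzi with h' | h'
      · exfalso
        refine hnd z ((-ρ : ℝ) : ℂ) ((hroot _).2 hz) ((hroot _).2 h) ?_ 2 two_pos ?_
        · rw [h']
          intro h2
          have : ρ = -ρ := by exact_mod_cast h2
          linarith
        · rw [h']
          push_cast
          field_simp
      · rw [h']; congr 1; ring
    · refine ⟨1, Or.inl rfl, fun z hz hzn hzi => ?_⟩
      rcases hreal z hzn hzi with h' | h'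
      · rw [h', one_mul]
      · exact absurd (h' ▸ hz) h
  have hσabs : |σ| = 1 := by rcases hσ with rfl | rfl <;> simp
  set l₀ : ℂ := ((σ * ρ : ℝ) : ℂ) with hl₀
  have hl₀norm : ‖l₀‖ = ρ := by
    rw [hl₀, Complex.norm_real, Real.norm_eq_abs, abs_mul, hσabs, one_mul, abs_of_pos hρ]
  have hl₀im : l₀.im = 0 := by rw [hl₀, Complex.ofReal_im]
  have hcover : ∀ z ∈ R, ‖z‖ = ρ → z = l₀ ∨ z = l₁ ∨ z = conj l₁ := by
    intro z hz hzn
    by_cases hzi : z.im = 0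
    · exact Or.inl (hσR z hz hzn hzi)
    · exact Or.inr (hl₁ z hz hzn hzi)
  -- the maximal degree
  set T : Finset (ℂ × ℕ) := (R ×ˢ Finset.range A).filter fun t => ‖t.1‖ = ρ ∧ B t.1 t.2 ≠ 0
    with hT
  have hTne : T.Nonempty := by
    obtain ⟨e, he, hbe⟩ := hBne m₀ hm₀
    exact ⟨(m₀, e), by simp [hT, hm₀, he, hbe, hρdef]⟩
  obtain ⟨⟨m₁, d⟩, hm₁, hd⟩ := T.exists_max_image (fun t => t.2) hTne
  simp only [hT, Finset.mem_filter, Finset.mem_product, Finset.mem_range, and_imp,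
    Prod.forall] at hm₁ hd
  obtain ⟨⟨hm₁R, hdA⟩, hm₁n, hm₁B⟩ := hm₁
  set c : ℝ := (B l₀ d).re with hc
  set b : ℂ := 2 * B l₁ d with hb
  set ω : ℂ := l₁ / ρ with hω
  have hBl₀ : B l₀ d = (c : ℂ) := by
    have h1 := hBconj l₀ d
    rw [Complex.conj_eq_iff_im.2 hl₀im] at h1
    exact (Complex.conj_eq_iff_re.1 h1.symm).symm
  -- Zero coefficients must be left out: a dominant root may have them at exponents above `d`, and
  -- such terms would not count as negligible.
  set rest : Finset (ℂ × ℕ) :=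
    (R ×ˢ Finset.range A).filter fun t => ¬ (‖t.1‖ = ρ ∧ t.2 = d) ∧ B t.1 t.2 ≠ 0 with hrest
  refine ⟨σ, d, ρ, c, b, ω, rest.toList.map fun t => (t.2, B t.1 t.2, t.1), hσ, ⟨hρ, ?_, ?_, ?_,
    ?_, ?_⟩, ?_, ?_, ?_, ?_, ?_⟩
  · rw [hω, norm_div, hl₁norm, Complex.norm_real, Real.norm_eq_abs, abs_of_pos hρ,
      div_self hρ.ne']
  · rcases hcover m₁ hm₁R hm₁n with h | h | h
    · left
      intro h0
      rw [h, hBl₀, h0] at hm₁B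
      exact hm₁B Complex.ofReal_zero
    · right
      rw [hb, ← h]
      exact mul_ne_zero two_ne_zero hm₁B
    · right
      rw [h, hBconj] at hm₁B
      rw [hb]
      exact mul_ne_zero two_ne_zero fun h0 => hm₁B (by rw [h0, map_zero])
  · intro hb0 n hn hpow
    have hl₁R : l₁ ∈ R := by
      by_contra h
      exact hb0 (by rw [hb, hBout l₁ h, mul_zero])
    have hconjR : conj l₁ ∈ R := by
      by_contra h
      have := hBout _ h d
      rw [hBconj, map_eq_zero] at this
      exact hb0 (by rw [hb, this, mul_zero])
    refine hnd l₁ (conj l₁) ((hroot _).2 hl₁R) ((hroot _).2 hconjR) ?_ n hn ?_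
    · intro h
      exact hl₁im (Complex.conj_eq_iff_im.1 h.symm)
    · rw [hω, div_pow, div_eq_one_iff_eq (pow_ne_zero _ hρc)] at hpow
      -- If `ω ^ n = 1`, then `l₁ ^ n = ρ ^ n` is real, so `l₁` and its conjugate have the same
      -- power. Their ratio would be a root of unity.
      have h2 : (conj l₁) ^ n = (ρ : ℂ) ^ n := by
        rw [← map_pow, hpow, map_pow, Complex.conj_ofReal]
      rw [div_pow, hpow, h2, div_self (pow_ne_zero _ hρc)]
  · intro t ht
    obtain ⟨⟨z, e⟩, hs, rfl⟩ := List.mem_map.1 ht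
    simp only [hrest, Finset.mem_toList, Finset.mem_filter, Finset.mem_product,
      Finset.mem_range] at hs
    obtain ⟨⟨hz, he⟩, hne, hB⟩ := hs
    rcases lt_or_eq_of_le (hmax z hz) with h | h
    · exact Or.inl h
    · right
      refine ⟨h, lt_of_le_of_ne (hd z e hz he h hB) fun h' => hne ⟨h, h'⟩⟩
  · intro n
    have hsum : (u n : ℝ) = ∑ t ∈ R ×ˢ Finset.range A, termSeq (t.2, B t.1 t.2, t.1) n := by
      have h1 := congrArg Complex.re (congrFun hdec n)
      have h2 : (castSeq ℂ u n).re = (u n : ℝ) := by simp [castSeq]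
      rw [h2, expPoly, ← Finset.sum_product', Complex.re_sum] at h1
      rw [h1]
      refine Finset.sum_congr rfl fun t _ => ?_
      rw [termSeq, ← Complex.re_ofReal_mul]
      congr 1
      push_cast
      ring
    rw [hsum, ← Finset.sum_filter_add_sum_filter_not _ (fun t : ℂ × ℕ => ‖t.1‖ = ρ ∧ t.2 = d)]
    congr 1
    -- The sum can be taken over all three candidates, because those that are no roots have
    -- coefficient zero.
    · have hS3 : ∑ t ∈ (R ×ˢ Finset.range A).filter (fun t : ℂ × ℕ => ‖t.1‖ = ρ ∧ t.2 = d),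
          termSeq (t.2, B t.1 t.2, t.1) n =
          ∑ z ∈ ({l₀, l₁, conj l₁} : Finset ℂ), termSeq (d, B z d, z) n := by
        have hfil : (R ×ˢ Finset.range A).filter (fun t : ℂ × ℕ => ‖t.1‖ = ρ ∧ t.2 = d) =
            (R.filter fun z => ‖z‖ = ρ) ×ˢ {d} := by
          ext ⟨z, e⟩
          simp only [Finset.mem_filter, Finset.mem_product, Finset.mem_range,
            Finset.mem_singleton]
          constructor
          · rintro ⟨⟨h1, h2⟩, h3, h4⟩; exact ⟨⟨h1, h3⟩, h4⟩
          · rintro ⟨⟨h1, h3⟩, rfl⟩; exact ⟨⟨h1, hdA⟩, h3, rfl⟩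
        rw [hfil, Finset.sum_product]
        simp only [Finset.sum_singleton]
        refine Finset.sum_subset ?_ ?_
        · intro z hz
          rw [Finset.mem_filter] at hz
          simpa using hcover z hz.1 hz.2
        · intro z hz hz'
          have hzn : ‖z‖ = ρ := by
            simp only [Finset.mem_insert, Finset.mem_singleton] at hz
            rcases hz with rfl | rfl | rfl
            · exact hl₀norm
            · exact hl₁norm
            · rw [Complex.norm_conj, hl₁norm]
          have hzR : z ∉ R := fun h => hz' (Finset.mem_filter.2 ⟨h, hzn⟩)
          simp [termSeq, hBout z hzR d]
      have hne1 : l₀ ∉ ({l₁, conj l₁} : Finset ℂ) := by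
        simp only [Finset.mem_insert, Finset.mem_singleton, not_or]
        constructor
        · intro h; exact hl₁im (h ▸ hl₀im)
        · intro h
          have := congrArg Complex.im h
          rw [hl₀im, Complex.conj_im] at this
          exact hl₁im (by linarith)
      have hne2 : l₁ ∉ ({conj l₁} : Finset ℂ) := by
        rw [Finset.mem_singleton]
        intro h
        exact hl₁im (Complex.conj_eq_iff_im.1 h.symm)
      rw [hS3, Finset.sum_insert hne1, Finset.sum_insert hne2, Finset.sum_singleton]
      have e1 : termSeq (d, B l₀ d, l₀) n = (n.choose d : ℝ) * (c * (σ * ρ) ^ n) := by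
        rw [termSeq, hBl₀, hl₀, ← Complex.ofReal_pow, ← Complex.ofReal_mul, Complex.ofReal_re]
      have e2 : termSeq (d, B (conj l₁) d, conj l₁) n = termSeq (d, B l₁ d, l₁) n := by
        simp only [termSeq]
        rw [hBconj, ← map_pow, ← map_mul, Complex.conj_re]
      have e3 : ρ ^ n * (b * ω ^ n).re = 2 * (B l₁ d * l₁ ^ n).re := by
        rw [← Complex.re_ofReal_mul, hb, hω]
        have : ((ρ ^ n : ℝ) : ℂ) * (2 * B l₁ d * (l₁ / ρ) ^ n) =
            ((2 : ℝ) : ℂ) * (B l₁ d * l₁ ^ n) := by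
          rw [div_pow]
          push_cast
          field_simp
        rw [this, Complex.re_ofReal_mul]
      rw [e1, e2]
      simp only [termSeq]
      linear_combination -(n.choose d : ℝ) * e3
    · rw [List.map_map, Finset.sum_map_toList, hrest]
      rw [← Finset.filter_filter]
      refine Eq.symm (Finset.sum_filter_of_ne (p := fun t : ℂ × ℕ => B t.1 t.2 ≠ 0) ?_)
      intro t _ ht h0
      exact ht (by simp [termSeq, h0])
  · exact IsAlgebraic.norm (hRne m₀ hm₀).2
  · exact IsAlgebraic.re (hBalg _ _)
  · exact isAlgebraic_two.mul (hBalg _ _)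
  · rw [hω, div_eq_mul_inv]
    exact hl₁alg.mul hρalg.inv
  · intro t ht
    obtain ⟨⟨z, e⟩, hs, rfl⟩ := List.mem_map.1 ht
    simp only [hrest, Finset.mem_toList, Finset.mem_filter, Finset.mem_product] at hs
    exact ⟨hBalg _ _, (hRne z hs.1.1).2⟩

end LRS

namespace LRS

open Polynomial

/-! ### Sequences given by codes and their subsequences -/

/-- The characteristic polynomial of a code, over the complex numbers. -/
noncomputable def Code.charPoly (I : Code) : ℂ[X] := I.recurrence.charPoly.map (algebraMap ℚ ℂ)

theorem Code.charPoly_monic (I : Code) : I.charPoly.Monic := I.recurrence.charPoly_monic.map _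

theorem Code.natDegree_charPoly (I : Code) : I.charPoly.natDegree = I.length := by
  rw [Code.charPoly, natDegree_map, LRS.natDegree_charPoly]
  rfl

theorem Code.aeval_shift_charPoly (I : Code) :
    aeval (shift ℂ) I.charPoly (castSeq ℂ I.seq) = 0 :=
  aeval_shift_charPoly_castSeq (I.recurrence.is_sol_mkSol _)

/-- The constant coefficient is `-a_k`; for the empty code the polynomial is `1`. So `0` is no root,
which the exponential form of the sequence needs. -/
theorem Code.Valid.eval_zero_charPoly {I : Code} (hI : I.Valid) : I.charPoly.eval 0 ≠ 0 := by
  rw [← coeff_zero_eq_eval_zero, Code.charPoly, coeff_map]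
  rw [Ne, FaithfulSMul.algebraMap_eq_zero_iff]
  rw [LinearRecurrence.charPoly, coeff_sub, finsetSum_coeff, coeff_monomial]
  simp only [coeff_monomial]
  by_cases h : I = []
  · subst h
    have h0 : ∑ i : Fin (Code.recurrence []).order,
        (if (i : ℕ) = 0 then (Code.recurrence []).coeffs i else 0) = 0 :=
      Finset.sum_eq_zero fun i _ => Fin.elim0 (show Fin 0 from i)
    rw [if_pos (show (Code.recurrence []).order = 0 from rfl), h0, sub_zero]
    exact one_ne_zero
  · have hlen : 0 < I.length := List.length_pos_iff.2 h
    have hord : I.recurrence.order ≠ 0 := hlen.ne'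
    rw [if_neg hord, zero_sub, neg_eq_zero]
    rw [Finset.sum_eq_single (⟨0, hlen⟩ : Fin I.recurrence.order)]
    · have := hI h
      rw [List.getLast_eq_getElem] at this
      simpa [Code.recurrence, Fin.rev] using this
    · intro i _ hi
      rw [if_neg]
      intro h0
      exact hi (Fin.ext h0)
    · simp

/-- The polynomial `h` has the `P`-th powers of the roots of `g` as its roots. Then `g` divides `h
(X ^ P)`, and the `P`-th power of the shift acts on each subsequence as the shift. The degree does
not grow, so the length of the code still bounds the number of terms to be checked. -/
theorem exists_subsequence_annihilator {g : ℂ[X]} (hg : g.Monic) {w : ℕ → ℂ}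
    (hw : aeval (shift ℂ) g w = 0) {P : ℕ} (hP : 0 < P) :
    ∃ h : ℂ[X], h.Monic ∧ h.natDegree = g.natDegree ∧ (g.eval 0 ≠ 0 → h.eval 0 ≠ 0) ∧
      ∀ l, aeval (shift ℂ) h (fun n => w (n * P + l)) = 0 := by
  have hsplit := (IsAlgClosed.splits g).eq_prod_roots_of_monic hg
  have hcard : Multiset.card g.roots = g.natDegree :=
    (IsAlgClosed.splits g).natDegree_eq_card_roots.symm
  set h : ℂ[X] := (g.roots.map fun k => X - C (k ^ P)).prod with hh
  have hmonic : h.Monic := monic_multiset_prod_of_monic _ _ fun k _ => monic_X_sub_C _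
  have hdvd : g ∣ expand ℂ P h := by
    rw [hh, map_multiset_prod, Multiset.map_map]
    conv_lhs => rw [hsplit]
    refine Multiset.prod_dvd_prod_of_dvd _ _ fun k _ => ?_
    have hk : expand ℂ P (X - C (k ^ P)) = X ^ P - C k ^ P := by
      rw [map_sub, expand_X, expand_C, C_pow]
    simp only [Function.comp, hk]
    exact sub_dvd_pow_sub_pow X (C k) P
  refine ⟨h, hmonic, ?_, ?_, ?_⟩
  · rw [hh, natDegree_multiset_prod_of_monic _ (by
      intro f hf
      obtain ⟨k, _, rfl⟩ := Multiset.mem_map.1 hf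
      exact monic_X_sub_C _), Multiset.map_map]
    simp only [Function.comp_def, natDegree_X_sub_C, Multiset.map_const', Multiset.sum_replicate,
      smul_eq_mul, mul_one]
    exact hcard
  · intro hg0 h0
    rw [hh, eval_multiset_prod, Multiset.prod_eq_zero_iff, Multiset.map_map, Multiset.mem_map] at h0
    obtain ⟨k, hk, hk0⟩ := h0
    simp only [Function.comp, eval_sub, eval_X, eval_C, zero_sub, neg_eq_zero] at hk0
    have : k = 0 := pow_eq_zero_iff hP.ne' |>.1 hk0
    subst this
    exact hg0 ((mem_roots hg.ne_zero).1 hk)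
  · intro l
    have h1 := aeval_shift_eq_zero_of_dvd hdvd hw
    rw [expand_aeval, aeval_eq_sum_range] at h1
    funext n
    have h2 := congrFun h1 (n * P + l)
    rw [aeval_shift_apply, Pi.zero_apply]
    rw [Pi.zero_apply] at h2
    rw [← h2]
    simp only [LinearMap.sum_apply, LinearMap.smul_apply, Finset.sum_apply, Pi.smul_apply,
      smul_eq_mul, ← pow_mul, shift_pow_apply]
    refine Finset.sum_congr rfl fun i _ => ?_
    congr 2
    ring

theorem positivitySet_eq (u : ℕ → ℚ) : positivitySet u = {n | 0 < (u n : ℝ)} := by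
  ext n
  simp [positivitySet]

/-- The constants are those of the dominant form divided by `d!`, because `C(n, d)` grows like `n ^
d / d!`. -/
theorem exists_dominantPart {I : Code} (hI : I.Valid) (hnd : NonDegenerate I.seq)
    (hone : AtMostOneDominantPair I.seq) (hne : ∃ n, I.seq n ≠ 0) :
    ∃ σ c r : ℝ, (σ = 1 ∨ σ = -1) ∧ 0 ≤ r ∧ IsAlgebraic ℚ c ∧ IsAlgebraic ℚ r ∧
      HasDominantPart I.seq σ c r ∧
      (σ = 1 → |c| < r → HasDensity (positivitySet I.seq) (Real.arccos (-c / r) / Real.pi)) ∧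
      (σ = 1 → r ≤ c → HasDensity (positivitySet I.seq) 1) ∧
      (σ = 1 → r ≤ -c → HasDensity (positivitySet I.seq) 0) ∧
      (σ = -1 → HasDensity (positivitySet I.seq) (1 / 2)) := by
  obtain ⟨σ, d, ρ, c, b, ω, ts, hσ, hform, -, hc, hb, -, -⟩ := exists_isDominantForm
    I.charPoly_monic hI.eval_zero_charPoly I.aeval_shift_charPoly hnd hone hne
  have hfac : (0 : ℝ) < d.factorial := by exact_mod_cast d.factorial_pos
  have hfacalg : IsAlgebraic ℚ (d.factorial : ℝ)⁻¹ :=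
    IsAlgebraic.inv (isAlgebraic_natCast (R := ℚ) (A := ℝ) d.factorial)
  obtain ⟨θ, τ, hθ, hlim⟩ := hform.exists_tendsto (by rcases hσ with rfl | rfl <;> simp)
  have hr : 0 ≤ ‖b‖ / d.factorial := by positivity
  have hcr : c / d.factorial ≠ 0 ∨ ‖b‖ / d.factorial ≠ 0 := by
    rcases hform.ne_zero with h | h
    · exact Or.inl (div_ne_zero h hfac.ne')
    · exact Or.inr (div_ne_zero (norm_ne_zero_iff.2 h) hfac.ne')
  refine ⟨σ, c / d.factorial, ‖b‖ / d.factorial, hσ, hr, ?_, ?_,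
    ⟨hcr, d, ρ, θ, τ, hform.pos, hθ, hlim⟩, ?_⟩
  · rw [div_eq_mul_inv]; exact hc.mul hfacalg
  · rw [div_eq_mul_inv]; exact (IsAlgebraic.norm hb).mul hfacalg
  rw [positivitySet_eq]
  have hcases : σ = 1 → _ := fun h1 => hasDensity_pos_cases hr hcr hθ (by simpa [h1] using hlim)
  refine ⟨fun h1 h2 => ?_, fun h1 h2 => ?_, fun h1 h2 => ?_, fun h1 => ?_⟩
  · exact hasDensity_of_tendsto_div hform.pos
      ((hcases h1).1 (lt_of_le_of_lt (abs_nonneg _) h2).ne')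
  · exact hasDensity_of_tendsto_div hform.pos ((hcases h1).2.1 h2)
  · exact hasDensity_of_tendsto_div hform.pos ((hcases h1).2.2 h2)
  · rw [h1] at hlim
    exact hasDensity_of_tendsto_div hform.pos (hasDensity_half_of_tendsto hr hcr hθ hlim)

end LRS

namespace LRS

/-! ### Composition rules for primitive recursive functions -/

section Primrec

variable {α β γ : Type*} [Primcodable α] [Primcodable β] [Primcodable γ]

attribute [fun_prop] Primrec
attribute [fun_prop] Primrec.id Primrec.const Primrec.comp Primrec.pair

@[fun_prop]
theorem primrec_fst {f : α → β × γ} (hf : Primrec f) : Primrec fun a => (f a).1 :=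
  Primrec.fst.comp hf

@[fun_prop]
theorem primrec_snd {f : α → β × γ} (hf : Primrec f) : Primrec fun a => (f a).2 :=
  Primrec.snd.comp hf

@[fun_prop]
theorem primrec_add {f g : α → ℕ} (hf : Primrec f) (hg : Primrec g) :
    Primrec fun a => f a + g a := Primrec.nat_add.comp hf hg

@[fun_prop]
theorem primrec_sub {f g : α → ℕ} (hf : Primrec f) (hg : Primrec g) :
    Primrec fun a => f a - g a := Primrec.nat_sub.comp hf hg

@[fun_prop]
theorem primrec_mul {f g : α → ℕ} (hf : Primrec f) (hg : Primrec g) :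
    Primrec fun a => f a * g a := Primrec.nat_mul.comp hf hg

@[fun_prop]
theorem primrec_div {f g : α → ℕ} (hf : Primrec f) (hg : Primrec g) :
    Primrec fun a => f a / g a := Primrec.nat_div.comp hf hg

@[fun_prop]
theorem primrec_mod {f g : α → ℕ} (hf : Primrec f) (hg : Primrec g) :
    Primrec fun a => f a % g a := Primrec.nat_mod.comp hf hg

@[fun_prop]
theorem primrec_length {f : α → List β} (hf : Primrec f) : Primrec fun a => (f a).length :=
  Primrec.list_length.comp hf

@[fun_prop]
theorem primrec_cons {f : α → β} {g : α → List β} (hf : Primrec f) (hg : Primrec g) :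
    Primrec fun a => f a :: g a := Primrec.list_cons.comp hf hg

@[fun_prop]
theorem primrec_getD {f : α → List β} {g : α → ℕ} (d : β) (hf : Primrec f) (hg : Primrec g) :
    Primrec fun a => (f a).getD (g a) d := (Primrec.list_getD d).comp hf hg

@[fun_prop]
theorem primrec_factorial {f : α → ℕ} (hf : Primrec f) : Primrec fun a => (f a).factorial := by
  have h : Primrec Nat.factorial := by
    refine (Primrec.nat_rec₁ (f := fun n y => (n + 1) * y) 1 ?_).of_eq fun n => ?_
    · exact (show Primrec fun p : ℕ × ℕ => (p.1 + 1) * p.2 by fun_prop)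
    · induction n with
      | zero => rfl
      | succ n ih => rw [Nat.factorial_succ, ← ih]
  exact h.comp hf

@[fun_prop]
theorem primrec_choose {f g : α → ℕ} (hf : Primrec f) (hg : Primrec g) :
    Primrec fun a => (f a).choose (g a) := by
  have h : Primrec₂ Nat.descFactorial := by
    refine (Primrec.nat_rec (f := fun _ : ℕ => 1) (g := fun n q => (n - q.1) * q.2)
      (by fun_prop) ?_).of_eq fun n k => ?_
    · exact (show Primrec fun p : ℕ × (ℕ × ℕ) => (p.1 - p.2.1) * p.2.2 by fun_prop)
    · induction k with
      | zero => rfl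
      | succ k ih => rw [Nat.descFactorial_succ, ← ih]
  have h2 : Primrec fun a => (f a).descFactorial (g a) / (g a).factorial :=
    primrec_div (h.comp hf hg) (by fun_prop)
  exact h2.of_eq fun a => (Nat.choose_eq_descFactorial_div_factorial _ _).symm

theorem encode_intCast (n : ℕ) : Encodable.encode (n : ℤ) = 2 * n := rfl

theorem encode_negSucc (n : ℕ) : Encodable.encode (Int.negSucc n) = 2 * n + 1 := rfl

-- The natural number `n` is encoded as `2 * n` and the integer `-(n + 1)` as `2 * n + 1`, so the
-- parity of the code reveals the sign.
@[fun_prop]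
theorem primrec_toNat {f : α → ℤ} (hf : Primrec f) : Primrec fun a => (f a).toNat := by
  have h : Primrec Int.toNat := by
    refine (Primrec.ite (c := fun z : ℤ => Encodable.encode z % 2 = 0)
      (f := fun z => Encodable.encode z / 2) (g := fun _ => 0)
      (Primrec.eq.comp (primrec_mod Primrec.encode (by fun_prop)) (by fun_prop))
      (primrec_div Primrec.encode (by fun_prop)) (by fun_prop)).of_eq fun z => ?_
    cases z with
    | ofNat n => rw [Int.ofNat_eq_natCast, encode_intCast]; simp
    | negSucc n => rw [encode_negSucc, if_neg (by omega)]; rfl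
  exact h.comp hf

@[fun_prop]
theorem primrec_toNat_neg {f : α → ℤ} (hf : Primrec f) : Primrec fun a => (-f a).toNat := by
  have h : Primrec fun z : ℤ => (-z).toNat := by
    refine (Primrec.ite (c := fun z : ℤ => Encodable.encode z % 2 = 0)
      (f := fun _ => 0) (g := fun z => Encodable.encode z / 2 + 1)
      (Primrec.eq.comp (primrec_mod Primrec.encode (by fun_prop)) (by fun_prop)) (by fun_prop)
      (primrec_add (primrec_div Primrec.encode (by fun_prop)) (by fun_prop))).of_eq fun z => ?_
    cases z with
    | ofNat n => rw [Int.ofNat_eq_natCast, encode_intCast]; simp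
    | negSucc n => rw [encode_negSucc, if_neg (by omega), Int.neg_negSucc, Int.toNat_natCast]; omega
  exact h.comp hf

/-- Every integer is `z.toNat - (-z).toNat`. Addition and multiplication therefore reduce to natural
numbers and this one operation. -/
theorem primrec_intSub {f g : α → ℕ} (hf : Primrec f) (hg : Primrec g) :
    Primrec fun a => (f a : ℤ) - (g a : ℤ) := by
  have h : Primrec fun p : ℕ × ℕ => (p.1 : ℤ) - (p.2 : ℤ) := by
    rw [← Primrec.encode_iff]
    refine (Primrec.ite (c := fun p : ℕ × ℕ => p.2 ≤ p.1) (f := fun p => 2 * (p.1 - p.2))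
      (g := fun p => 2 * (p.2 - p.1 - 1) + 1) (Primrec.nat_le.comp Primrec.snd Primrec.fst)
      (by fun_prop) (by fun_prop)).of_eq fun p => ?_
    split_ifs with h
    · rw [← Nat.cast_sub h, encode_intCast]
    · rw [← encode_negSucc]
      congr 1
      omega
  exact h.comp (hf.pair hg)

@[fun_prop]
theorem primrec_intAdd {f g : α → ℤ} (hf : Primrec f) (hg : Primrec g) :
    Primrec fun a => f a + g a := by
  refine (primrec_intSub (f := fun a => (f a).toNat + (g a).toNat)
    (g := fun a => (-f a).toNat + (-g a).toNat) (by fun_prop) (by fun_prop)).of_eq fun a => ?_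
  have h1 := Int.toNat_sub_toNat_neg (f a)
  have h2 := Int.toNat_sub_toNat_neg (g a)
  push_cast
  linarith

@[fun_prop]
theorem primrec_intMul {f g : α → ℤ} (hf : Primrec f) (hg : Primrec g) :
    Primrec fun a => f a * g a := by
  refine (primrec_intSub
    (f := fun a => (f a).toNat * (g a).toNat + (-f a).toNat * (-g a).toNat)
    (g := fun a => (f a).toNat * (-g a).toNat + (-f a).toNat * (g a).toNat)
    (by fun_prop) (by fun_prop)).of_eq fun a => ?_
  have h1 := Int.toNat_sub_toNat_neg (f a)
  have h2 := Int.toNat_sub_toNat_neg (g a)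
  conv_rhs => rw [← h1, ← h2]
  push_cast
  ring

@[fun_prop]
theorem primrec_intCast {f : α → ℕ} (hf : Primrec f) : Primrec fun a => (f a : ℤ) :=
  (primrec_intSub hf (Primrec.const 0)).of_eq fun a => by simp

end Primrec

/-! ### Semidecidable predicates -/

section SemiDec

variable {α β : Type*} [Primcodable α] [Primcodable β]

/-- The projection of a primitive recursive relation. -/
def SemiDec (p : α → Prop) : Prop :=
  ∃ q : α → ℕ → Bool, Primrec₂ q ∧ ∀ a, p a ↔ ∃ n, q a n = true

theorem SemiDec.of_primrecRel {p : α → Prop} {q : α → ℕ → Prop} (hq : PrimrecRel q)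
    (h : ∀ a, p a ↔ ∃ n, q a n) : SemiDec p := by
  classical
  exact ⟨fun a n => decide (q a n), hq.decide, fun a => by simpa using h a⟩

theorem SemiDec.of_eq {p q : α → Prop} (hp : SemiDec p) (h : ∀ a, p a ↔ q a) : SemiDec q := by
  obtain ⟨r, hr, h'⟩ := hp
  exact ⟨r, hr, fun a => (h a).symm.trans (h' a)⟩

theorem SemiDec.of_primrecPred {p : α → Prop} (hp : PrimrecPred p) : SemiDec p :=
  SemiDec.of_primrecRel (q := fun a _ => p a) (hp.comp Primrec.fst) fun _ => by simp

@[fun_prop]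
theorem primrec_unpair {f : α → ℕ} (hf : Primrec f) : Primrec fun a => (f a).unpair :=
  Primrec.unpair.comp hf

theorem SemiDec.and {p q : α → Prop} (hp : SemiDec p) (hq : SemiDec q) :
    SemiDec fun a => p a ∧ q a := by
  obtain ⟨r, hr, h⟩ := hp
  obtain ⟨s, hs, h'⟩ := hq
  refine ⟨fun a n => r a n.unpair.1 && s a n.unpair.2, ?_, fun a => ?_⟩
  · exact Primrec.and.comp
      (hr.comp (g := fun x : α × ℕ => x.1) (h := fun x => x.2.unpair.1)
        (by fun_prop) (by fun_prop))
      (hs.comp (g := fun x : α × ℕ => x.1) (h := fun x => x.2.unpair.2)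
        (by fun_prop) (by fun_prop))
  · simp only [h, h', Bool.and_eq_true]
    constructor
    · rintro ⟨⟨m, hm⟩, ⟨n, hn⟩⟩
      exact ⟨Nat.pair m n, by simpa using ⟨hm, hn⟩⟩
    · rintro ⟨n, h1, h2⟩
      exact ⟨⟨_, h1⟩, ⟨_, h2⟩⟩

theorem SemiDec.or {p q : α → Prop} (hp : SemiDec p) (hq : SemiDec q) :
    SemiDec fun a => p a ∨ q a := by
  obtain ⟨r, hr, h⟩ := hp
  obtain ⟨s, hs, h'⟩ := hq
  refine ⟨fun a n => r a n || s a n, Primrec.or.comp hr hs, fun a => ?_⟩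
  simp only [h, h', Bool.or_eq_true, exists_or]

/-- One number encodes both a candidate `b` and the witness for it; numbers that decode to nothing
are rejected. -/
theorem SemiDec.exists {p : α → β → Prop} (hp : SemiDec fun x : α × β => p x.1 x.2) :
    SemiDec fun a => ∃ b, p a b := by
  obtain ⟨q, hq, h⟩ := hp
  refine ⟨fun a n => ((Encodable.decode (α := β) n.unpair.1).map
    fun b => q (a, b) n.unpair.2).getD false, ?_, fun a => ?_⟩
  · refine Primrec.option_getD.comp (Primrec.option_map
      (f := fun x : α × ℕ => Encodable.decode (α := β) x.2.unpair.1)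
      (Primrec.decode.comp (by fun_prop)) ?_) (Primrec.const false)
    exact hq.comp (g := fun z : (α × ℕ) × β => (z.1.1, z.2)) (h := fun z => z.1.2.unpair.2)
      (by fun_prop) (by fun_prop)
  · constructor
    · rintro ⟨b, hb⟩
      obtain ⟨n, hn⟩ := (h (a, b)).1 hb
      exact ⟨Nat.pair (Encodable.encode b) n, by simpa using hn⟩
    · rintro ⟨n, hn⟩
      cases hd : Encodable.decode (α := β) n.unpair.1 with
      | none => simp [hd] at hn
      | some b =>
        simp only [hd, Option.map_some, Option.getD_some] at hn
        exact ⟨b, (h (a, b)).2 ⟨_, hn⟩⟩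

/-- The witness is a common bound for the witnesses of all members of the list. Bounded quantifiers
over lists preserve primitive recursion. -/
theorem SemiDec.forall_mem {p : α → β → Prop} (hp : SemiDec fun x : α × β => p x.1 x.2)
    {f : α → List β} (hf : Primrec f) : SemiDec fun a => ∀ b ∈ f a, p a b := by
  obtain ⟨q, hq, h⟩ := hp
  have h1 : PrimrecRel fun (n : ℕ) (x : α × β) => q x n = true :=
    Primrec.eq.comp (hq.comp Primrec.snd Primrec.fst) (Primrec.const true)
  have h2 := h1.exists_mem_list.comp
    (f := fun y : β × (α × ℕ) => List.range y.2.2) (g := fun y => (y.2.1, y.1))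
    (Primrec.list_range.comp (by fun_prop)) (by fun_prop)
  have h3 : PrimrecRel fun (b : β) (y : α × ℕ) => ∃ n ∈ List.range y.2, q (y.1, b) n = true := h2
  have h4 := h3.forall_mem_list.comp (f := fun y : α × ℕ => f y.1) (g := fun y => y)
    (by fun_prop) (by fun_prop)
  refine SemiDec.of_primrecRel
    (q := fun a N => ∀ b ∈ f a, ∃ n ∈ List.range N, q (a, b) n = true) h4 fun a => ?_
  have h' : ∀ b, p a b ↔ ∃ n, q (a, b) n = true := fun b => h (a, b)
  simp only [h', List.mem_range]
  constructor
  · intro hall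
    generalize f a = l at hall
    induction l with
    | nil => exact ⟨0, by simp⟩
    | cons b l ih =>
      obtain ⟨N, hN⟩ := ih fun b hb => hall b (by simp [hb])
      obtain ⟨n, hn⟩ := hall b (by simp)
      refine ⟨max N (n + 1), fun b' hb' => ?_⟩
      rcases List.mem_cons.1 hb' with rfl | hb'
      · exact ⟨n, by omega, hn⟩
      · obtain ⟨k, hk, hk'⟩ := hN b' hb'
        exact ⟨k, by omega, hk'⟩
  · rintro ⟨N, hN⟩ b hb
    obtain ⟨n, _, hn⟩ := hN b hb
    exact ⟨n, hn⟩

theorem SemiDec.forall_lt {p : α → ℕ → Prop} (hp : SemiDec fun x : α × ℕ => p x.1 x.2)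
    {f : α → ℕ} (hf : Primrec f) : SemiDec fun a => ∀ i < f a, p a i :=
  (hp.forall_mem (Primrec.list_range.comp hf)).of_eq fun a => by simp

/-- A semidecidable relation contains a partial recursive function with the same domain. -/
theorem SemiDec.exists_partrec {p : α → β → Prop} (hp : SemiDec fun x : α × β => p x.1 x.2) :
    ∃ f : α →. β, Partrec f ∧ (∀ a b, b ∈ f a → p a b) ∧ ∀ a, (∃ b, p a b) → (f a).Dom := by
  obtain ⟨q, hq, h⟩ := hp
  -- The search runs over pairs of a candidate and a witness and returns the first candidate whose
  -- witness is accepted.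
  let g : α → ℕ → Option β := fun a n =>
    (Encodable.decode (α := β) n.unpair.1).bind fun b =>
      bif q (a, b) n.unpair.2 then some b else none
  have hg : Primrec₂ g := by
    refine Primrec.option_bind (f := fun x : α × ℕ => Encodable.decode (α := β) x.2.unpair.1)
      (Primrec.decode.comp (by fun_prop)) ?_
    exact Primrec.cond
      (hq.comp (g := fun z : (α × ℕ) × β => (z.1.1, z.2)) (h := fun z => z.1.2.unpair.2)
        (by fun_prop) (by fun_prop))
      (Primrec.option_some.comp (by fun_prop)) (by fun_prop)
  refine ⟨fun a => Nat.rfindOpt (g a), Partrec.rfindOpt hg.to_comp, ?_, ?_⟩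
  · intro a b hb
    obtain ⟨n, hn⟩ := Nat.rfindOpt_spec hb
    obtain ⟨b', hb', hn'⟩ := Option.bind_eq_some_iff.1 hn
    cases hqa : q (a, b') n.unpair.2 with
    | true =>
      rw [hqa, cond_true, Option.some.injEq] at hn'
      subst hn'
      exact (h (a, b')).2 ⟨_, hqa⟩
    | false =>
      rw [hqa, cond_false] at hn'
      exact absurd hn' (by simp)
  · rintro a ⟨b, hb⟩
    obtain ⟨n, hn⟩ := (h (a, b)).1 hb
    refine Nat.rfindOpt_dom.2 ⟨Nat.pair (Encodable.encode b) n, b, ?_⟩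
    simp [g, hn]

end SemiDec

end LRS

namespace LRS

open Polynomial

/-! ### Arithmetic of codes of rational numbers -/

/-- Addition of codes. -/
def ratAdd (a b : RatCode) : RatCode :=
  (a.1 * ((b.2 + 1 : ℕ) : ℤ) + b.1 * ((a.2 + 1 : ℕ) : ℤ), (a.2 + 1) * (b.2 + 1) - 1)

/-- Multiplication of codes. -/
def ratMul (a b : RatCode) : RatCode := (a.1 * b.1, (a.2 + 1) * (b.2 + 1) - 1)

/-- Denominators are stored diminished by one. A product of two successors is at least `1`, so the
truncated subtraction is exact. -/
theorem den_ratMul (a b : ℕ) : (((a + 1) * (b + 1) - 1 : ℕ) : ℚ) + 1 = (a + 1) * (b + 1) := by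
  have h : 1 ≤ (a + 1) * (b + 1) := Nat.mul_pos (by omega) (by omega)
  rw [Nat.cast_sub h]
  push_cast
  ring

theorem val_ratAdd (a b : RatCode) : (ratAdd a b).val = a.val + b.val := by
  simp only [RatCode.val, ratAdd, den_ratMul]
  push_cast
  field_simp

theorem val_ratMul (a b : RatCode) : (ratMul a b).val = a.val * b.val := by
  simp only [RatCode.val, ratMul, den_ratMul]
  push_cast
  field_simp

theorem val_eq_zero_iff (a : RatCode) : a.val = 0 ↔ a.1 = 0 := by
  have : (a.2 : ℚ) + 1 ≠ 0 := by positivity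
  simp [RatCode.val, this]

theorem val_pos_iff (a : RatCode) : 0 < a.val ↔ 0 < a.1 := by
  have : (0 : ℚ) < (a.2 : ℚ) + 1 := by positivity
  rw [RatCode.val, div_pos_iff_of_pos_right this]
  exact_mod_cast Iff.rfl

theorem exists_val_eq (q : ℚ) : ∃ a : RatCode, a.val = q := by
  refine ⟨(q.num, q.den - 1), ?_⟩
  have h : 1 ≤ q.den := q.den_pos
  simp only [RatCode.val]
  rw [Nat.cast_sub h]
  simpa using Rat.num_div_den q

theorem val_zero : RatCode.val (0, 0) = 0 := by simp [RatCode.val]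

theorem val_natCast (n : ℕ) : RatCode.val ((n : ℤ), 0) = n := by simp [RatCode.val]

theorem val_neg_one : RatCode.val (-1, 0) = -1 := by simp [RatCode.val]

section Primrec

variable {α : Type*} [Primcodable α]

@[fun_prop]
theorem primrec_ratAdd {f g : α → RatCode} (hf : Primrec f) (hg : Primrec g) :
    Primrec fun a => ratAdd (f a) (g a) := by
  unfold ratAdd
  fun_prop

@[fun_prop]
theorem primrec_ratMul {f g : α → RatCode} (hf : Primrec f) (hg : Primrec g) :
    Primrec fun a => ratMul (f a) (g a) := by
  unfold ratMul
  fun_prop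

end Primrec

/-! ### Computing the terms of a sequence -/

/-- The next term of the sequence of a code, from the list of its previous terms, the last one
first. -/
def nextTerm (I : Code) (h : List RatCode) : RatCode :=
  (List.range I.length).foldr
    (fun i s => ratAdd (ratMul (I.getD i ((0, 0), (0, 0))).1 (h.getD i (0, 0))) s) (0, 0)

/-- The first terms of the sequence of a code, the last one first. -/
def history (I : Code) (n : ℕ) : List RatCode :=
  Nat.rec (I.map Prod.snd).reverse (fun _ h => nextTerm I h :: h) n

/-- A code of the term of index `n` of the sequence of a code. -/
def seqCode (I : Code) (n : ℕ) : RatCode := (history I n).getD (I.length - 1) (0, 0)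

theorem val_foldr_ratAdd {ι : Type*} (l : List ι) (f : ι → RatCode) :
    (l.foldr (fun i s => ratAdd (f i) s) (0, 0)).val = (l.map fun i => (f i).val).sum := by
  induction l with
  | nil => exact val_zero
  | cons a l ih => rw [List.foldr_cons, val_ratAdd, ih, List.map_cons, List.sum_cons]

/-- After `n` steps the head of the list is the term of index `n + I.length - 1`, and each further
position is one index behind. The most recent `I.length` entries are all that the recurrence reads,
in the order of the coefficients of the code. -/
theorem val_history (I : Code) (n j : ℕ) (hj : j < I.length) :
    ((history I n).getD j (0, 0)).val = I.seq (n + (I.length - 1 - j)) := by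
  induction n generalizing j with
  | zero =>
    have h1 : history I 0 = (I.map Prod.snd).reverse := rfl
    have hlt : I.length - 1 - j < I.length := by omega
    rw [h1, zero_add, List.getD_eq_getElem _ _ (by simpa using hj), List.getElem_reverse]
    have h2 := I.recurrence.mkSol_eq_init (fun i => (I.get i).2.val) ⟨I.length - 1 - j, hlt⟩
    rw [Code.seq, h2]
    simp only [List.getElem_map, List.length_map]
    rfl
  | succ n ih =>
    have h1 : history I (n + 1) = nextTerm I (history I n) :: history I n := rfl
    rw [h1]
    cases j with
    | zero =>
      rw [List.getD_cons_zero, nextTerm, val_foldr_ratAdd]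
      have hrec : I.seq (n + I.length) = ∑ i : Fin I.length,
          (I.get i.rev).1.val * I.seq (n + i) :=
        I.recurrence.is_sol_mkSol (fun i => (I.get i).2.val) n
      have hsum : ∀ f : ℕ → ℚ, ((List.range I.length).map f).sum =
          ∑ i ∈ Finset.range I.length, f i := fun f => rfl
      rw [show n + 1 + (I.length - 1 - 0) = n + I.length by omega, hrec, hsum, Finset.sum_range,
        ← Equiv.sum_comp Fin.revPerm]
      refine Finset.sum_congr rfl fun i _ => ?_
      have hi := i.isLt
      rw [val_ratMul, Fin.revPerm_apply, ih _ (by omega), List.getD_eq_getElem _ _ i.rev.isLt]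
      have hr := Fin.val_rev i
      rw [show I.length - 1 - (i.rev : ℕ) = i by omega]
      rfl
    | succ j =>
      rw [List.getD_cons_succ, ih j (by omega)]
      congr 1
      omega

theorem val_seqCode (I : Code) (n : ℕ) : (seqCode I n).val = I.seq n := by
  by_cases h : I = []
  · subst h
    have h0 : Code.seq [] n = 0 := by
      have := (Code.recurrence []).is_sol_mkSol (fun i => RatCode.val (List.get ([] : Code) i).2) n
      exact this.trans (Finset.sum_eq_zero fun i _ => Fin.elim0 (show Fin 0 from i))
    rw [h0, seqCode]
    cases n with
    | zero => exact val_zero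
    | succ n => exact val_zero
  · have hlen : 0 < I.length := List.length_pos_iff.2 h
    rw [seqCode, val_history I n _ (by omega)]
    congr 1
    omega

@[fun_prop]
theorem primrec_seqCode {α : Type*} [Primcodable α] {f : α → Code} {g : α → ℕ} (hf : Primrec f)
    (hg : Primrec g) : Primrec fun a => seqCode (f a) (g a) := by
  have h1 : Primrec₂ nextTerm := by
    refine Primrec.list_foldr (f := fun x : Code × List RatCode => List.range x.1.length)
      (h := fun x y => ratAdd (ratMul (x.1.getD y.1 ((0, 0), (0, 0))).1 (x.2.getD y.1 (0, 0))) y.2)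
      (Primrec.list_range.comp (by fun_prop)) (by fun_prop) ?_
    exact (show Primrec fun z : (Code × List RatCode) × (ℕ × RatCode) =>
      ratAdd (ratMul (z.1.1.getD z.2.1 ((0, 0), (0, 0))).1 (z.1.2.getD z.2.1 (0, 0))) z.2.2
      by fun_prop)
  have h2 : Primrec₂ history := by
    refine Primrec.nat_rec (f := fun I : Code => (I.map Prod.snd).reverse)
      (g := fun I x => nextTerm I x.2 :: x.2) ?_ ?_
    · exact Primrec.list_reverse.comp (Primrec.list_map Primrec.id (Primrec.snd.comp Primrec.snd))
    · exact Primrec.list_cons.comp (h1.comp (by fun_prop) (by fun_prop)) (by fun_prop)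
  have h3 : Primrec fun a => history (f a) (g a) := h2.comp hf hg
  unfold seqCode
  fun_prop

/-! ### Codes of polynomials -/

/-- The list of coefficients of a rational polynomial, the constant one first. -/
abbrev PolyCode := List RatCode

/-- The polynomial of a code. -/
noncomputable def polyOf : PolyCode → ℚ[X]
  | [] => 0
  | c :: l => C (RatCode.val c) + X * polyOf l

theorem coeff_polyOf (p : PolyCode) (i : ℕ) : (polyOf p).coeff i = (p.getD i (0, 0)).val := by
  induction p generalizing i with
  | nil => simp [polyOf, RatCode.val]
  | cons c p ih =>
    cases i with
    | zero => simp [polyOf]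
    | succ i => simp [polyOf, ih]

theorem exists_polyOf_eq (f : ℚ[X]) : ∃ p, polyOf p = f := by
  choose g hg using exists_val_eq
  refine ⟨(List.range (f.natDegree + 1)).map fun i => g (f.coeff i), ?_⟩
  ext i
  rw [coeff_polyOf]
  rcases lt_or_ge i (f.natDegree + 1) with h | h
  · rw [List.getD_eq_getElem _ _ (by simpa using h)]
    simp [hg]
  · rw [List.getD_eq_default _ _ (by simpa using h), val_zero,
      coeff_eq_zero_of_natDegree_lt (by omega)]

theorem natDegree_polyOf_le (p : PolyCode) : (polyOf p).natDegree ≤ p.length := by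
  refine natDegree_le_iff_coeff_eq_zero.2 fun N hN => ?_
  rw [coeff_polyOf, List.getD_eq_default _ _ hN.le, val_zero]

/-- Addition of codes of polynomials. -/
def polyAdd (p q : PolyCode) : PolyCode :=
  (List.range (max p.length q.length)).map fun i => ratAdd (p.getD i (0, 0)) (q.getD i (0, 0))

/-- Multiplication of a code of a polynomial by a rational number. -/
def polySmul (a : RatCode) (p : PolyCode) : PolyCode := p.map (ratMul a)

/-- Subtraction of codes of polynomials. -/
def polySub (p q : PolyCode) : PolyCode := polyAdd p (polySmul (-1, 0) q)

/-- Multiplication of codes of polynomials. -/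
def polyMul (p q : PolyCode) : PolyCode :=
  p.foldr (fun a s => polyAdd (polySmul a q) ((0, 0) :: s)) []

theorem polyOf_polyAdd (p q : PolyCode) : polyOf (polyAdd p q) = polyOf p + polyOf q := by
  ext i
  rw [coeff_add, coeff_polyOf, coeff_polyOf, coeff_polyOf, ← val_ratAdd]
  rcases lt_or_ge i (max p.length q.length) with h | h
  · rw [List.getD_eq_getElem _ _ (by simpa [polyAdd] using h)]
    simp [polyAdd]
  · rw [List.getD_eq_default _ _ (by simpa [polyAdd] using h),
      List.getD_eq_default p _ ((le_max_left _ _).trans h),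
      List.getD_eq_default q _ ((le_max_right _ _).trans h), val_ratAdd]
    simp [val_zero]

theorem polyOf_polySmul (a : RatCode) (p : PolyCode) :
    polyOf (polySmul a p) = C a.val * polyOf p := by
  induction p with
  | nil => simp [polySmul, polyOf]
  | cons c p ih =>
    have : polySmul a (c :: p) = ratMul a c :: polySmul a p := rfl
    rw [this, polyOf, polyOf, ih, val_ratMul, C_mul]
    ring

theorem polyOf_polySub (p q : PolyCode) : polyOf (polySub p q) = polyOf p - polyOf q := by
  rw [polySub, polyOf_polyAdd, polyOf_polySmul, val_neg_one]
  simp [sub_eq_add_neg]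

theorem polyOf_polyMul (p q : PolyCode) : polyOf (polyMul p q) = polyOf p * polyOf q := by
  induction p with
  | nil => simp [polyMul, polyOf]
  | cons c p ih =>
    have : polyMul (c :: p) q = polyAdd (polySmul c q) ((0, 0) :: polyMul p q) := rfl
    rw [this, polyOf_polyAdd, polyOf_polySmul, polyOf, polyOf, ih, val_zero]
    simp only [C_0]
    ring

/-- Codes are not normalized: fractions may be reducible and lists may end in zeros. This turns the
zero test into a test on numerators, which is primitive recursive. -/
theorem polyOf_eq_zero_iff (p : PolyCode) : polyOf p = 0 ↔ ∀ c ∈ p, c.1 = 0 := by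
  constructor
  · intro h c hc
    obtain ⟨i, hi, rfl⟩ := List.getElem_of_mem hc
    rw [← val_eq_zero_iff, ← List.getD_eq_getElem p (0, 0) hi, ← coeff_polyOf, h, coeff_zero]
  · intro h
    ext i
    rw [coeff_polyOf, coeff_zero]
    rcases lt_or_ge i p.length with hi | hi
    · rw [List.getD_eq_getElem _ _ hi, val_eq_zero_iff]
      exact h _ (List.getElem_mem hi)
    · rw [List.getD_eq_default _ _ hi, val_zero]

/-- The value of a polynomial at a rational number. -/
def polyEval (p : PolyCode) (a : RatCode) : RatCode :=
  p.foldr (fun c s => ratAdd c (ratMul a s)) (0, 0)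

theorem val_polyEval (p : PolyCode) (a : RatCode) : (polyEval p a).val = (polyOf p).eval a.val := by
  induction p with
  | nil => simp [polyEval, polyOf, val_zero]
  | cons c p ih =>
    have : polyEval (c :: p) a = ratAdd c (ratMul a (polyEval p a)) := rfl
    rw [this, val_ratAdd, val_ratMul, ih, polyOf]
    simp

section Primrec

variable {α : Type*} [Primcodable α]

@[fun_prop]
theorem primrec_polyAdd {f g : α → PolyCode} (hf : Primrec f) (hg : Primrec g) :
    Primrec fun a => polyAdd (f a) (g a) := by
  refine Primrec.list_map (f := fun a => List.range (max (f a).length (g a).length))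
    (g := fun a i => ratAdd ((f a).getD i (0, 0)) ((g a).getD i (0, 0)))
    (Primrec.list_range.comp (Primrec.nat_max.comp (by fun_prop) (by fun_prop))) ?_
  exact (show Primrec fun x : α × ℕ =>
    ratAdd ((f x.1).getD x.2 (0, 0)) ((g x.1).getD x.2 (0, 0)) by fun_prop)

@[fun_prop]
theorem primrec_polySmul {f : α → RatCode} {g : α → PolyCode} (hf : Primrec f)
    (hg : Primrec g) : Primrec fun a => polySmul (f a) (g a) := by
  refine Primrec.list_map (g := fun a c => ratMul (f a) c) hg ?_
  exact (show Primrec fun x : α × RatCode => ratMul (f x.1) x.2 by fun_prop)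

@[fun_prop]
theorem primrec_polySub {f g : α → PolyCode} (hf : Primrec f) (hg : Primrec g) :
    Primrec fun a => polySub (f a) (g a) := by
  unfold polySub
  fun_prop

@[fun_prop]
theorem primrec_polyMul {f g : α → PolyCode} (hf : Primrec f) (hg : Primrec g) :
    Primrec fun a => polyMul (f a) (g a) := by
  refine Primrec.list_foldr (h := fun a x => polyAdd (polySmul x.1 (g a)) ((0, 0) :: x.2)) hf
    (by fun_prop) ?_
  exact (show Primrec fun x : α × (RatCode × PolyCode) =>
    polyAdd (polySmul x.2.1 (g x.1)) ((0, 0) :: x.2.2) by fun_prop)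

@[fun_prop]
theorem primrec_polyEval {f : α → PolyCode} {g : α → RatCode} (hf : Primrec f)
    (hg : Primrec g) : Primrec fun a => polyEval (f a) (g a) := by
  refine Primrec.list_foldr (h := fun a x => ratAdd x.1 (ratMul (g a) x.2)) hf
    (by fun_prop) ?_
  exact (show Primrec fun x : α × (RatCode × RatCode) =>
    ratAdd x.2.1 (ratMul (g x.1) x.2.2) by fun_prop)

end Primrec

end LRS

namespace LRS

open Polynomial

/-! ### Codes of complex numbers -/

/-- A code of a complex number: codes of its real and its imaginary part. -/
abbrev CxCode := PolyCode × PolyCode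

/-- The code of the polynomial `1`. -/
def polyOne : PolyCode := [(1, 0)]

/-- Multiplication of codes of complex numbers. -/
def cxMul (z w : CxCode) : CxCode :=
  (polySub (polyMul z.1 w.1) (polyMul z.2 w.2), polyAdd (polyMul z.1 w.2) (polyMul z.2 w.1))

/-- Powers of codes of complex numbers. -/
def cxPow (z : CxCode) (n : ℕ) : CxCode := Nat.rec (polyOne, []) (fun _ s => cxMul s z) n

/-- The square of the absolute value. -/
def cxNormSq (z : CxCode) : PolyCode := polyAdd (polyMul z.1 z.1) (polyMul z.2 z.2)

/-- Multiplication of a complex number by a real number. -/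
def cxSmul (a : PolyCode) (z : CxCode) : CxCode := (polyMul a z.1, polyMul a z.2)

/-- The product of a list of complex numbers. -/
def cxProd (l : List CxCode) : CxCode := l.foldr cxMul (polyOne, [])

/-- A code of a triple `(e, b, μ)`. -/
abbrev TermCode := ℕ × CxCode × CxCode

/-- The value `C(n, e) * Re (b * μ ^ n)`. -/
def termCode (t : TermCode) (n : ℕ) : PolyCode :=
  polySmul ((n.choose t.1 : ℕ), 0) (cxMul t.2.1 (cxPow t.2.2 n)).1

/-- The sum of the values of a list of terms. -/
def sumCode (ts : List TermCode) (n : ℕ) : PolyCode :=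
  ts.foldr (fun t s => polyAdd (termCode t n) s) []

/-- The order of a recurrence satisfied by a list of terms. -/
def orderBound (ts : List TermCode) : ℕ := ts.foldr (fun t s => 2 * (t.1 + 1) + s) 0

section Primrec

variable {α : Type*} [Primcodable α]

@[fun_prop]
theorem primrec_cxMul {f g : α → CxCode} (hf : Primrec f) (hg : Primrec g) :
    Primrec fun a => cxMul (f a) (g a) := by
  unfold cxMul
  fun_prop

@[fun_prop]
theorem primrec_cxPow {f : α → CxCode} {g : α → ℕ} (hf : Primrec f) (hg : Primrec g) :
    Primrec fun a => cxPow (f a) (g a) := by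
  have h : Primrec₂ cxPow := by
    refine Primrec.nat_rec (f := fun _ : CxCode => ((polyOne, []) : CxCode))
      (g := fun z x => cxMul x.2 z) (by fun_prop) ?_
    exact (show Primrec fun x : CxCode × (ℕ × CxCode) => cxMul x.2.2 x.1 by fun_prop)
  exact h.comp hf hg

@[fun_prop]
theorem primrec_cxNormSq {f : α → CxCode} (hf : Primrec f) :
    Primrec fun a => cxNormSq (f a) := by
  unfold cxNormSq
  fun_prop

@[fun_prop]
theorem primrec_cxSmul {f : α → PolyCode} {g : α → CxCode} (hf : Primrec f) (hg : Primrec g) :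
    Primrec fun a => cxSmul (f a) (g a) := by
  unfold cxSmul
  fun_prop

@[fun_prop]
theorem primrec_cxProd {f : α → List CxCode} (hf : Primrec f) :
    Primrec fun a => cxProd (f a) := by
  refine Primrec.list_foldr (h := fun _ x => cxMul x.1 x.2) hf (by fun_prop) ?_
  exact (show Primrec fun x : α × (CxCode × CxCode) => cxMul x.2.1 x.2.2 by fun_prop)

@[fun_prop]
theorem primrec_termCode {f : α → TermCode} {g : α → ℕ} (hf : Primrec f) (hg : Primrec g) :
    Primrec fun a => termCode (f a) (g a) := by
  unfold termCode
  fun_prop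

@[fun_prop]
theorem primrec_sumCode {f : α → List TermCode} {g : α → ℕ} (hf : Primrec f)
    (hg : Primrec g) : Primrec fun a => sumCode (f a) (g a) := by
  refine Primrec.list_foldr (h := fun a x => polyAdd (termCode x.1 (g a)) x.2) hf
    (by fun_prop) ?_
  exact (show Primrec fun x : α × (TermCode × PolyCode) =>
    polyAdd (termCode x.2.1 (g x.1)) x.2.2 by fun_prop)

@[fun_prop]
theorem primrec_orderBound {f : α → List TermCode} (hf : Primrec f) :
    Primrec fun a => orderBound (f a) := by
  refine Primrec.list_foldr (g := fun _ => 0) (h := fun _ x => 2 * (x.1.1 + 1) + x.2) hf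
    (Primrec.const 0) ?_
  exact (show Primrec fun x : α × (TermCode × ℕ) => 2 * (x.2.1.1 + 1) + x.2.2 by fun_prop)

end Primrec

/-! ### Semidecidable relations between algebraic numbers

The codes `X`, `Y` stand for polynomials in a root of the polynomial `m`. -/

/-- The polynomials `X` and `Y` are congruent modulo `m`. -/
def CodeEq (m X Y : PolyCode) : Prop :=
  ∃ q : PolyCode, ∀ c ∈ polySub (polySub X Y) (polyMul q m), c.1 = 0

/-- Modulo `m`, the polynomial `X` is a square. -/
def CodeNonneg (m X : PolyCode) : Prop := ∃ y : PolyCode, CodeEq m X (polyMul y y)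

/-- Modulo `m`, the polynomial `X` is invertible. -/
def CodeNeZero (m X : PolyCode) : Prop := ∃ w : PolyCode, CodeEq m (polyMul X w) polyOne

/-- Modulo `m`, the polynomial `X` is an invertible square. -/
def CodePos (m X : PolyCode) : Prop := CodeNonneg m X ∧ CodeNeZero m X

/-- Equality of complex numbers. -/
def CxEq (m : PolyCode) (z w : CxCode) : Prop := CodeEq m z.1 w.1 ∧ CodeEq m z.2 w.2

/-- An exponent that is a multiple of the order of every root of unity in the field generated by
the imaginary unit and a root of `m`. -/
def unityExponent (m : PolyCode) : ℕ := (4 * m.length).factorial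

/-- The complex number `z` is no root of unity. -/
def CxNotUnity (m : PolyCode) (z : CxCode) : Prop :=
  CodeNeZero m (cxNormSq (polySub (cxPow z (unityExponent m)).1 polyOne,
    (cxPow z (unityExponent m)).2))

/-- The polynomial `m` changes sign, hence it has a real root. -/
def CodeHasRoot (m : PolyCode) : Prop :=
  ∃ ab : RatCode × RatCode, (-(polyEval m ab.1).1).toNat ≠ 0 ∧ (polyEval m ab.2).1.toNat ≠ 0

section SemiDec

variable {α : Type*} [Primcodable α]

theorem semiDec_eq {β : Type*} [Primcodable β] {f g : α → β} (hf : Primrec f) (hg : Primrec g) :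
    SemiDec fun a => f a = g a :=
  SemiDec.of_primrecPred (Primrec.eq.comp hf hg)

theorem semiDec_ne {β : Type*} [Primcodable β] {f g : α → β} (hf : Primrec f) (hg : Primrec g) :
    SemiDec fun a => f a ≠ g a :=
  SemiDec.of_primrecPred (PrimrecPred.not (Primrec.eq.comp hf hg))

theorem semiDec_lt {f g : α → ℕ} (hf : Primrec f) (hg : Primrec g) :
    SemiDec fun a => f a < g a :=
  SemiDec.of_primrecPred (Primrec.nat_lt.comp hf hg)

theorem semiDec_codeEq {m f g : α → PolyCode} (hm : Primrec m) (hf : Primrec f)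
    (hg : Primrec g) : SemiDec fun a => CodeEq (m a) (f a) (g a) := by
  refine SemiDec.exists (SemiDec.forall_mem (p := fun _ (c : RatCode) => c.1 = 0)
    (semiDec_eq (by fun_prop) (by fun_prop)) ?_)
  fun_prop

theorem semiDec_codeNonneg {m f : α → PolyCode} (hm : Primrec m) (hf : Primrec f) :
    SemiDec fun a => CodeNonneg (m a) (f a) :=
  SemiDec.exists (semiDec_codeEq (by fun_prop) (by fun_prop) (by fun_prop))

theorem semiDec_codeNeZero {m f : α → PolyCode} (hm : Primrec m) (hf : Primrec f) :
    SemiDec fun a => CodeNeZero (m a) (f a) :=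
  SemiDec.exists (semiDec_codeEq (by fun_prop) (by fun_prop) (by fun_prop))

theorem semiDec_codePos {m f : α → PolyCode} (hm : Primrec m) (hf : Primrec f) :
    SemiDec fun a => CodePos (m a) (f a) :=
  (semiDec_codeNonneg hm hf).and (semiDec_codeNeZero hm hf)

theorem semiDec_cxEq {m : α → PolyCode} {f g : α → CxCode} (hm : Primrec m) (hf : Primrec f)
    (hg : Primrec g) : SemiDec fun a => CxEq (m a) (f a) (g a) :=
  (semiDec_codeEq hm (by fun_prop) (by fun_prop)).and
    (semiDec_codeEq hm (by fun_prop) (by fun_prop))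

theorem semiDec_cxNotUnity {m : α → PolyCode} {f : α → CxCode} (hm : Primrec m)
    (hf : Primrec f) : SemiDec fun a => CxNotUnity (m a) (f a) := by
  unfold CxNotUnity unityExponent
  exact semiDec_codeNeZero hm (by fun_prop)

theorem semiDec_codeHasRoot {m : α → PolyCode} (hm : Primrec m) :
    SemiDec fun a => CodeHasRoot (m a) :=
  SemiDec.exists ((semiDec_ne (by fun_prop) (by fun_prop)).and
    (semiDec_ne (by fun_prop) (by fun_prop)))

end SemiDec

/-! ### Certificates -/

/-- The data of a dominant form: `(d, ρ, κ, c, r)` with `κ = ± ρ`, the numbers `(b, ω)` and the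
terms of smaller growth. -/
abbrev FormCode := ((ℕ × PolyCode × PolyCode × PolyCode × PolyCode) × CxCode × CxCode) ×
  List TermCode

/-- All terms of a dominant form. -/
def allTerms (w : FormCode) : List TermCode :=
  (w.1.1.1, (w.1.1.2.2.2.1, []), (w.1.1.2.2.1, [])) ::
    (w.1.1.1, w.1.2.1, cxSmul w.1.1.2.1 w.1.2.2) :: w.2

/-- The number `z` is `exp (i π δ)` for the density `δ` of the positive values of
`c + r * cos`. -/
def IsArcCode (m c r : PolyCode) (z : CxCode) : Prop :=
  (CodeNeZero m r ∧ CodeEq m (polyAdd (polyMul r z.1) c) []) ∨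
  ((CodeEq m (polyAdd z.1 polyOne) [] ∧ CodePos m c) ∧ CodeNonneg m (polySub c r)) ∨
  ((CodeEq m z.1 polyOne ∧ CodePos m (polySub [] c)) ∧ CodeNonneg m (polySub (polySub [] c) r))

/-- The data `w` describe a dominant form of the sequence `v n = u (n * P + l)`, and `z` is
`exp (i π δ)` for the density `δ` of its positive values. -/
def IsFormCode (I : Code) (m : PolyCode) (P l : ℕ) (z : CxCode) (w : FormCode) : Prop :=
  ((CodePos m w.1.1.2.1 ∧ CodeEq m (cxNormSq w.1.2.2) polyOne) ∧
    (CodeNonneg m w.1.1.2.2.2.2 ∧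
      CodeEq m (polyMul w.1.1.2.2.2.2 w.1.1.2.2.2.2) (cxNormSq w.1.2.1))) ∧
  (CodeEq m w.1.1.2.2.2.2 [] ∨ CxNotUnity m w.1.2.2) ∧
  (∀ t ∈ w.2, CodePos m (polySub (polyMul w.1.1.2.1 w.1.1.2.1) (cxNormSq t.2.2)) ∨
    (CodeEq m (cxNormSq t.2.2) (polyMul w.1.1.2.1 w.1.1.2.1) ∧ t.1 < w.1.1.1)) ∧
  (∀ n < I.length + orderBound (allTerms w),
    CodeEq m [seqCode I (n * P + l)] (sumCode (allTerms w) n)) ∧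
  (CodeEq m (cxNormSq z) polyOne ∧ CodeNonneg m z.2) ∧
  (CodeNeZero m w.1.1.2.2.2.1 ∨ CodeNeZero m w.1.1.2.2.2.2) ∧
  ((CodeEq m w.1.1.2.2.1 w.1.1.2.1 ∧ IsArcCode m w.1.1.2.2.2.1 w.1.1.2.2.2.2 z) ∨
    (CodeEq m (polyAdd w.1.1.2.2.1 w.1.1.2.1) [] ∧ CxEq m z ([], polyOne)))

/-- The number `z` is `exp (i π δ)` for the density `δ` of the positive values of the sequence
`v n = u (n * P + l)`. -/
def IsDensityCode (I : Code) (m : PolyCode) (P l : ℕ) (z : CxCode) : Prop :=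
  ((∀ n < I.length, (seqCode I (n * P + l)).1 = 0) ∧ CxEq m z (polyOne, [])) ∨
    ∃ w : FormCode, IsFormCode I m P l z w

/-- One step of the summation of angles: the angle `π * t` of a complex number in the open upper
half plane or at `1`, together with an integer part, is increased by the angle of `z`. -/
def IsAngleStep (m : PolyCode) (z : CxCode) (s s' : CxCode × ℕ) : Prop :=
  ((s'.2 = s.2 ∧ CxEq m s'.1 (cxMul s.1 z)) ∨
    (s'.2 = s.2 + 1 ∧ CxEq m s'.1 (cxMul ([(-1, 0)], []) (cxMul s.1 z)))) ∧
  (CodePos m s'.1.2 ∨ CxEq m s'.1 (polyOne, []))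

/-- A certificate that the sum of the densities with codes `zs`, divided by their number, is the
rational number with code `q`. -/
def IsRationalSum (m : PolyCode) (zs : List CxCode) (q : RatCode) : Prop :=
  ∃ w : (ℕ × ℕ) × List (CxCode × ℕ), 0 < w.1.1 ∧
    (w.2.getD 0 (([], []), 0) = ((polyOne, []), 0) ∧
      w.2.getD (w.1.1 * zs.length) (([], []), 0) = ((polyOne, []), w.1.2)) ∧
    q = ((w.1.2 : ℤ), w.1.1 * zs.length - 1) ∧
    ∀ j < w.1.1 * zs.length, IsAngleStep m (zs.getD (j % zs.length) ([], []))
      (w.2.getD j (([], []), 0)) (w.2.getD (j + 1) (([], []), 0))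

/-- A certificate for the output `o` on the input `I`. -/
def IsOutput (I : Code) (o : Option RatCode) : Prop :=
  ∃ x : PolyCode × List CxCode, (CodeHasRoot x.1 ∧ 0 < x.2.length) ∧
    (∀ l < x.2.length, IsDensityCode I x.1 x.2.length l (x.2.getD l ([], []))) ∧
    ((o = none ∧ CxNotUnity x.1 (cxProd x.2)) ∨
      ∃ q : RatCode, o = some q ∧ IsRationalSum x.1 x.2 q)

section SemiDec

variable {α : Type*} [Primcodable α]

@[fun_prop]
theorem primrec_allTerms {f : α → FormCode} (hf : Primrec f) :
    Primrec fun a => allTerms (f a) := by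
  unfold allTerms
  fun_prop

theorem semiDec_isArcCode {m c r : α → PolyCode} {z : α → CxCode} (hm : Primrec m)
    (hc : Primrec c) (hr : Primrec r) (hz : Primrec z) :
    SemiDec fun a => IsArcCode (m a) (c a) (r a) (z a) := by
  refine SemiDec.or (SemiDec.and (semiDec_codeNeZero ?_ ?_) (semiDec_codeEq ?_ ?_ ?_))
    (SemiDec.or (SemiDec.and (SemiDec.and (semiDec_codeEq ?_ ?_ ?_) (semiDec_codePos ?_ ?_))
      (semiDec_codeNonneg ?_ ?_)) (SemiDec.and (SemiDec.and (semiDec_codeEq ?_ ?_ ?_)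
        (semiDec_codePos ?_ ?_)) (semiDec_codeNonneg ?_ ?_))) <;> fun_prop

theorem semiDec_isFormCode {I : α → Code} {m : α → PolyCode} {P l : α → ℕ} {z : α → CxCode}
    {w : α → FormCode} (hI : Primrec I) (hm : Primrec m) (hP : Primrec P) (hl : Primrec l)
    (hz : Primrec z) (hw : Primrec w) :
    SemiDec fun a => IsFormCode (I a) (m a) (P a) (l a) (z a) (w a) := by
  refine SemiDec.and (SemiDec.and ((semiDec_codePos ?_ ?_).and (semiDec_codeEq ?_ ?_ ?_))
      ((semiDec_codeNonneg ?_ ?_).and (semiDec_codeEq ?_ ?_ ?_)))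
    (SemiDec.and ((semiDec_codeEq ?_ ?_ ?_).or (semiDec_cxNotUnity ?_ ?_))
    (SemiDec.and (SemiDec.forall_mem ((semiDec_codePos ?_ ?_).or
      ((semiDec_codeEq ?_ ?_ ?_).and (semiDec_lt ?_ ?_))) ?_)
    (SemiDec.and (SemiDec.forall_lt (semiDec_codeEq ?_ ?_ ?_) ?_)
    (SemiDec.and ((semiDec_codeEq ?_ ?_ ?_).and (semiDec_codeNonneg ?_ ?_))
    (SemiDec.and ((semiDec_codeNeZero ?_ ?_).or (semiDec_codeNeZero ?_ ?_))
    (SemiDec.or ((semiDec_codeEq ?_ ?_ ?_).and (semiDec_isArcCode ?_ ?_ ?_ ?_))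
      ((semiDec_codeEq ?_ ?_ ?_).and (semiDec_cxEq ?_ ?_ ?_)))))))) <;> fun_prop

theorem semiDec_isDensityCode {I : α → Code} {m : α → PolyCode} {P l : α → ℕ} {z : α → CxCode}
    (hI : Primrec I) (hm : Primrec m) (hP : Primrec P) (hl : Primrec l) (hz : Primrec z) :
    SemiDec fun a => IsDensityCode (I a) (m a) (P a) (l a) (z a) := by
  refine SemiDec.or (SemiDec.and (SemiDec.forall_lt
    (p := fun a n => (seqCode (I a) (n * P a + l a)).1 = 0) (semiDec_eq ?_ ?_) ?_)
    (semiDec_cxEq ?_ ?_ ?_)) (SemiDec.exists (semiDec_isFormCode ?_ ?_ ?_ ?_ ?_ ?_)) <;> fun_prop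

theorem semiDec_isAngleStep {m : α → PolyCode} {z : α → CxCode} {s s' : α → CxCode × ℕ}
    (hm : Primrec m) (hz : Primrec z) (hs : Primrec s) (hs' : Primrec s') :
    SemiDec fun a => IsAngleStep (m a) (z a) (s a) (s' a) := by
  refine SemiDec.and (SemiDec.or ((semiDec_eq ?_ ?_).and (semiDec_cxEq ?_ ?_ ?_))
    ((semiDec_eq ?_ ?_).and (semiDec_cxEq ?_ ?_ ?_)))
    (SemiDec.or (semiDec_codePos ?_ ?_) (semiDec_cxEq ?_ ?_ ?_)) <;> fun_prop

theorem semiDec_isRationalSum {m : α → PolyCode} {zs : α → List CxCode} {q : α → RatCode}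
    (hm : Primrec m) (hzs : Primrec zs) (hq : Primrec q) :
    SemiDec fun a => IsRationalSum (m a) (zs a) (q a) := by
  refine SemiDec.exists (SemiDec.and (semiDec_lt ?_ ?_) (SemiDec.and
    ((semiDec_eq ?_ ?_).and (semiDec_eq ?_ ?_)) (SemiDec.and (semiDec_eq ?_ ?_)
    (SemiDec.forall_lt (semiDec_isAngleStep ?_ ?_ ?_ ?_) ?_)))) <;> fun_prop

theorem semiDec_isOutput :
    SemiDec fun x : Code × Option RatCode => IsOutput x.1 x.2 := by
  refine SemiDec.exists (SemiDec.and ((semiDec_codeHasRoot ?_).and (semiDec_lt ?_ ?_))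
    (SemiDec.and (SemiDec.forall_lt (semiDec_isDensityCode ?_ ?_ ?_ ?_ ?_) ?_)
    (SemiDec.or ((semiDec_eq ?_ ?_).and (semiDec_cxNotUnity ?_ ?_))
      (SemiDec.exists (SemiDec.and (semiDec_eq ?_ (Primrec.option_some.comp ?_))
        (semiDec_isRationalSum ?_ ?_ ?_)))))) <;> fun_prop

end SemiDec

end LRS

namespace LRS

open Polynomial

/-! ### The numbers that codes stand for -/

/-- The value at `β` of the polynomial with a given code. -/
noncomputable def codeVal (β : ℝ) (p : PolyCode) : ℝ := aeval β (polyOf p)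

/-- The complex number with a given code. -/
noncomputable def cxVal (β : ℝ) (z : CxCode) : ℂ := ⟨codeVal β z.1, codeVal β z.2⟩

/-- The triple with a given code. -/
noncomputable def termVal (β : ℝ) (t : TermCode) : ℕ × ℂ × ℂ :=
  (t.1, cxVal β t.2.1, cxVal β t.2.2)

section Values

variable (β : ℝ)

@[simp] theorem codeVal_polyAdd (p q : PolyCode) :
    codeVal β (polyAdd p q) = codeVal β p + codeVal β q := by
  simp [codeVal, polyOf_polyAdd]

@[simp] theorem codeVal_polySub (p q : PolyCode) :
    codeVal β (polySub p q) = codeVal β p - codeVal β q := by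
  simp [codeVal, polyOf_polySub]

@[simp] theorem codeVal_polyMul (p q : PolyCode) :
    codeVal β (polyMul p q) = codeVal β p * codeVal β q := by
  simp [codeVal, polyOf_polyMul]

@[simp] theorem codeVal_polySmul (a : RatCode) (p : PolyCode) :
    codeVal β (polySmul a p) = (a.val : ℝ) * codeVal β p := by
  simp [codeVal, polyOf_polySmul]

@[simp] theorem codeVal_nil : codeVal β [] = 0 := by simp [codeVal, polyOf]

@[simp] theorem codeVal_singleton (a : RatCode) : codeVal β [a] = (a.val : ℝ) := by
  simp [codeVal, polyOf]

@[simp] theorem codeVal_polyOne : codeVal β polyOne = 1 := by simp [polyOne, RatCode.val]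

@[simp] theorem cxVal_re (z : CxCode) : (cxVal β z).re = codeVal β z.1 := rfl

@[simp] theorem cxVal_im (z : CxCode) : (cxVal β z).im = codeVal β z.2 := rfl

@[simp] theorem cxVal_one : cxVal β (polyOne, []) = 1 := by
  apply Complex.ext <;> simp

@[simp] theorem cxVal_cxMul (z w : CxCode) : cxVal β (cxMul z w) = cxVal β z * cxVal β w := by
  apply Complex.ext <;> simp [cxMul]

@[simp] theorem cxVal_cxPow (z : CxCode) (n : ℕ) : cxVal β (cxPow z n) = cxVal β z ^ n := by
  induction n with
  | zero => simp [cxPow]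
  | succ n ih =>
    have : cxPow z (n + 1) = cxMul (cxPow z n) z := rfl
    rw [this, cxVal_cxMul, ih, pow_succ]

@[simp] theorem codeVal_cxNormSq (z : CxCode) : codeVal β (cxNormSq z) = ‖cxVal β z‖ ^ 2 := by
  rw [← Complex.normSq_eq_norm_sq, Complex.normSq_apply]
  simp [cxNormSq]

@[simp] theorem cxVal_cxSmul (a : PolyCode) (z : CxCode) :
    cxVal β (cxSmul a z) = codeVal β a * cxVal β z := by
  apply Complex.ext <;> simp [cxSmul]

@[simp] theorem cxVal_cxProd (l : List CxCode) :
    cxVal β (cxProd l) = (l.map (cxVal β)).prod := by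
  induction l with
  | nil => simp [cxProd]
  | cons z l ih =>
    have : cxProd (z :: l) = cxMul z (cxProd l) := rfl
    rw [this, cxVal_cxMul, ih, List.map_cons, List.prod_cons]

@[simp] theorem codeVal_termCode (t : TermCode) (n : ℕ) :
    codeVal β (termCode t n) = termSeq (termVal β t) n := by
  rw [termCode, codeVal_polySmul, val_natCast, ← cxVal_re, cxVal_cxMul, cxVal_cxPow]
  simp [termSeq, termVal]

@[simp] theorem codeVal_sumCode (ts : List TermCode) (n : ℕ) :
    codeVal β (sumCode ts n) = ((ts.map (termVal β)).map fun t => termSeq t n).sum := by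
  induction ts with
  | nil => simp [sumCode]
  | cons t ts ih =>
    have : sumCode (t :: ts) n = polyAdd (termCode t n) (sumCode ts n) := rfl
    rw [this, codeVal_polyAdd, ih, codeVal_termCode]
    simp

end Values

/-! ### Soundness of the relations between codes -/

section Sound

variable {β : ℝ} {m : PolyCode}

/-- Evaluation at a real root of `m` factors through polynomials modulo `m`. For soundness it does
not matter which root is taken, nor whether `m` is irreducible. -/
theorem CodeEq.codeVal_eq (hβ : codeVal β m = 0) {X Y : PolyCode} (h : CodeEq m X Y) :
    codeVal β X = codeVal β Y := by
  obtain ⟨q, hq⟩ := h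
  have h1 : codeVal β (polySub (polySub X Y) (polyMul q m)) = 0 := by
    rw [codeVal, (polyOf_eq_zero_iff _).2 hq, map_zero]
  simp [hβ, sub_eq_zero] at h1
  exact h1

theorem CodeNonneg.codeVal_nonneg (hβ : codeVal β m = 0) {X : PolyCode} (h : CodeNonneg m X) :
    0 ≤ codeVal β X := by
  obtain ⟨y, hy⟩ := h
  rw [hy.codeVal_eq hβ, codeVal_polyMul]
  exact mul_self_nonneg _

theorem CodeNeZero.codeVal_ne_zero (hβ : codeVal β m = 0) {X : PolyCode} (h : CodeNeZero m X) :
    codeVal β X ≠ 0 := by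
  obtain ⟨w, hw⟩ := h
  have := hw.codeVal_eq hβ
  rw [codeVal_polyMul, codeVal_polyOne] at this
  exact left_ne_zero_of_mul_eq_one this

theorem CodePos.codeVal_pos (hβ : codeVal β m = 0) {X : PolyCode} (h : CodePos m X) :
    0 < codeVal β X :=
  lt_of_le_of_ne (h.1.codeVal_nonneg hβ) (h.2.codeVal_ne_zero hβ).symm

theorem CxEq.cxVal_eq (hβ : codeVal β m = 0) {z w : CxCode} (h : CxEq m z w) :
    cxVal β z = cxVal β w :=
  Complex.ext (h.1.codeVal_eq hβ) (h.2.codeVal_eq hβ)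

/-- This is the intermediate value theorem. The positive value also shows that the polynomial is not
zero, which the degree bound for roots of unity needs. -/
theorem CodeHasRoot.exists_root (h : CodeHasRoot m) :
    ∃ β : ℝ, codeVal β m = 0 ∧ polyOf m ≠ 0 := by
  obtain ⟨⟨a, b⟩, ha, hb⟩ := h
  have hval : ∀ a : RatCode, codeVal (a.val : ℝ) m = ((polyEval m a).val : ℝ) := by
    intro a
    rw [val_polyEval, codeVal]
    have := aeval_algebraMap_apply_eq_algebraMap_eval (A := ℝ) a.val (polyOf m)
    simpa using this
  have hb' : 0 < codeVal (b.val : ℝ) m := by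
    rw [hval]
    exact_mod_cast (val_pos_iff _).2 (by simp only at hb; omega)
  have ha' : codeVal (a.val : ℝ) m < 0 := by
    have h1 : (polyEval m a).1 < 0 := by simp only at ha; omega
    have h2 : (polyEval m a).val < 0 := by
      rw [RatCode.val]
      exact div_neg_of_neg_of_pos (by exact_mod_cast h1) (by positivity)
    rw [hval]
    exact_mod_cast h2
  have hcont : Continuous fun x => codeVal x m := by
    unfold codeVal
    exact (polyOf m).continuous_aeval
  obtain ⟨β, hβ⟩ := mem_range_of_exists_le_of_exists_ge hcont ⟨_, ha'.le⟩ ⟨_, hb'.le⟩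
  refine ⟨β, hβ, fun h0 => ?_⟩
  rw [codeVal, h0, map_zero] at hb'
  exact lt_irrefl _ hb'

end Sound

end LRS

namespace LRS

open Polynomial

/-! ### Roots of unity in a number field -/

/-- It suffices to treat the prime powers that divide `N`. Such a power `p ^ (k + 1)` is at most
twice its totient, because `p ≤ 2 * (p - 1)`, and its totient is at most `2 * D`. So it is one of
the factors of `(4 * D)!`. -/
theorem dvd_factorial_of_totient_le {N D : ℕ} (hN : 0 < N) (h : N.totient ≤ 2 * D) :
    N ∣ (4 * D).factorial := by
  rw [Nat.dvd_iff_prime_pow_dvd_dvd]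
  intro p k hp hk
  cases k with
  | zero => simp
  | succ k =>
    refine Nat.dvd_factorial (pow_pos hp.pos _) ?_
    have h1 : (p ^ (k + 1)).totient ≤ 2 * D :=
      (Nat.le_of_dvd (Nat.totient_pos.2 hN) (Nat.totient_dvd_of_dvd hk)).trans h
    rw [Nat.totient_prime_pow_succ hp] at h1
    have h2 : p ≤ 2 * (p - 1) := by have := hp.two_le; omega
    calc p ^ (k + 1) = p ^ k * p := pow_succ _ _
      _ ≤ p ^ k * (2 * (p - 1)) := Nat.mul_le_mul_left _ h2
      _ = 2 * (p ^ k * (p - 1)) := by ring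
      _ ≤ 2 * (2 * D) := Nat.mul_le_mul_left _ h1
      _ = 4 * D := by ring

/-- A root of unity whose minimal polynomial has degree at most `2 * D` has order dividing
`(4 * D)!`. -/
theorem pow_factorial_eq_one {w : ℂ} {n D : ℕ} (hn : 0 < n) (hw : w ^ n = 1)
    (hdeg : (minpoly ℚ w).natDegree ≤ 2 * D) : w ^ (4 * D).factorial = 1 := by
  have hpos : 0 < orderOf w := orderOf_pos_iff.2 (isOfFinOrder_iff_pow_eq_one.2 ⟨n, hn, hw⟩)
  rw [← cyclotomic_eq_minpoly_rat (IsPrimitiveRoot.orderOf w) hpos, natDegree_cyclotomic] at hdeg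
  exact orderOf_dvd_iff_pow_eq_one.1 (dvd_factorial_of_totient_le hpos hdeg)

/-- The number `w` lies in the compositum of `ℚ(β)` and `ℚ(i)`. The first field has degree at most
that of `f`, the second at most `2`. -/
theorem natDegree_minpoly_le_of_mem {f : ℚ[X]} (hf : f ≠ 0) {β : ℝ} (hβ : aeval β f = 0)
    {w : ℂ} (hre : ∃ p : ℚ[X], aeval β p = w.re) (him : ∃ p : ℚ[X], aeval β p = w.im) :
    (minpoly ℚ w).natDegree ≤ 2 * f.natDegree := by
  have hβ' : aeval (β : ℂ) f = 0 := by
    have := aeval_algebraMap_apply ℂ β f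
    rw [hβ, map_zero] at this
    exact this
  have hintegral : IsIntegral ℚ (β : ℂ) := isAlgebraic_iff_isIntegral.1 ⟨f, hf, hβ'⟩
  have hI : aeval Complex.I (X ^ 2 + 1 : ℚ[X]) = 0 := by simp
  have hI0 : (X ^ 2 + 1 : ℚ[X]) ≠ 0 := (monic_X_pow_add_C (1 : ℚ) two_ne_zero).ne_zero
  have hIint : IsIntegral ℚ Complex.I := isAlgebraic_iff_isIntegral.1 ⟨_, hI0, hI⟩
  set A := IntermediateField.adjoin ℚ {(β : ℂ)}
  set B := IntermediateField.adjoin ℚ {Complex.I}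
  have hA : Module.finrank ℚ A ≤ f.natDegree := by
    rw [IntermediateField.adjoin.finrank hintegral]
    exact natDegree_le_of_dvd (minpoly.dvd ℚ _ hβ') hf
  have hB : Module.finrank ℚ B ≤ 2 := by
    rw [IntermediateField.adjoin.finrank hIint]
    refine (natDegree_le_of_dvd (minpoly.dvd ℚ _ hI) hI0).trans ?_
    exact (natDegree_X_pow_add_C (n := 2) (r := (1 : ℚ))).le
  have : FiniteDimensional ℚ A := IntermediateField.adjoin.finiteDimensional hintegral
  have : FiniteDimensional ℚ B := IntermediateField.adjoin.finiteDimensional hIint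
  have hβA : (β : ℂ) ∈ A ⊔ B :=
    (le_sup_left : A ≤ A ⊔ B) (IntermediateField.mem_adjoin_simple_self ℚ _)
  have hIB : Complex.I ∈ A ⊔ B :=
    (le_sup_right : B ≤ A ⊔ B) (IntermediateField.mem_adjoin_simple_self ℚ _)
  have hmem : ∀ x : ℝ, (∃ p : ℚ[X], aeval β p = x) → (x : ℂ) ∈ A ⊔ B := by
    rintro x ⟨p, rfl⟩
    have h1 : ((aeval β p : ℝ) : ℂ) = aeval (β : ℂ) p := (aeval_algebraMap_apply ℂ β p).symm
    have h2 := aeval_algebraMap_apply ℂ (⟨β, hβA⟩ : (A ⊔ B : IntermediateField ℚ ℂ)) p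
    rw [h1]
    change aeval (β : ℂ) p = _ at h2
    rw [h2]
    exact SetLike.coe_mem _
  have hw : w ∈ A ⊔ B := by
    rw [← Complex.re_add_im w]
    exact add_mem (hmem _ hre) (mul_mem (hmem _ him) hIB)
  have hle : IntermediateField.adjoin ℚ {w} ≤ A ⊔ B := by
    rw [IntermediateField.adjoin_simple_le_iff]
    exact hw
  have : FiniteDimensional ℚ (A ⊔ B : IntermediateField ℚ ℂ) := inferInstance
  have hwint : IsIntegral ℚ w :=
    (IntermediateField.isIntegral_iff (S := A ⊔ B) (x := ⟨w, hw⟩)).1 (IsIntegral.of_finite ℚ _)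
  rw [← IntermediateField.adjoin.finrank hwint]
  calc _ ≤ Module.finrank ℚ (A ⊔ B : IntermediateField ℚ ℂ) :=
        Submodule.finrank_mono (s := (IntermediateField.adjoin ℚ {w}).toSubmodule)
          (t := (A ⊔ B).toSubmodule) hle
    _ ≤ Module.finrank ℚ A * Module.finrank ℚ B := IntermediateField.finrank_sup_le A B
    _ ≤ f.natDegree * 2 := Nat.mul_le_mul hA hB
    _ = 2 * f.natDegree := mul_comm _ _

section Sound

variable {β : ℝ} {m : PolyCode}

theorem cxVal_pow_unityExponent (hm : polyOf m ≠ 0) (hβ : codeVal β m = 0) {z : CxCode} {n : ℕ}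
    (hn : 0 < n) (hz : cxVal β z ^ n = 1) : cxVal β z ^ unityExponent m = 1 :=
  pow_factorial_eq_one hn hz <|
    (natDegree_minpoly_le_of_mem hm hβ ⟨polyOf z.1, rfl⟩ ⟨polyOf z.2, rfl⟩).trans
      (Nat.mul_le_mul_left _ (natDegree_polyOf_le m))

theorem codeVal_cxNormSq_sub_one (z : CxCode) :
    codeVal β (cxNormSq (polySub z.1 polyOne, z.2)) = ‖cxVal β z - 1‖ ^ 2 := by
  rw [codeVal_cxNormSq]
  congr 2
  apply Complex.ext <;> simp

/-- One exponent decides about all of them: the order of any root of unity that has a code divides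
`unityExponent m`. -/
theorem CxNotUnity.pow_ne_one (hm : polyOf m ≠ 0) (hβ : codeVal β m = 0) {z : CxCode}
    (h : CxNotUnity m z) {n : ℕ} (hn : 0 < n) : cxVal β z ^ n ≠ 1 := by
  intro hz
  apply h.codeVal_ne_zero hβ
  rw [codeVal_cxNormSq_sub_one, cxVal_cxPow, cxVal_pow_unityExponent hm hβ hn hz]
  simp

end Sound

end LRS

namespace LRS

open Polynomial

/-! ### Verifying a representation on finitely many terms -/

/-- A real part is half the sum of a number and its conjugate, so the sequence mixes the powers of
`μ` and of its conjugate. This accounts for the factor `2` in `orderBound`. -/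
theorem aeval_shift_termSeq (t : ℕ × ℂ × ℂ) :
    aeval (shift ℂ) ((X - C t.2.2) ^ (t.1 + 1) * (X - C ((starRingEnd ℂ) t.2.2)) ^ (t.1 + 1))
      (fun n => (termSeq t n : ℂ)) = 0 := by
  obtain ⟨e, b, μ⟩ := t
  have h : (fun n => (termSeq (e, b, μ) n : ℂ)) =
      (b / 2) • (fun n : ℕ => (n.choose e : ℂ) * μ ^ n) +
        ((starRingEnd ℂ) b / 2) • (fun n : ℕ => (n.choose e : ℂ) * ((starRingEnd ℂ) μ) ^ n) := by
    funext n
    simp only [termSeq, Pi.add_apply, Pi.smul_apply, smul_eq_mul]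
    push_cast
    rw [Complex.re_eq_add_conj, map_mul, map_pow]
    ring
  rw [h, map_add, map_smul, map_smul,
    aeval_shift_eq_zero_of_dvd (Dvd.intro _ rfl) (aeval_shift_choose_mul_pow μ e),
    aeval_shift_eq_zero_of_dvd (Dvd.intro_left _ rfl)
      (aeval_shift_choose_mul_pow ((starRingEnd ℂ) μ) e)]
  simp

theorem exists_annihilator_sum_termSeq (ts : List (ℕ × ℂ × ℂ)) :
    ∃ h : ℂ[X], h.Monic ∧ h.natDegree = (ts.map fun t => 2 * (t.1 + 1)).sum ∧
      aeval (shift ℂ) h (fun n => (((ts.map fun t => termSeq t n).sum : ℝ) : ℂ)) = 0 := by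
  induction ts with
  | nil =>
    refine ⟨1, monic_one, by simp, ?_⟩
    funext n
    simp
  | cons t ts ih =>
    obtain ⟨h, hmon, hdeg, hann⟩ := ih
    have hm1 : ((X - C t.2.2) ^ (t.1 + 1) : ℂ[X]).Monic := (monic_X_sub_C _).pow _
    have hm2 : ((X - C ((starRingEnd ℂ) t.2.2)) ^ (t.1 + 1) : ℂ[X]).Monic :=
      (monic_X_sub_C _).pow _
    refine ⟨_, (hm1.mul hm2).mul hmon, ?_, ?_⟩
    · rw [(hm1.mul hm2).natDegree_mul hmon, hm1.natDegree_mul hm2, hdeg,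
        (monic_X_sub_C _).natDegree_pow, (monic_X_sub_C _).natDegree_pow]
      simp
      ring
    · have hs : (fun n => ((((t :: ts).map fun t => termSeq t n).sum : ℝ) : ℂ)) =
          (fun n => (termSeq t n : ℂ)) +
            fun n => (((ts.map fun t => termSeq t n).sum : ℝ) : ℂ) := by
        funext n
        simp
      rw [hs, map_add, aeval_shift_eq_zero_of_dvd (Dvd.intro _ rfl) (aeval_shift_termSeq t),
        aeval_shift_eq_zero_of_dvd (Dvd.intro_left _ rfl) hann, add_zero]

/-- A linear recurrence sequence that begins like a sum of terms is equal to this sum. -/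
theorem eq_sum_termSeq {g : ℂ[X]} (hg : g.Monic) {x : ℕ → ℝ}
    (hx : aeval (shift ℂ) g (fun n => (x n : ℂ)) = 0) {ts : List (ℕ × ℂ × ℂ)}
    (h : ∀ n < g.natDegree + (ts.map fun t => 2 * (t.1 + 1)).sum,
      x n = (ts.map fun t => termSeq t n).sum) (n : ℕ) :
    x n = (ts.map fun t => termSeq t n).sum := by
  obtain ⟨f, hf, hdeg, hann⟩ := exists_annihilator_sum_termSeq ts
  have h0 : (fun n => (x n : ℂ)) - (fun n => (((ts.map fun t => termSeq t n).sum : ℝ) : ℂ)) =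
      0 := by
    -- The product of the two annihilators kills the difference, so as many zeros as its degree
    -- suffice.
    refine eq_zero_of_aeval_shift (hg.mul hf) ?_ ?_
    · rw [map_sub, aeval_shift_eq_zero_of_dvd (Dvd.intro _ rfl) hx,
        aeval_shift_eq_zero_of_dvd (Dvd.intro_left _ rfl) hann, sub_zero]
    · intro n hn
      rw [hg.natDegree_mul hf, hdeg] at hn
      rw [Pi.sub_apply, h n hn, sub_self]
  have := congrFun h0 n
  rw [Pi.sub_apply, Pi.zero_apply, sub_eq_zero] at this
  exact_mod_cast this

theorem Code.exists_subsequence_annihilator (I : Code) {P : ℕ} (hP : 0 < P) :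
    ∃ h : ℂ[X], h.Monic ∧ h.natDegree = I.length ∧ (I.Valid → h.eval 0 ≠ 0) ∧
      ∀ l, aeval (shift ℂ) h (castSeq ℂ fun n => I.seq (n * P + l)) = 0 := by
  obtain ⟨h, h1, h2, h3, h4⟩ :=
    LRS.exists_subsequence_annihilator I.charPoly_monic I.aeval_shift_charPoly hP
  exact ⟨h, h1, h2.trans I.natDegree_charPoly, fun hI => h3 hI.eval_zero_charPoly, h4⟩

/-! ### Soundness of certificates -/

theorem orderBound_eq (β : ℝ) (ts : List TermCode) :
    orderBound ts = ((ts.map (termVal β)).map fun t => 2 * (t.1 + 1)).sum := by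
  induction ts with
  | nil => rfl
  | cons t ts ih =>
    have : orderBound (t :: ts) = 2 * (t.1 + 1) + orderBound ts := rfl
    rw [this, ih]
    rfl

section Sound

variable {β : ℝ} {m : PolyCode}

/-- A point of the closed upper half of the unit circle, written with the arc cosine of its real
part. -/
theorem eq_exp_arccos {z : ℂ} (hz : ‖z‖ = 1) (him : 0 ≤ z.im) :
    z = Complex.exp (Real.pi * ((Real.arccos z.re / Real.pi : ℝ) : ℂ) * Complex.I) := by
  have h1 : ((Real.pi : ℝ) : ℂ) * ((Real.arccos z.re / Real.pi : ℝ) : ℂ) =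
      ((Real.arccos z.re : ℝ) : ℂ) := by
    rw [← Complex.ofReal_mul, mul_div_cancel₀ _ Real.pi_ne_zero]
  have h2 : z.re ^ 2 + z.im ^ 2 = 1 := by
    have := Complex.normSq_apply z
    rw [Complex.normSq_eq_norm_sq, hz] at this
    nlinarith
  have h3 : -1 ≤ z.re := by nlinarith [sq_nonneg z.im]
  have h4 : z.re ≤ 1 := by nlinarith [sq_nonneg z.im]
  rw [h1]
  apply Complex.ext
  · rw [Complex.exp_ofReal_mul_I_re, Real.cos_arccos h3 h4]
  · rw [Complex.exp_ofReal_mul_I_im, Real.sin_arccos, ← Real.sqrt_sq him]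
    congr 1
    linarith

/-- The density of the set of positive values of a sequence, with its code. -/
def HasDensityAngle (x : ℕ → ℚ) (z : ℂ) (δ : ℝ) : Prop :=
  0 ≤ δ ∧ δ ≤ 1 ∧ HasDensity {n | 0 < (x n : ℝ)} δ ∧
    z = Complex.exp (Real.pi * (δ : ℂ) * Complex.I)

theorem HasDensityAngle.of_arccos {x : ℕ → ℚ} {z : ℂ} (hz : ‖z‖ = 1) (him : 0 ≤ z.im)
    (h : HasDensity {n | 0 < (x n : ℝ)} (Real.arccos z.re / Real.pi)) :
    HasDensityAngle x z (Real.arccos z.re / Real.pi) :=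
  ⟨div_nonneg (Real.arccos_nonneg _) Real.pi_pos.le,
    div_le_one_of_le₀ (Real.arccos_le_pi _) Real.pi_pos.le, h, eq_exp_arccos hz him⟩

/-- The density of the positive values of a sequence with a dominant form. -/
theorem IsDominantForm.hasDensity {x : ℕ → ℝ} {σ : ℝ} {d : ℕ} {ρ c : ℝ} {b ω : ℂ}
    {ts : List (ℕ × ℂ × ℂ)} (h : IsDominantForm x σ d ρ c b ω ts) :
    (σ = 1 → (b ≠ 0 → HasDensity {n | 0 < x n} (Real.arccos (-c / ‖b‖) / Real.pi)) ∧
      (‖b‖ ≤ c → HasDensity {n | 0 < x n} 1) ∧ (‖b‖ ≤ -c → HasDensity {n | 0 < x n} 0)) ∧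
    (σ = -1 → HasDensity {n | 0 < x n} (1 / 2)) := by
  have hd : (0 : ℝ) < d.factorial := by positivity
  have hr : (0 : ℝ) ≤ ‖b‖ / d.factorial := by positivity
  have hcr : c / d.factorial ≠ 0 ∨ ‖b‖ / d.factorial ≠ 0 :=
    h.ne_zero.imp (fun h => div_ne_zero h hd.ne')
      (fun h => div_ne_zero (norm_ne_zero_iff.2 h) hd.ne')
  constructor
  · rintro rfl
    obtain ⟨θ, τ, hθ, hlim⟩ := h.exists_tendsto (by simp)
    simp only [one_pow, mul_one] at hlim
    obtain ⟨h1, h2, h3⟩ := hasDensity_pos_cases hr hcr hθ hlim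
    refine ⟨fun hb => ?_, fun hc => ?_, fun hc => ?_⟩
    · have hb' : ‖b‖ ≠ 0 := norm_ne_zero_iff.2 hb
      have := hasDensity_of_tendsto_div h.pos (h1 (div_ne_zero hb' hd.ne'))
      rwa [show -(c / d.factorial) / (‖b‖ / d.factorial) = -c / ‖b‖ by field_simp] at this
    · exact hasDensity_of_tendsto_div h.pos (h2 (by gcongr))
    · refine hasDensity_of_tendsto_div h.pos (h3 ?_)
      rw [← neg_div]
      gcongr
  · rintro rfl
    obtain ⟨θ, τ, hθ, hlim⟩ := h.exists_tendsto (by simp)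
    exact hasDensity_of_tendsto_div h.pos (hasDensity_half_of_tendsto hr hcr hθ hlim)

/-- Inequalities of moduli are read off from their squares. The identity for all `n` follows from
the finitely many checked terms by `eq_sum_termSeq`. The first two entries of `allTerms` have the
bases `κ = σ * ρ` and `ρ * ω` and together make up the leading part. -/
theorem IsFormCode.isDominantForm (hm : polyOf m ≠ 0) (hβ : codeVal β m = 0) {I : Code} {P l : ℕ}
    (hP : 0 < P) {z : CxCode} {w : FormCode} (h : IsFormCode I m P l z w) {σ : ℝ}
    (hκ : codeVal β w.1.1.2.2.1 = codeVal β w.1.1.2.1 * σ) :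
    IsDominantForm (fun n => (I.seq (n * P + l) : ℝ)) σ w.1.1.1 (codeVal β w.1.1.2.1)
      (codeVal β w.1.1.2.2.2.1) (cxVal β w.1.2.1) (cxVal β w.1.2.2) (w.2.map (termVal β)) ∧
      codeVal β w.1.1.2.2.2.2 = ‖cxVal β w.1.2.1‖ := by
  obtain ⟨⟨⟨hρ, hω⟩, hr, hrb⟩, hunity, hts, hterms, hz, hcr, -⟩ := h
  obtain ⟨⟨⟨d, ρ, κ, c, r⟩, b, ω⟩, ts⟩ := w
  simp only at *
  have hρ' := hρ.codeVal_pos hβ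
  have hω' := hω.codeVal_eq hβ
  have hr' := hr.codeVal_nonneg hβ
  have hrb' := hrb.codeVal_eq hβ
  rw [codeVal_polyMul, codeVal_cxNormSq, ← pow_two] at hrb'
  have hrnorm : codeVal β r = ‖cxVal β b‖ := (sq_eq_sq₀ hr' (norm_nonneg _)).1 hrb'
  rw [codeVal_cxNormSq, codeVal_polyOne] at hω'
  refine ⟨⟨hρ', ?_, ?_, ?_, ?_, ?_⟩, hrnorm⟩
  · exact (pow_eq_one_iff_of_nonneg (norm_nonneg _) two_ne_zero).1 hω'
  · rcases hcr with h | h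
    · exact Or.inl (h.codeVal_ne_zero hβ)
    · right
      rw [← norm_ne_zero_iff, ← hrnorm]
      exact h.codeVal_ne_zero hβ
  · intro hb n hn
    rcases hunity with h | h
    · exact absurd (h.codeVal_eq hβ) (by rw [hrnorm, codeVal_nil]; exact norm_ne_zero_iff.2 hb)
    · exact h.pow_ne_one hm hβ hn
  · intro t' ht'
    obtain ⟨t, ht, rfl⟩ := List.mem_map.1 ht'
    rcases hts t ht with h | ⟨h1, h2⟩
    · left
      have := h.codeVal_pos hβ
      rw [codeVal_polySub, codeVal_polyMul, codeVal_cxNormSq, ← pow_two, sub_pos] at this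
      exact lt_of_pow_lt_pow_left₀ 2 hρ'.le this
    · right
      have := h1.codeVal_eq hβ
      rw [codeVal_polyMul, codeVal_cxNormSq, ← pow_two] at this
      exact ⟨(sq_eq_sq₀ (norm_nonneg _) hρ'.le).1 this, h2⟩
  · obtain ⟨g, hg, hdeg, -, hann⟩ := I.exists_subsequence_annihilator hP
    have hx : aeval (shift ℂ) g (fun n => ((I.seq (n * P + l) : ℝ) : ℂ)) = 0 := by
      rw [← hann l]
      congr 1
    have heq := eq_sum_termSeq hg hx
      (ts := (allTerms (((d, ρ, κ, c, r), b, ω), ts)).map (termVal β))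
      (fun n hn => by
        rw [hdeg, ← orderBound_eq] at hn
        have := (hterms n hn).codeVal_eq hβ
        rwa [codeVal_singleton, val_seqCode, codeVal_sumCode] at this)
    intro n
    rw [heq n]
    have hκ' : cxVal β (κ, []) = ((codeVal β ρ * σ : ℝ) : ℂ) := by
      apply Complex.ext <;> simp [hκ]
    have hc' : cxVal β (c, []) = ((codeVal β c : ℝ) : ℂ) := by
      apply Complex.ext <;> simp
    simp only [allTerms, List.map_cons, List.sum_cons, termVal, termSeq, hκ', hc', cxVal_cxSmul,
      mul_pow]
    rw [← Complex.ofReal_pow, ← Complex.ofReal_pow, ← Complex.ofReal_mul,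
      Complex.ofReal_re, mul_left_comm (cxVal β b), Complex.re_ofReal_mul]
    ring

/-- A point in the closed upper half of the unit circle is determined by its real part. So it is
enough to match the real part of `z` with the cosine of `π` times the density, in each case of the
certificate. -/
theorem IsDensityCode.exists_hasDensityAngle (hm : polyOf m ≠ 0) (hβ : codeVal β m = 0) {I : Code}
    {P l : ℕ} (hP : 0 < P) {z : CxCode} (h : IsDensityCode I m P l z) :
    ∃ δ, HasDensityAngle (fun n => I.seq (n * P + l)) (cxVal β z) δ := by
  rcases h with ⟨h0, hz⟩ | ⟨w, hw⟩
  · obtain ⟨g, hg, hdeg, -, hann⟩ := I.exists_subsequence_annihilator hP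
    have hzero := eq_zero_of_aeval_shift hg (hann l) fun n hn => by
      rw [hdeg] at hn
      have := (val_eq_zero_iff _).2 (h0 n hn)
      rw [val_seqCode] at this
      simp [castSeq, this]
    refine ⟨0, le_rfl, zero_le_one, ?_, ?_⟩
    · refine hasDensity_zero_of_eventually (Eventually.of_forall fun n => ?_)
      have := congrFun hzero n
      simp only [castSeq, Pi.zero_apply, FaithfulSMul.algebraMap_eq_zero_iff] at this
      simp [this]
    · rw [hz.cxVal_eq hβ]
      simp
  · obtain ⟨-, -, -, -, ⟨hz, hz'⟩, -, hcase⟩ := id hw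
    have hz1 := hz.codeVal_eq hβ
    rw [codeVal_cxNormSq, codeVal_polyOne] at hz1
    have hnorm : ‖cxVal β z‖ = 1 :=
      (pow_eq_one_iff_of_nonneg (norm_nonneg _) two_ne_zero).1 hz1
    have him : 0 ≤ (cxVal β z).im := hz'.codeVal_nonneg hβ
    refine ⟨_, HasDensityAngle.of_arccos hnorm him ?_⟩
    rcases hcase with ⟨hκ, harc⟩ | ⟨hκ, hzi⟩
    · obtain ⟨hform, hr⟩ := hw.isDominantForm hm hβ hP (σ := 1)
        (by rw [hκ.codeVal_eq hβ, mul_one])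
      obtain ⟨d1, d2, d3⟩ := hform.hasDensity.1 rfl
      rw [cxVal_re]
      rcases harc with ⟨hr0, he⟩ | ⟨⟨he, hc⟩, hcr⟩ | ⟨⟨he, hc⟩, hcr⟩
      · have hr0' := hr0.codeVal_ne_zero hβ
        have he' := he.codeVal_eq hβ
        rw [codeVal_polyAdd, codeVal_polyMul, codeVal_nil] at he'
        have hb : cxVal β w.1.2.1 ≠ 0 := by rwa [← norm_ne_zero_iff, ← hr]
        convert d1 hb using 3
        rw [← hr, eq_div_iff hr0']
        linarith
      · have he' := he.codeVal_eq hβ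
        have hcr' := hcr.codeVal_nonneg hβ
        rw [codeVal_polyAdd, codeVal_polyOne, codeVal_nil] at he'
        rw [codeVal_polySub, hr] at hcr'
        rw [show codeVal β z.1 = -1 by linarith, Real.arccos_neg_one, div_self Real.pi_ne_zero]
        exact d2 (by linarith)
      · have he' := he.codeVal_eq hβ
        have hcr' := hcr.codeVal_nonneg hβ
        rw [codeVal_polyOne] at he'
        rw [codeVal_polySub, codeVal_polySub, codeVal_nil, hr] at hcr'
        rw [he', Real.arccos_one, zero_div]
        exact d3 (by linarith)
    · have hκ' := hκ.codeVal_eq hβ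
      rw [codeVal_polyAdd, codeVal_nil] at hκ'
      obtain ⟨hform, hr⟩ := hw.isDominantForm hm hβ hP (σ := -1) (by linarith)
      have := hzi.1.codeVal_eq hβ
      rw [cxVal_re, this, codeVal_nil, Real.arccos_zero]
      convert hform.hasDensity.2 rfl using 1
      field_simp

end Sound

end LRS

namespace LRS

/-! ### Sums of angles -/

/-- The point `exp (i π x)` of the unit circle. -/
noncomputable def halfTurn (x : ℝ) : ℂ := Complex.exp (Real.pi * (x : ℂ) * Complex.I)

theorem halfTurn_re (x : ℝ) : (halfTurn x).re = Real.cos (Real.pi * x) := by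
  rw [halfTurn, ← Complex.ofReal_mul, Complex.exp_ofReal_mul_I_re]

theorem halfTurn_im (x : ℝ) : (halfTurn x).im = Real.sin (Real.pi * x) := by
  rw [halfTurn, ← Complex.ofReal_mul, Complex.exp_ofReal_mul_I_im]

theorem norm_halfTurn (x : ℝ) : ‖halfTurn x‖ = 1 := by
  rw [halfTurn, ← Complex.ofReal_mul, Complex.norm_exp_ofReal_mul_I]

@[simp] theorem halfTurn_zero : halfTurn 0 = 1 := by simp [halfTurn]

theorem halfTurn_add (x y : ℝ) : halfTurn (x + y) = halfTurn x * halfTurn y := by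
  rw [halfTurn, halfTurn, halfTurn, ← Complex.exp_add]
  push_cast
  ring_nf

theorem halfTurn_one : halfTurn 1 = -1 := by simp [halfTurn]

theorem halfTurn_nat_mul (n : ℕ) (x : ℝ) : halfTurn (n * x) = halfTurn x ^ n := by
  rw [halfTurn, halfTurn, ← Complex.exp_nat_mul]
  push_cast
  ring_nf

theorem halfTurn_sub_one (x : ℝ) : halfTurn (x - 1) = -halfTurn x := by
  have h := halfTurn_add (x - 1) 1
  rw [sub_add_cancel, halfTurn_one] at h
  rw [h]
  ring

theorem halfTurn_two_mul_int (k : ℤ) : halfTurn (2 * k) = 1 := by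
  rw [halfTurn, Complex.exp_eq_one_iff]
  exact ⟨k, by push_cast; ring⟩

theorem exists_of_halfTurn_eq_one {t : ℝ} (h : halfTurn t = 1) : ∃ k : ℤ, t = 2 * k := by
  rw [halfTurn, Complex.exp_eq_one_iff] at h
  obtain ⟨k, hk⟩ := h
  refine ⟨k, ?_⟩
  have h1 : (Real.pi : ℂ) * Complex.I ≠ 0 :=
    mul_ne_zero (by exact_mod_cast Real.pi_ne_zero) Complex.I_ne_zero
  have h2 : (t : ℂ) = ((2 * k : ℝ) : ℂ) := by
    apply mul_left_cancel₀ h1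
    push_cast
    linear_combination hk
  exact_mod_cast h2

theorem halfTurn_sum {ι : Type*} (s : Finset ι) (f : ι → ℝ) :
    halfTurn (∑ i ∈ s, f i) = ∏ i ∈ s, halfTurn (f i) := by
  classical
  induction s using Finset.induction_on with
  | empty => simp
  | insert a s ha ih => rw [Finset.sum_insert ha, Finset.prod_insert ha, halfTurn_add, ih]

/-- An angle in `[0, π)` gives a point in the open upper half plane or the point `1`. -/
theorem halfTurn_im_pos_or {t : ℝ} (h0 : 0 ≤ t) (h1 : t < 1) :
    0 < (halfTurn t).im ∨ halfTurn t = 1 := by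
  rcases h0.eq_or_lt with rfl | h0
  · right; simp
  · left
    rw [halfTurn_im]
    exact Real.sin_pos_of_pos_of_lt_pi (by positivity) (by nlinarith [Real.pi_pos])

/-- Among the representatives `s`, `s - 1` of an angle in `[0, 2π)` the condition on the half
plane selects the one in `[0, 1)`. -/
theorem angle_eq_of_im_pos_or {s t : ℝ} (h0 : 0 ≤ s) (h2 : s < 2) (ht : t = s ∨ t = s - 1)
    (h : 0 < (halfTurn t).im ∨ halfTurn t = 1) : 0 ≤ t ∧ t < 1 := by
  have hlt : -1 ≤ t ∧ t < 2 := by rcases ht with rfl | rfl <;> constructor <;> linarith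
  have hπ := Real.pi_pos
  rcases h with h | h
  · rw [halfTurn_im] at h
    constructor
    · by_contra! hneg
      have := Real.sin_nonpos_of_nonpos_of_neg_pi_le (x := Real.pi * t) (by nlinarith)
        (by nlinarith)
      linarith
    · by_contra! hge
      have := Real.sin_nonneg_of_nonneg_of_le_pi (x := Real.pi * t - Real.pi) (by nlinarith)
        (by nlinarith)
      rw [Real.sin_sub_pi] at this
      linarith
  · obtain ⟨k, hk'⟩ := exists_of_halfTurn_eq_one h
    have hk1 : k < 1 := by
      have : (k : ℝ) < 1 := by linarith
      exact_mod_cast this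
    have hk0 : -1 < k := by
      have : (-1 : ℝ) < k := by linarith
      exact_mod_cast this
    have : k = 0 := by omega
    rw [hk', this]
    simp

section Sound

variable {β : ℝ} {m : PolyCode}

/-- The invariant is that the partial sum `S` has integer part `s.2` and fractional part `t`, with
`s.1` coding `halfTurn t`. The new value `t + δ` lies in `[0, 2)`, so at most one half turn is to be
removed; the half plane condition tells whether it was. -/
theorem IsAngleStep.angle (hβ : codeVal β m = 0) {z : CxCode} {s s' : CxCode × ℕ}
    (h : IsAngleStep m z s s') {δ S t : ℝ} (hδ0 : 0 ≤ δ) (hδ1 : δ ≤ 1)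
    (hz : cxVal β z = halfTurn δ) (ht0 : 0 ≤ t) (ht1 : t < 1) (hS : S = s.2 + t)
    (hs : cxVal β s.1 = halfTurn t) :
    ∃ t', 0 ≤ t' ∧ t' < 1 ∧ S + δ = s'.2 + t' ∧ cxVal β s'.1 = halfTurn t' := by
  obtain ⟨hstep, him⟩ := h
  have him' : 0 < (cxVal β s'.1).im ∨ cxVal β s'.1 = 1 := by
    rcases him with h | h
    · exact Or.inl (h.codeVal_pos hβ)
    · exact Or.inr ((h.cxVal_eq hβ).trans (cxVal_one β))
  rcases hstep with ⟨hk, hw⟩ | ⟨hk, hw⟩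
  · have hw' : cxVal β s'.1 = halfTurn (t + δ) := by
      rw [hw.cxVal_eq hβ, cxVal_cxMul, hs, hz, halfTurn_add]
    rw [hw'] at him'
    obtain ⟨h0, h1⟩ := angle_eq_of_im_pos_or (by linarith) (by linarith) (Or.inl rfl) him'
    exact ⟨t + δ, h0, h1, by rw [hk, hS]; ring, hw'⟩
  · have hneg : cxVal β ([(-1, 0)], []) = -1 := by
      apply Complex.ext <;> simp [val_neg_one]
    have hw' : cxVal β s'.1 = halfTurn (t + δ - 1) := by
      rw [hw.cxVal_eq hβ, cxVal_cxMul, cxVal_cxMul, hs, hz, halfTurn_sub_one, halfTurn_add, hneg]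
      ring
    rw [hw'] at him'
    obtain ⟨h0, h1⟩ := angle_eq_of_im_pos_or (by linarith) (by linarith) (Or.inr rfl) him'
    exact ⟨t + δ - 1, h0, h1, by rw [hk, hS]; push_cast; ring, hw'⟩

theorem sum_range_mul_mod (δ : ℕ → ℝ) (N P : ℕ) :
    ∑ j ∈ Finset.range (N * P), δ (j % P) = N * ∑ l ∈ Finset.range P, δ l := by
  induction N with
  | zero => simp
  | succ N ih =>
    rw [Nat.succ_mul, Finset.sum_range_add, ih]
    have : ∑ x ∈ Finset.range P, δ ((N * P + x) % P) = ∑ x ∈ Finset.range P, δ x := by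
      refine Finset.sum_congr rfl fun x hx => ?_
      rw [Nat.mul_comm, Nat.mul_add_mod, Nat.mod_eq_of_lt (Finset.mem_range.1 hx)]
    rw [this]
    push_cast
    ring

/-- The steps run `N` times through the list of angles. They end at fractional part zero with
integer part `k`, so `N` times the sum of the `δ l` is `k`. -/
theorem IsRationalSum.sum_div_eq (hβ : codeVal β m = 0) {zs : List CxCode} {q : RatCode}
    (h : IsRationalSum m zs q) (hzs : 0 < zs.length) {δ : ℕ → ℝ} (hδ0 : ∀ l < zs.length, 0 ≤ δ l)
    (hδ1 : ∀ l < zs.length, δ l ≤ 1)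
    (hz : ∀ l < zs.length, cxVal β (zs.getD l ([], [])) = halfTurn (δ l)) :
    (∑ l ∈ Finset.range zs.length, δ l) / zs.length = (q.val : ℝ) := by
  obtain ⟨⟨⟨N, k⟩, ws⟩, hN, ⟨hstart, hend⟩, rfl, hstep⟩ := h
  simp only at *
  have key : ∀ j ≤ N * zs.length, ∃ t, 0 ≤ t ∧ t < 1 ∧
      ∑ i ∈ Finset.range j, δ (i % zs.length) = (ws.getD j (([], []), 0)).2 + t ∧
      cxVal β (ws.getD j (([], []), 0)).1 = halfTurn t := by
    intro j
    induction j with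
    | zero =>
      intro _
      exact ⟨0, le_rfl, one_pos, by rw [hstart]; simp, by rw [hstart]; simp⟩
    | succ j ih =>
      intro hj
      obtain ⟨t, h0, h1, h2, h3⟩ := ih (by omega)
      have hmod : j % zs.length < zs.length := Nat.mod_lt _ hzs
      rw [Finset.sum_range_succ]
      exact (hstep j (by omega)).angle hβ (hδ0 _ hmod) (hδ1 _ hmod) (hz _ hmod) h0 h1 h2 h3
  obtain ⟨t, h0, h1, h2, h3⟩ := key _ le_rfl
  rw [hend] at h2 h3
  simp only [cxVal_one] at h2 h3
  have ht : t = 0 := by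
    by_contra hne
    have hpos : 0 < t := lt_of_le_of_ne h0 (Ne.symm hne)
    have : 0 < (halfTurn t).im := by
      rw [halfTurn_im]
      exact Real.sin_pos_of_pos_of_lt_pi (by positivity) (by nlinarith [Real.pi_pos])
    rw [← h3] at this
    simp at this
  rw [ht, add_zero, sum_range_mul_mod] at h2
  have hNP : 1 ≤ N * zs.length := Nat.mul_pos hN hzs
  have hN' : (N : ℝ) ≠ 0 := by exact_mod_cast hN.ne'
  have hzs' : (zs.length : ℝ) ≠ 0 := by exact_mod_cast hzs.ne'
  simp only [RatCode.val]
  rw [Nat.cast_sub hNP]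
  push_cast
  rw [← h2]
  field_simp
  ring

theorem prod_map_eq_prod_range {M : Type*} [CommMonoid M] {ι : Type*} (l : List ι) (d : ι)
    (f : ι → M) : (l.map f).prod = ∏ i ∈ Finset.range l.length, f (l.getD i d) := by
  induction l with
  | nil => simp
  | cons a l ih =>
    rw [List.map_cons, List.prod_cons, List.length_cons, Finset.prod_range_succ', ih, mul_comm]
    simp

end Sound

theorem IsOutput.sound {I : Code} {o : Option RatCode} (h : IsOutput I o) :
    ∃ δ : ℝ, HasDensity (positivitySet I.seq) δ ∧
      ((Irrational δ ∧ o = none) ∨ ∃ q : RatCode, o = some q ∧ δ = (q.val : ℝ)) := by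
  obtain ⟨⟨m, zs⟩, ⟨hroot, hlen⟩, hdens, ho⟩ := h
  simp only at *
  obtain ⟨β, hβ, hm⟩ := hroot.exists_root
  have hex : ∀ l : ℕ, ∃ δ : ℝ, l < zs.length →
      HasDensityAngle (fun n => I.seq (n * zs.length + l)) (cxVal β (zs.getD l ([], []))) δ := by
    intro l
    by_cases hl : l < zs.length
    · obtain ⟨δ, hδ⟩ := (hdens l hl).exists_hasDensityAngle hm hβ hlen
      exact ⟨δ, fun _ => hδ⟩
    · exact ⟨0, fun h => absurd h hl⟩
  choose δ hδ using hex
  have hD := HasDensity.of_residues (S := positivitySet I.seq) hlen (δ := δ) fun l hl => by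
    have := (hδ l hl).2.2.1
    rw [positivitySet_eq]
    exact this
  refine ⟨_, hD, ?_⟩
  rcases ho with ⟨ho, hun⟩ | ⟨q, hq, hsum⟩
  · left
    refine ⟨?_, ho⟩
    have hprod : cxVal β (cxProd zs) = halfTurn (∑ l ∈ Finset.range zs.length, δ l) := by
      rw [cxVal_cxProd, prod_map_eq_prod_range zs ([], []), halfTurn_sum]
      exact Finset.prod_congr rfl fun l hl => (hδ l (Finset.mem_range.1 hl)).2.2.2
    -- If the mean is rational, the sum of the angles is a rational multiple of `π`. Twice the
    -- denominator then clears it to a multiple of `2 π`, and the product would be a root of unity.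
    rintro ⟨a, ha⟩
    have hlen' : (zs.length : ℝ) ≠ 0 := by exact_mod_cast hlen.ne'
    have hS : ∑ l ∈ Finset.range zs.length, δ l = a * zs.length := by
      rw [ha, div_mul_cancel₀ _ hlen']
    refine hun.pow_ne_one hm hβ (n := 2 * a.den) (Nat.mul_pos two_pos a.den_pos) ?_
    rw [hprod, ← halfTurn_nat_mul, hS]
    have : ((2 * a.den : ℕ) : ℝ) * (a * zs.length) = 2 * ((a.num * zs.length : ℤ) : ℝ) := by
      have h1 : (a : ℝ) * a.den = a.num := by exact_mod_cast Rat.mul_den_eq_num a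
      push_cast
      linear_combination 2 * (zs.length : ℝ) * h1
    rw [this, halfTurn_two_mul_int]
  · right
    exact ⟨q, hq, hsum.sum_div_eq hβ hlen (fun l hl => (hδ l hl).1) (fun l hl => (hδ l hl).2.1)
      fun l hl => (hδ l hl).2.2.2⟩

end LRS

namespace LRS

open Polynomial

/-! ### Completeness of the relations between codes -/

/-- The real number `x` is a polynomial in `β`. -/
def HasCode (β x : ℝ) : Prop := ∃ p : PolyCode, codeVal β p = x

theorem hasCode_iff_aeval {β x : ℝ} : HasCode β x ↔ ∃ f : ℚ[X], aeval β f = x := by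
  constructor
  · rintro ⟨p, hp⟩
    exact ⟨polyOf p, hp⟩
  · rintro ⟨f, hf⟩
    obtain ⟨p, rfl⟩ := exists_polyOf_eq f
    exact ⟨p, hf⟩

/-- Finitely many real algebraic numbers lie in a field generated by one real number. -/
theorem exists_hasCode {S : Set ℝ} (hfin : S.Finite) (hS : ∀ x ∈ S, IsAlgebraic ℚ x) :
    ∃ (β : ℝ) (m : PolyCode), IsIntegral ℚ β ∧ polyOf m = minpoly ℚ β ∧ ∀ x ∈ S, HasCode β x := by
  have : Finite S := hfin
  have hfd : FiniteDimensional ℚ (IntermediateField.adjoin ℚ S) :=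
    IntermediateField.finiteDimensional_adjoin fun x hx => (hS x hx).isIntegral
  obtain ⟨α, hα⟩ := Field.exists_primitive_element ℚ (IntermediateField.adjoin ℚ S)
  have hintegral : IsIntegral ℚ α := IsIntegral.of_finite ℚ α
  obtain ⟨m, hm⟩ := exists_polyOf_eq (minpoly ℚ (α : ℝ))
  refine ⟨α, m, ?_, hm, fun x hx => ?_⟩
  · exact (isIntegral_algebraMap_iff (algebraMap (IntermediateField.adjoin ℚ S) ℝ).injective).2 hintegral
  · have hmem : (⟨x, IntermediateField.subset_adjoin ℚ S hx⟩ : IntermediateField.adjoin ℚ S) ∈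
        (IntermediateField.adjoin ℚ {α}).toSubalgebra := by
      rw [hα]
      trivial
    rw [IntermediateField.adjoin_simple_toSubalgebra_of_isAlgebraic hintegral.isAlgebraic,
      Algebra.adjoin_singleton_eq_range_aeval] at hmem
    obtain ⟨f, hf⟩ := hmem
    rw [hasCode_iff_aeval]
    refine ⟨f, ?_⟩
    have h1 := aeval_algebraMap_apply ℝ α f
    change aeval α f = _ at hf
    rw [hf] at h1
    exact h1

section Complete

variable {β : ℝ} {m : PolyCode}

/-- Since `β` is algebraic, the polynomials in `β` already form a field. -/
theorem HasCode.inv (hβ : IsIntegral ℚ β) {x : ℝ} (hx : HasCode β x) : HasCode β x⁻¹ := by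
  rw [hasCode_iff_aeval] at hx ⊢
  obtain ⟨f, rfl⟩ := hx
  have hadj := IntermediateField.adjoin_simple_toSubalgebra_of_isAlgebraic hβ.isAlgebraic
  rw [Algebra.adjoin_singleton_eq_range_aeval] at hadj
  have h1 : aeval β f ∈ IntermediateField.adjoin ℚ {β} := by
    rw [← IntermediateField.mem_toSubalgebra, hadj]
    exact ⟨f, rfl⟩
  have h2 := inv_mem h1
  rw [← IntermediateField.mem_toSubalgebra, hadj] at h2
  exact h2

theorem codeVal_eq_zero_of_minpoly (hm : polyOf m = minpoly ℚ β) : codeVal β m = 0 := by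
  rw [codeVal, hm, minpoly.aeval]

/-- Here `m` must be the minimal polynomial: only then does equality of values at `β` imply
congruence modulo `m`. -/
theorem CodeEq.of_codeVal (hm : polyOf m = minpoly ℚ β) {X Y : PolyCode}
    (h : codeVal β X = codeVal β Y) : CodeEq m X Y := by
  have h1 : minpoly ℚ β ∣ polyOf X - polyOf Y := by
    refine minpoly.dvd ℚ β ?_
    rw [map_sub]
    exact sub_eq_zero.2 h
  obtain ⟨g, hg⟩ := h1
  obtain ⟨q, rfl⟩ := exists_polyOf_eq g
  refine ⟨q, (polyOf_eq_zero_iff _).1 ?_⟩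
  rw [polyOf_polySub, polyOf_polySub, polyOf_polyMul, hg, hm]
  ring

/-- The field of `β` need not contain square roots of its non-negative elements. They are put into
the field in advance, as the lists `formNumbers` and `sumNumbers` do. -/
theorem CodeNonneg.of_codeVal (hm : polyOf m = minpoly ℚ β) {X : PolyCode}
    (h : 0 ≤ codeVal β X) (hs : HasCode β √(codeVal β X)) : CodeNonneg m X := by
  obtain ⟨y, hy⟩ := hs
  refine ⟨y, CodeEq.of_codeVal hm ?_⟩
  rw [codeVal_polyMul, hy, Real.mul_self_sqrt h]

theorem CodeNeZero.of_codeVal (hβ : IsIntegral ℚ β) (hm : polyOf m = minpoly ℚ β) {X : PolyCode}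
    (h : codeVal β X ≠ 0) : CodeNeZero m X := by
  obtain ⟨y, hy⟩ := HasCode.inv hβ ⟨X, rfl⟩
  refine ⟨y, CodeEq.of_codeVal hm ?_⟩
  rw [codeVal_polyMul, hy, mul_inv_cancel₀ h, codeVal_polyOne]

theorem CodePos.of_codeVal (hβ : IsIntegral ℚ β) (hm : polyOf m = minpoly ℚ β) {X : PolyCode}
    (h : 0 < codeVal β X) (hs : HasCode β √(codeVal β X)) : CodePos m X :=
  ⟨CodeNonneg.of_codeVal hm h.le hs, CodeNeZero.of_codeVal hβ hm h.ne'⟩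

theorem CxEq.of_cxVal (hm : polyOf m = minpoly ℚ β) {z w : CxCode} (h : cxVal β z = cxVal β w) :
    CxEq m z w :=
  ⟨CodeEq.of_codeVal hm (congrArg Complex.re h), CodeEq.of_codeVal hm (congrArg Complex.im h)⟩

theorem unityExponent_pos (m : PolyCode) : 0 < unityExponent m := Nat.factorial_pos _

theorem CxNotUnity.of_pow_ne_one (hβ : IsIntegral ℚ β) (hm : polyOf m = minpoly ℚ β) {z : CxCode}
    (h : ∀ n : ℕ, 0 < n → cxVal β z ^ n ≠ 1) : CxNotUnity m z := by
  refine CodeNeZero.of_codeVal hβ hm ?_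
  rw [codeVal_cxNormSq_sub_one, cxVal_cxPow]
  exact pow_ne_zero 2 (norm_ne_zero_iff.2 (sub_ne_zero.2 (h _ (unityExponent_pos m))))

/-- Minimal polynomials over `ℚ` are separable, so `β` is a simple root. If the polynomial had only
one weak sign on `ℚ`, it would have it on `ℝ` by density. Then `β` would be an extremum and the
derivative would vanish there. -/
theorem CodeHasRoot.of_minpoly (hβ : IsIntegral ℚ β) (hm : polyOf m = minpoly ℚ β) :
    CodeHasRoot m := by
  have hcont : Continuous fun x => codeVal x m := (polyOf m).continuous_aeval
  have hval : ∀ q : ℚ, codeVal (q : ℝ) m = (((polyOf m).eval q : ℚ) : ℝ) := fun q => by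
    simpa [codeVal] using aeval_algebraMap_apply_eq_algebraMap_eval (A := ℝ) q (polyOf m)
  have hder : HasDerivAt (fun x => codeVal x m) (aeval β (derivative (polyOf m))) β :=
    (polyOf m).hasDerivAt_aeval β
  have hne : aeval β (derivative (polyOf m)) ≠ 0 := by
    rw [hm]
    exact (minpoly.irreducible hβ).separable.aeval_derivative_ne_zero (minpoly.aeval ℚ β)
  have hzero : codeVal β m = 0 := codeVal_eq_zero_of_minpoly hm
  have hdense : DenseRange ((↑) : ℚ → ℝ) := Rat.denseRange_cast
  have hneg : ∃ q : ℚ, (polyOf m).eval q < 0 := by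
    by_contra! hall
    have hge : ∀ x : ℝ, 0 ≤ codeVal x m :=
      fun x => hdense.induction_on x (isClosed_le continuous_const hcont) fun q => by
        rw [hval]
        exact_mod_cast hall q
    have hmin : IsLocalMin (fun x => codeVal x m) β :=
      Eventually.of_forall fun x => by simpa [hzero] using hge x
    exact hne (hmin.hasDerivAt_eq_zero hder)
  have hpos : ∃ q : ℚ, 0 < (polyOf m).eval q := by
    by_contra! hall
    have hle : ∀ x : ℝ, codeVal x m ≤ 0 :=
      fun x => hdense.induction_on x (isClosed_le hcont continuous_const) fun q => by
        rw [hval]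
        exact_mod_cast hall q
    have hmax : IsLocalMax (fun x => codeVal x m) β :=
      Eventually.of_forall fun x => by simpa [hzero] using hle x
    exact hne (hmax.hasDerivAt_eq_zero hder)
  obtain ⟨qa, ha⟩ := hneg
  obtain ⟨qb, hb⟩ := hpos
  obtain ⟨a, rfl⟩ := exists_val_eq qa
  obtain ⟨b, rfl⟩ := exists_val_eq qb
  refine ⟨(a, b), ?_, ?_⟩
  · rw [← val_polyEval, RatCode.val, div_neg_iff] at ha
    have h1 : (0 : ℚ) < (polyEval m a).2 + 1 := by positivity
    have h2 : ((polyEval m a).1 : ℚ) < 0 := by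
      rcases ha with h | h
      · linarith [h.2]
      · exact h.1
    have h3 : (polyEval m a).1 < 0 := by exact_mod_cast h2
    simp only
    omega
  · rw [← val_polyEval, val_pos_iff] at hb
    simp only
    omega

end Complete

end LRS

namespace LRS

/-! ### Completeness of certificates -/

theorem isAlgebraic_sqrt {x : ℝ} (hx : IsAlgebraic ℚ x) : IsAlgebraic ℚ √x := by
  rcases le_total 0 x with h | h
  · refine IsAlgebraic.of_pow two_pos ?_
    rwa [Real.sq_sqrt h]
  · rw [Real.sqrt_eq_zero_of_nonpos h]
    exact isAlgebraic_zero

theorem exists_code_function (β : ℝ) :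
    ∃ e : ℝ → PolyCode, ∀ x, HasCode β x → codeVal β (e x) = x := by
  have h : ∀ x, ∃ p, HasCode β x → codeVal β p = x := fun x => by
    by_cases hx : HasCode β x
    · obtain ⟨p, hp⟩ := hx
      exact ⟨p, fun _ => hp⟩
    · exact ⟨[], fun h => absurd h hx⟩
  choose e he using h
  exact ⟨e, he⟩

/-- The angle `π δ` is the one that a dominant form with the constants `σ`, `c` and `r`
prescribes. -/
def IsFormAngle (σ c r δ : ℝ) : Prop :=
  (σ = 1 ∧ ((r ≠ 0 ∧ r * (halfTurn δ).re + c = 0) ∨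
    (((halfTurn δ).re + 1 = 0 ∧ 0 < c) ∧ 0 ≤ c - r) ∨
    (((halfTurn δ).re = 1 ∧ 0 < -c) ∧ 0 ≤ -c - r))) ∨
  (σ = -1 ∧ halfTurn δ = Complex.I)

/-- The alternatives of a certificate overlap when `|c| = r`. Here the arc cosine is used up to and
including equality, and the constant densities are used only for `|c| > r`. -/
theorem exists_isFormAngle {σ c r : ℝ} (hσ : σ = 1 ∨ σ = -1) (hr : 0 ≤ r) (hcr : c ≠ 0 ∨ r ≠ 0) :
    ∃ δ, 0 ≤ δ ∧ δ ≤ 1 ∧ IsFormAngle σ c r δ := by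
  have hπ := Real.pi_pos
  rcases hσ with rfl | rfl
  · by_cases h : r ≠ 0 ∧ |c| ≤ r
    · have hr' : 0 < r := lt_of_le_of_ne hr h.1.symm
      obtain ⟨h1, h2⟩ := abs_le.1 h.2
      refine ⟨Real.arccos (-c / r) / Real.pi, div_nonneg (Real.arccos_nonneg _) hπ.le,
        div_le_one_of_le₀ (Real.arccos_le_pi _) hπ.le, Or.inl ⟨rfl, Or.inl ⟨h.1, ?_⟩⟩⟩
      rw [halfTurn_re, mul_div_cancel₀ _ Real.pi_ne_zero, Real.cos_arccos,
        mul_div_cancel₀ _ h.1]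
      · ring
      · rw [le_div_iff₀ hr']; linarith
      · rw [div_le_iff₀ hr']; linarith
    · have hlt : r < |c| := by
        by_contra! hle
        refine h ⟨fun h0 => ?_, hle⟩
        rw [h0] at hle
        exact hcr.elim (fun hc => hc (abs_nonpos_iff.1 hle)) fun hr => hr h0
      rcases lt_abs.1 hlt with hc | hc
      · refine ⟨1, zero_le_one, le_rfl, Or.inl ⟨rfl, Or.inr (Or.inl ⟨⟨?_, ?_⟩, ?_⟩)⟩⟩
        · rw [halfTurn_one]; simp
        · linarith
        · linarith
      · refine ⟨0, le_rfl, zero_le_one, Or.inl ⟨rfl, Or.inr (Or.inr ⟨⟨?_, ?_⟩, ?_⟩)⟩⟩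
        · simp
        · linarith
        · linarith
  · refine ⟨1 / 2, by norm_num, by norm_num, Or.inr ⟨rfl, ?_⟩⟩
    apply Complex.ext
    · rw [halfTurn_re, mul_one_div, Real.cos_pi_div_two, Complex.I_re]
    · rw [halfTurn_im, mul_one_div, Real.sin_pi_div_two, Complex.I_im]

theorem halfTurn_im_nonneg {δ : ℝ} (h0 : 0 ≤ δ) (h1 : δ ≤ 1) : 0 ≤ (halfTurn δ).im := by
  rw [halfTurn_im]
  have hπ := Real.pi_pos
  exact Real.sin_nonneg_of_nonneg_of_le_pi (by positivity) (by nlinarith)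

/-- The square of the sine is `1` minus the square of the cosine. -/
theorem isAlgebraic_halfTurn {δ : ℝ} (h : IsAlgebraic ℚ (halfTurn δ).re) :
    IsAlgebraic ℚ (halfTurn δ) := by
  have him : IsAlgebraic ℚ (halfTurn δ).im := by
    refine IsAlgebraic.of_pow two_pos ?_
    have : (halfTurn δ).im ^ 2 = 1 - (halfTurn δ).re ^ 2 := by
      rw [halfTurn_re, halfTurn_im]
      exact Real.sin_sq _
    rw [this]
    exact isAlgebraic_one.sub (h.pow 2)
  rw [← Complex.re_add_im (halfTurn δ)]
  exact (isAlgebraic_ofReal.2 h).add ((isAlgebraic_ofReal.2 him).mul isAlgebraic_I)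

theorem IsFormAngle.isAlgebraic {σ c r δ : ℝ} (h : IsFormAngle σ c r δ) (hc : IsAlgebraic ℚ c)
    (hr : IsAlgebraic ℚ r) : IsAlgebraic ℚ (halfTurn δ).re := by
  rcases h with ⟨-, ⟨h1, h2⟩ | ⟨⟨h, -⟩, -⟩ | ⟨⟨h, -⟩, -⟩⟩ | ⟨-, h⟩
  · have : (halfTurn δ).re = -c * r⁻¹ := by
      rw [← div_eq_mul_inv, eq_div_iff h1]
      linarith
    rw [this]
    exact hc.neg.mul hr.inv
  · rw [show (halfTurn δ).re = -1 by linarith]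
    exact isAlgebraic_one.neg
  · rw [h]
    exact isAlgebraic_one
  · rw [h, Complex.I_re]
    exact isAlgebraic_zero

/-- The numbers that a certificate for a dominant form needs. -/
noncomputable def formNumbers (ρ c : ℝ) (b ω : ℂ) (ts : List (ℕ × ℂ × ℂ)) (δ : ℝ) : List ℝ :=
  [ρ, √ρ, c, ‖b‖, √‖b‖, b.re, b.im, ω.re, ω.im, √(halfTurn δ).im, √c, √(-c), √(c - ‖b‖),
    √(-c - ‖b‖)] ++
  ts.flatMap fun t => [t.2.1.re, t.2.1.im, t.2.2.re, t.2.2.im, √(ρ ^ 2 - ‖t.2.2‖ ^ 2)]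

theorem isAlgebraic_of_mem_formNumbers {ρ c : ℝ} {b ω : ℂ} {ts : List (ℕ × ℂ × ℂ)} {δ : ℝ}
    (hρ : IsAlgebraic ℚ ρ) (hc : IsAlgebraic ℚ c) (hb : IsAlgebraic ℚ b) (hω : IsAlgebraic ℚ ω)
    (hts : ∀ t ∈ ts, IsAlgebraic ℚ t.2.1 ∧ IsAlgebraic ℚ t.2.2)
    (hδ : IsAlgebraic ℚ (halfTurn δ)) : ∀ x ∈ formNumbers ρ c b ω ts δ, IsAlgebraic ℚ x := by
  have hr := IsAlgebraic.norm hb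
  intro x hx
  rw [formNumbers, List.mem_append, List.mem_flatMap] at hx
  rcases hx with hx | ⟨t, ht, hx⟩
  · simp only [List.mem_cons, List.not_mem_nil, or_false] at hx
    rcases hx with rfl | rfl | rfl | rfl | rfl | rfl | rfl | rfl | rfl | rfl | rfl | rfl | rfl |
      rfl
    · exact hρ
    · exact isAlgebraic_sqrt hρ
    · exact hc
    · exact hr
    · exact isAlgebraic_sqrt hr
    · exact IsAlgebraic.re hb
    · exact IsAlgebraic.im hb
    · exact IsAlgebraic.re hω
    · exact IsAlgebraic.im hω
    · exact isAlgebraic_sqrt (IsAlgebraic.im hδ)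
    · exact isAlgebraic_sqrt hc
    · exact isAlgebraic_sqrt hc.neg
    · exact isAlgebraic_sqrt (hc.sub hr)
    · exact isAlgebraic_sqrt (hc.neg.sub hr)
  · obtain ⟨h1, h2⟩ := hts t ht
    simp only [List.mem_cons, List.not_mem_nil, or_false] at hx
    rcases hx with rfl | rfl | rfl | rfl | rfl
    · exact IsAlgebraic.re h1
    · exact IsAlgebraic.im h1
    · exact IsAlgebraic.re h2
    · exact IsAlgebraic.im h2
    · exact isAlgebraic_sqrt ((hρ.pow 2).sub ((IsAlgebraic.norm h2).pow 2))

section Complete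

variable {β : ℝ} {m : PolyCode}

theorem IsArcCode.of_isFormAngle (hβ : IsIntegral ℚ β) (hm : polyOf m = minpoly ℚ β)
    {c r : PolyCode} {z : CxCode} {δ : ℝ} (hz : cxVal β z = halfTurn δ)
    (h : IsFormAngle 1 (codeVal β c) (codeVal β r) δ)
    (h1 : HasCode β √(codeVal β c)) (h2 : HasCode β √(-codeVal β c))
    (h3 : HasCode β √(codeVal β c - codeVal β r))
    (h4 : HasCode β √(-codeVal β c - codeVal β r)) : IsArcCode m c r z := by
  have hre : codeVal β z.1 = (halfTurn δ).re := by rw [← hz, cxVal_re]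
  rcases h with ⟨-, ⟨ha, hb⟩ | ⟨⟨ha, hb⟩, hc⟩ | ⟨⟨ha, hb⟩, hc⟩⟩ | ⟨h, -⟩
  · exact Or.inl ⟨CodeNeZero.of_codeVal hβ hm ha, CodeEq.of_codeVal hm (by simp [hre, hb])⟩
  · exact Or.inr (Or.inl ⟨⟨CodeEq.of_codeVal hm (by simp [hre, ha]),
      CodePos.of_codeVal hβ hm hb h1⟩, CodeNonneg.of_codeVal hm (by simpa using hc)
        (by simpa using h3)⟩)
  · exact Or.inr (Or.inr ⟨⟨CodeEq.of_codeVal hm (by simp [hre, ha]),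
      CodePos.of_codeVal hβ hm (by simpa using hb) (by simpa using h2)⟩,
      CodeNonneg.of_codeVal hm (by simpa using hc) (by simpa using h4)⟩)
  · norm_num at h

/-- The list `formNumbers` holds the data of the form and the square roots that its inequalities ask
for. Equalities and inverses need nothing beyond the field itself. The real numbers are coded
through one chosen function `e`, so that evaluating the codes returns the given form. -/
theorem IsDominantForm.isDensityCode (hβ : IsIntegral ℚ β) (hm : polyOf m = minpoly ℚ β)
    {I : Code} {P l : ℕ} {σ : ℝ} {d : ℕ} {ρ c : ℝ} {b ω : ℂ} {ts : List (ℕ × ℂ × ℂ)}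
    (h : IsDominantForm (fun n => (I.seq (n * P + l) : ℝ)) σ d ρ c b ω ts) {δ : ℝ} (h0 : 0 ≤ δ)
    (h1 : δ ≤ 1) (hδ : IsFormAngle σ c ‖b‖ δ)
    (hS : ∀ x ∈ formNumbers ρ c b ω ts δ, HasCode β x) {z : CxCode}
    (hz : cxVal β z = halfTurn δ) : IsDensityCode I m P l z := by
  obtain ⟨e, he⟩ := exists_code_function β
  have heS : ∀ x ∈ formNumbers ρ c b ω ts δ, codeVal β (e x) = x := fun x hx => he x (hS x hx)
  have hmem : ∀ x ∈ [ρ, √ρ, c, ‖b‖, √‖b‖, b.re, b.im, ω.re, ω.im, √(halfTurn δ).im, √c, √(-c),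
      √(c - ‖b‖), √(-c - ‖b‖)], x ∈ formNumbers ρ c b ω ts δ := fun x hx =>
    List.mem_append_left _ hx
  have hmemt : ∀ t ∈ ts, ∀ x ∈ [t.2.1.re, t.2.1.im, t.2.2.re, t.2.2.im,
      √(ρ ^ 2 - ‖t.2.2‖ ^ 2)], x ∈ formNumbers ρ c b ω ts δ := fun t ht x hx =>
    List.mem_append_right _ (List.mem_flatMap.2 ⟨t, ht, hx⟩)
  have eρ := heS ρ (hmem _ (by simp))
  have ec := heS c (hmem _ (by simp))
  have er := heS ‖b‖ (hmem _ (by simp))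
  have eb : cxVal β (e b.re, e b.im) = b :=
    Complex.ext (heS _ (hmem _ (by simp))) (heS _ (hmem _ (by simp)))
  have eω : cxVal β (e ω.re, e ω.im) = ω :=
    Complex.ext (heS _ (hmem _ (by simp))) (heS _ (hmem _ (by simp)))
  set E : ℕ × ℂ × ℂ → TermCode :=
    fun t => (t.1, (e t.2.1.re, e t.2.1.im), (e t.2.2.re, e t.2.2.im)) with hE
  have et : ∀ t ∈ ts, termVal β (E t) = t := fun t ht =>
    Prod.ext rfl (Prod.ext
      (Complex.ext (heS _ (hmemt t ht _ (by simp))) (heS _ (hmemt t ht _ (by simp))))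
      (Complex.ext (heS _ (hmemt t ht _ (by simp))) (heS _ (hmemt t ht _ (by simp)))))
  have ets : (ts.map E).map (termVal β) = ts := by
    rw [List.map_map]
    exact (List.map_congr_left et).trans (List.map_id ts)
  obtain ⟨κ, hκ⟩ : ∃ κ : PolyCode, codeVal β κ = ρ * σ ∧
      (σ = 1 → CodeEq m κ (e ρ)) ∧ (σ = -1 → CodeEq m (polyAdd κ (e ρ)) []) := by
    rcases hδ with ⟨rfl, -⟩ | ⟨rfl, -⟩
    · exact ⟨e ρ, by rw [eρ, mul_one], fun _ => CodeEq.of_codeVal hm rfl, fun h => by norm_num at h⟩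
    · exact ⟨polySub [] (e ρ), by simp [eρ], fun h => by norm_num at h,
        fun _ => CodeEq.of_codeVal hm (by simp)⟩
  have hnz : ‖cxVal β z‖ = 1 := by rw [hz, norm_halfTurn]
  have hzim : codeVal β z.2 = (halfTurn δ).im := by rw [← hz, cxVal_im]
  refine Or.inr ⟨(((d, e ρ, κ, e c, e ‖b‖), (e b.re, e b.im), (e ω.re, e ω.im)), ts.map E),
    ⟨⟨?_, ?_⟩, ?_, ?_⟩, ?_, ?_, ?_, ⟨?_, ?_⟩, ?_, ?_⟩
  · exact CodePos.of_codeVal hβ hm (by rw [eρ]; exact h.pos)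
      (by rw [eρ]; exact hS _ (hmem _ (by simp)))
  · exact CodeEq.of_codeVal hm (by simp [eω, h.norm_eq_one])
  · exact CodeNonneg.of_codeVal hm (by rw [er]; exact norm_nonneg _)
      (by rw [er]; exact hS _ (hmem _ (by simp)))
  · exact CodeEq.of_codeVal hm (by simp [er, eb, pow_two])
  · by_cases hb : b = 0
    · exact Or.inl (CodeEq.of_codeVal hm (by rw [er, hb]; simp))
    · exact Or.inr (CxNotUnity.of_pow_ne_one hβ hm (by rw [eω]; exact h.pow_ne_one hb))
  · intro t' ht'
    obtain ⟨t, ht, rfl⟩ := List.mem_map.1 ht'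
    have hμ : cxVal β (E t).2.2 = t.2.2 := congrArg (fun x => x.2.2) (et t ht)
    rcases h.negligible t ht with hlt | ⟨heq, hlt⟩
    · left
      have hval : codeVal β (polySub (polyMul (e ρ) (e ρ)) (cxNormSq (E t).2.2)) =
          ρ ^ 2 - ‖t.2.2‖ ^ 2 := by
        rw [codeVal_polySub, codeVal_polyMul, codeVal_cxNormSq, hμ, eρ, pow_two ρ]
      refine CodePos.of_codeVal hβ hm ?_ ?_
      · rw [hval, sub_pos]
        exact pow_lt_pow_left₀ hlt (norm_nonneg _) two_ne_zero
      · rw [hval]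
        exact hS _ (hmemt t ht _ (by simp))
    · right
      refine ⟨CodeEq.of_codeVal hm ?_, hlt⟩
      rw [codeVal_polyMul, codeVal_cxNormSq, hμ, eρ, heq, pow_two]
  · intro n _
    refine CodeEq.of_codeVal hm ?_
    have hκ' : cxVal β (κ, []) = ((ρ * σ : ℝ) : ℂ) := by
      apply Complex.ext <;> simp [hκ.1]
    have hc' : cxVal β (e c, []) = ((c : ℝ) : ℂ) := by
      apply Complex.ext <;> simp [ec]
    rw [codeVal_singleton, val_seqCode, h.eq n, codeVal_sumCode]
    simp only [allTerms, List.map_cons, List.sum_cons, ets]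
    simp only [termVal, termSeq, hκ', hc', cxVal_cxSmul, eb, eω, eρ, mul_pow]
    rw [← Complex.ofReal_pow, ← Complex.ofReal_pow, ← Complex.ofReal_mul,
      Complex.ofReal_re, mul_left_comm b, Complex.re_ofReal_mul]
    ring
  · exact CodeEq.of_codeVal hm (by simp [hnz])
  · exact CodeNonneg.of_codeVal hm (by rw [hzim]; exact halfTurn_im_nonneg h0 h1)
      (by rw [hzim]; exact hS _ (hmem _ (by simp)))
  · rcases h.ne_zero with hc | hb
    · exact Or.inl (CodeNeZero.of_codeVal hβ hm (by rwa [ec]))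
    · exact Or.inr (CodeNeZero.of_codeVal hβ hm (by rw [er]; exact norm_ne_zero_iff.2 hb))
  · rcases id hδ with ⟨rfl, -⟩ | ⟨hσ, hI⟩
    · refine Or.inl ⟨hκ.2.1 rfl, IsArcCode.of_isFormAngle hβ hm hz ?_ ?_ ?_ ?_ ?_⟩ <;>
        simp only [ec, er]
      · exact hδ
      all_goals exact hS _ (hmem _ (by simp))
    · refine Or.inr ⟨hκ.2.2 hσ, CxEq.of_cxVal hm ?_⟩
      rw [hz, hI]
      apply Complex.ext <;> simp

end Complete

/-- Every subsequence in a splitting has a certificate of its density, once the field is large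
enough. -/
theorem exists_isDensityCode {I : Code} (hI : I.Valid) {P l : ℕ} (hP : 0 < P)
    (hnd : NonDegenerate fun n => I.seq (n * P + l))
    (hone : AtMostOneDominantPair fun n => I.seq (n * P + l)) :
    ∃ (δ : ℝ) (S : List ℝ), 0 ≤ δ ∧ δ ≤ 1 ∧ IsAlgebraic ℚ (halfTurn δ) ∧
      (∀ x ∈ S, IsAlgebraic ℚ x) ∧
      ∀ (β : ℝ) (m : PolyCode), IsIntegral ℚ β → polyOf m = minpoly ℚ β →
        (∀ x ∈ S, HasCode β x) → ∀ z : CxCode, cxVal β z = halfTurn δ →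
          IsDensityCode I m P l z := by
  by_cases hne : ∃ n, I.seq (n * P + l) ≠ 0
  · obtain ⟨g, hg, -, hg0, hann⟩ := I.exists_subsequence_annihilator hP
    obtain ⟨σ, d, ρ, c, b, ω, ts, hσ, hform, hρ, hc, hb, hω, hts⟩ :=
      exists_isDominantForm hg (hg0 hI) (hann l) hnd hone hne
    obtain ⟨δ, h0, h1, hδ⟩ := exists_isFormAngle hσ (norm_nonneg b)
      (hform.ne_zero.imp_right norm_ne_zero_iff.2)
    have hδalg := isAlgebraic_halfTurn (hδ.isAlgebraic hc (IsAlgebraic.norm hb))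
    exact ⟨δ, formNumbers ρ c b ω ts δ, h0, h1, hδalg,
      isAlgebraic_of_mem_formNumbers hρ hc hb hω hts hδalg,
      fun β m hβ hm hS z hz => hform.isDensityCode hβ hm h0 h1 hδ hS hz⟩
  · push Not at hne
    refine ⟨0, [], le_rfl, zero_le_one, by rw [halfTurn_zero]; exact isAlgebraic_one, by simp,
      fun β m hβ hm _ z hz => Or.inl ⟨fun n _ => ?_, CxEq.of_cxVal hm ?_⟩⟩
    · rw [← val_eq_zero_iff, val_seqCode, hne]
    · rw [hz, halfTurn_zero, cxVal_one]

end LRS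

/-! ### Completeness for sums of angles and for the output -/

namespace LRS

/-- Removing an integer from the angle changes the point by a sign at most, and squaring removes the
sign. -/
theorem isAlgebraic_halfTurn_fract {x : ℝ} (h : IsAlgebraic ℚ (halfTurn x)) :
    IsAlgebraic ℚ (halfTurn (Int.fract x)) := by
  refine IsAlgebraic.of_pow two_pos ?_
  have h1 : halfTurn (Int.fract x) ^ 2 = halfTurn x ^ 2 := by
    rw [← halfTurn_nat_mul, ← halfTurn_nat_mul,
      show ((2 : ℕ) : ℝ) * x = (2 : ℕ) * Int.fract x + 2 * (⌊x⌋ : ℤ) by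
        have := Int.floor_add_fract x
        push_cast
        linear_combination (-2) * this,
      halfTurn_add, halfTurn_two_mul_int, mul_one]
  rw [h1]
  exact h.pow 2

theorem isAlgebraic_halfTurn_sum {ι : Type*} (s : Finset ι) {f : ι → ℝ}
    (h : ∀ i ∈ s, IsAlgebraic ℚ (halfTurn (f i))) : IsAlgebraic ℚ (halfTurn (∑ i ∈ s, f i)) := by
  classical
  induction s using Finset.induction_on with
  | empty => simpa using isAlgebraic_one
  | insert a s ha ih =>
    rw [Finset.sum_insert ha, halfTurn_add]
    exact (h a (Finset.mem_insert_self a s)).mul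
      (ih fun i hi => h i (Finset.mem_insert_of_mem hi))

section Complete

variable {β : ℝ} {m : PolyCode}

/-- Codes of complex numbers, with a prescribed code of the number `1`. -/
theorem exists_cxCode_function (β : ℝ) : ∃ e : ℂ → CxCode, e 1 = (polyOne, []) ∧
    ∀ z, HasCode β z.re → HasCode β z.im → cxVal β (e z) = z := by
  classical
  obtain ⟨e, he⟩ := exists_code_function β
  -- `IsRationalSum` compares its first and last entries with `(polyOne, [])` as codes and not as
  -- numbers, so the number `1` must receive this very code.
  refine ⟨fun z => if z = 1 then (polyOne, []) else (e z.re, e z.im), by simp, fun z h1 h2 => ?_⟩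
  by_cases hz : z = 1
  · simp [hz]
  · simp only [hz, if_false]
    exact Complex.ext (he _ h1) (he _ h2)

/-- The floor grows by one exactly if the fractional part plus `δ` reaches `1`; this decides between
the two kinds of step. The new fractional part lies in `[0, 1)`, which gives the half plane
condition. -/
theorem IsAngleStep.of_halfTurn (hβ : IsIntegral ℚ β) (hm : polyOf m = minpoly ℚ β) {z : CxCode}
    {s s' : CxCode × ℕ} {S δ : ℝ} (hS : 0 ≤ S) (hδ0 : 0 ≤ δ) (hδ1 : δ ≤ 1)
    (hz : cxVal β z = halfTurn δ) (hs : cxVal β s.1 = halfTurn (Int.fract S)) (hs2 : s.2 = ⌊S⌋₊)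
    (hs' : cxVal β s'.1 = halfTurn (Int.fract (S + δ))) (hs2' : s'.2 = ⌊S + δ⌋₊)
    (him : HasCode β √(halfTurn (Int.fract (S + δ))).im) : IsAngleStep m z s s' := by
  have hfl : ((⌊S⌋₊ : ℕ) : ℤ) = ⌊S⌋ := Int.natCast_floor_eq_floor hS
  have hfl' : ((⌊S + δ⌋₊ : ℕ) : ℤ) = ⌊S + δ⌋ := Int.natCast_floor_eq_floor (by linarith)
  have hdec := Int.floor_add_fract S
  have hdec' := Int.floor_add_fract (S + δ)
  have hf0 := Int.fract_nonneg S
  have hf1 := Int.fract_lt_one S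
  have him' : codeVal β s'.1.2 = (halfTurn (Int.fract (S + δ))).im := by rw [← hs', cxVal_im]
  refine ⟨?_, ?_⟩
  · rcases lt_or_ge (Int.fract S + δ) 1 with hlt | hge
    · left
      have hk : ⌊S + δ⌋ = ⌊S⌋ := Int.floor_eq_iff.2 ⟨by linarith, by linarith⟩
      refine ⟨by omega, CxEq.of_cxVal hm ?_⟩
      rw [hk] at hdec'
      rw [hs', cxVal_cxMul, hs, hz, ← halfTurn_add]
      congr 1
      linarith
    · right
      have hk : ⌊S + δ⌋ = ⌊S⌋ + 1 :=
        Int.floor_eq_iff.2 ⟨by push_cast; linarith, by push_cast; linarith⟩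
      refine ⟨by omega, CxEq.of_cxVal hm ?_⟩
      have hneg : cxVal β ([(-1, 0)], []) = -1 := by
        apply Complex.ext <;> simp [val_neg_one]
      rw [hk] at hdec'
      push_cast at hdec'
      rw [hs', cxVal_cxMul, cxVal_cxMul, hs, hz, ← halfTurn_add, hneg, neg_one_mul,
        ← halfTurn_sub_one]
      congr 1
      linarith
  · rcases halfTurn_im_pos_or (Int.fract_nonneg (S + δ)) (Int.fract_lt_one (S + δ)) with h | h
    · left
      exact CodePos.of_codeVal hβ hm (by rwa [him']) (by rwa [him'])
    · right
      exact CxEq.of_cxVal hm (by rw [hs', h, cxVal_one])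

end Complete

/-- The sum of the first `j` entries of a periodic sequence. -/
noncomputable def periodicSum (P : ℕ) (δ : ℕ → ℝ) (j : ℕ) : ℝ :=
  ∑ i ∈ Finset.range j, δ (i % P)

/-- The numbers that a certificate for a rational sum of densities needs. -/
noncomputable def sumNumbers (P N : ℕ) (δ : ℕ → ℝ) : List ℝ :=
  (List.range (N * P + 1)).flatMap fun j =>
    [(halfTurn (Int.fract (periodicSum P δ j))).re, (halfTurn (Int.fract (periodicSum P δ j))).im,
      √(halfTurn (Int.fract (periodicSum P δ j))).im]

theorem isAlgebraic_of_mem_sumNumbers {P N : ℕ} {δ : ℕ → ℝ}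
    (hδ : ∀ l, IsAlgebraic ℚ (halfTurn (δ l))) : ∀ x ∈ sumNumbers P N δ, IsAlgebraic ℚ x := by
  intro x hx
  obtain ⟨j, -, hx⟩ := List.mem_flatMap.1 hx
  have h : IsAlgebraic ℚ (halfTurn (Int.fract (periodicSum P δ j))) :=
    isAlgebraic_halfTurn_fract (isAlgebraic_halfTurn_sum _ fun i _ => hδ _)
  simp only [List.mem_cons, List.not_mem_nil, or_false] at hx
  rcases hx with rfl | rfl | rfl
  · exact IsAlgebraic.re h
  · exact IsAlgebraic.im h
  · exact isAlgebraic_sqrt (IsAlgebraic.im h)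

theorem exists_isRationalSum {β : ℝ} {m : PolyCode} (hβ : IsIntegral ℚ β)
    (hm : polyOf m = minpoly ℚ β) {zs : List CxCode} (hzs : 0 < zs.length) {δ : ℕ → ℝ}
    (hδ0 : ∀ l, 0 ≤ δ l) (hδ1 : ∀ l, δ l ≤ 1)
    (hz : ∀ l < zs.length, cxVal β (zs.getD l ([], [])) = halfTurn (δ l)) {N : ℕ} (hN : 0 < N)
    {k : ℤ} (hk : N * ∑ l ∈ Finset.range zs.length, δ l = k)
    (hS : ∀ x ∈ sumNumbers zs.length N δ, HasCode β x) : ∃ q, IsRationalSum m zs q := by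
  obtain ⟨e, he1, he⟩ := exists_cxCode_function β
  set T : ℕ → ℝ := periodicSum zs.length δ with hT
  have hT0 : ∀ j, 0 ≤ T j := fun j => Finset.sum_nonneg fun i _ => hδ0 _
  have hTend : T (N * zs.length) = k := by rw [hT, periodicSum, sum_range_mul_mod, hk]
  have hmem : ∀ j < N * zs.length + 1, ∀ x ∈ [(halfTurn (Int.fract (T j))).re,
      (halfTurn (Int.fract (T j))).im, √(halfTurn (Int.fract (T j))).im], HasCode β x :=
    fun j hj x hx => hS x (List.mem_flatMap.2 ⟨j, List.mem_range.2 hj, hx⟩)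
  -- The states of the certificate are the fractional parts and floors of the partial sums. There is
  -- one more state than there are steps, whence `N * zs.length + 1`.
  set W : ℕ → CxCode × ℕ := fun j => (e (halfTurn (Int.fract (T j))), ⌊T j⌋₊) with hW
  have hval : ∀ j < N * zs.length + 1, cxVal β (W j).1 = halfTurn (Int.fract (T j)) :=
    fun j hj => he _ (hmem j hj _ (by simp)) (hmem j hj _ (by simp))
  have hget : ∀ j < N * zs.length + 1,
      ((List.range (N * zs.length + 1)).map W).getD j (([], []), 0) = W j := fun j hj => by
    rw [List.getD_eq_getElem _ _ (by simpa using hj)]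
    simp
  refine ⟨_, ⟨(N, ⌊(k : ℝ)⌋₊), (List.range (N * zs.length + 1)).map W⟩, hN, ⟨?_, ?_⟩, rfl,
    fun j hj => ?_⟩
  · rw [hget 0 (by omega), hW]
    simp [hT, periodicSum, he1]
  · simp only
    rw [hget _ (Nat.lt_succ_self _), hW]
    simp only [hTend]
    rw [Int.fract_intCast, halfTurn_zero, he1]
  · simp only at hj ⊢
    rw [hget j (by omega), hget (j + 1) (by omega)]
    have hsucc : T (j + 1) = T j + δ (j % zs.length) := Finset.sum_range_succ _ _
    refine IsAngleStep.of_halfTurn hβ hm (hT0 j) (hδ0 (j % zs.length)) (hδ1 _)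
      (hz _ (Nat.mod_lt _ hzs)) (hval j (by omega)) rfl ?_ ?_ ?_
    · rw [← hsucc]
      exact hval _ (by omega)
    · rw [← hsucc]
    · rw [← hsucc]
      exact hmem (j + 1) (by omega) _ (by simp)

theorem exists_isOutput {I : Code} (hI : I.Valid) (h : HasOnePairSplitting I.seq) :
    ∃ o, IsOutput I o := by
  obtain ⟨P, hP, hsplit⟩ := h
  have hex : ∀ l : ℕ, ∃ (δ : ℝ) (S : List ℝ), 0 ≤ δ ∧ δ ≤ 1 ∧ IsAlgebraic ℚ (halfTurn δ) ∧
      (∀ x ∈ S, IsAlgebraic ℚ x) ∧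
      (l < P → ∀ (β : ℝ) (m : PolyCode), IsIntegral ℚ β → polyOf m = minpoly ℚ β →
        (∀ x ∈ S, HasCode β x) → ∀ z : CxCode, cxVal β z = halfTurn δ →
          IsDensityCode I m P l z) := by
    intro l
    by_cases hl : l < P
    · obtain ⟨δ, S, h1, h2, h3, h4, h5⟩ :=
        exists_isDensityCode hI hP (hsplit l hl).1 (hsplit l hl).2
      exact ⟨δ, S, h1, h2, h3, h4, fun _ => h5⟩
    · exact ⟨0, [], le_rfl, zero_le_one, by rw [halfTurn_zero]; exact isAlgebraic_one, by simp,
        fun h => absurd h hl⟩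
  choose δ S hδ0 hδ1 hδalg hSalg hcode using hex
  -- The generator `β` has to serve all residue classes at once and, in the rational case, also the
  -- summation of angles. So it is chosen last, with room for further numbers `extra`.
  have main : ∀ extra : List ℝ, (∀ x ∈ extra, IsAlgebraic ℚ x) →
      ∃ (β : ℝ) (m : PolyCode) (zs : List CxCode), IsIntegral ℚ β ∧ polyOf m = minpoly ℚ β ∧
        zs.length = P ∧ (∀ x ∈ extra, HasCode β x) ∧
        (∀ l < P, cxVal β (zs.getD l ([], [])) = halfTurn (δ l)) ∧
        ∀ l < P, IsDensityCode I m P l (zs.getD l ([], [])) := by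
    intro extra hextra
    set A : List ℝ := ((List.range P).flatMap fun l =>
      [(halfTurn (δ l)).re, (halfTurn (δ l)).im] ++ S l) ++ extra with hA
    have hAalg : ∀ x ∈ A, IsAlgebraic ℚ x := by
      intro x hx
      rcases List.mem_append.1 hx with hx | hx
      · obtain ⟨l, -, hx⟩ := List.mem_flatMap.1 hx
        rcases List.mem_append.1 hx with hx | hx
        · simp only [List.mem_cons, List.not_mem_nil, or_false] at hx
          rcases hx with rfl | rfl
          · exact IsAlgebraic.re (hδalg l)
          · exact IsAlgebraic.im (hδalg l)
        · exact hSalg l x hx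
      · exact hextra x hx
    obtain ⟨β, m, hβ, hm, hcodes⟩ := exists_hasCode (S := {x | x ∈ A}) (List.finite_toSet A) hAalg
    obtain ⟨e, -, he⟩ := exists_cxCode_function β
    have hin : ∀ l < P, ∀ x ∈ [(halfTurn (δ l)).re, (halfTurn (δ l)).im] ++ S l, HasCode β x :=
      fun l hl x hx => hcodes x (List.mem_append_left _
        (List.mem_flatMap.2 ⟨l, List.mem_range.2 hl, hx⟩))
    have hval : ∀ l < P, cxVal β (((List.range P).map fun l => e (halfTurn (δ l))).getD l ([], []))
        = halfTurn (δ l) := by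
      intro l hl
      rw [List.getD_eq_getElem _ _ (by simpa using hl)]
      simp only [List.getElem_map, List.getElem_range]
      exact he _ (hin l hl _ (by simp)) (hin l hl _ (by simp))
    exact ⟨β, m, (List.range P).map fun l => e (halfTurn (δ l)), hβ, hm, by simp,
      fun x hx => hcodes x (List.mem_append_right _ hx), hval, fun l hl =>
        hcode l hl β m hβ hm (fun x hx => hin l hl x (List.mem_append_right _ hx)) _ (hval l hl)⟩
  by_cases hrat : ∃ a : ℚ, (a : ℝ) = ∑ l ∈ Finset.range P, δ l
  · obtain ⟨a, ha⟩ := hrat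
    obtain ⟨β, m, zs, hβ, hm, rfl, hextra, hval, hdens⟩ :=
      main (sumNumbers P a.den δ) (isAlgebraic_of_mem_sumNumbers hδalg)
    -- The number of repetitions is the denominator of the sum, which makes the final angle an
    -- integer multiple of `π`.
    obtain ⟨q, hq⟩ := exists_isRationalSum hβ hm hP hδ0 hδ1 hval a.den_pos (k := a.num)
      (by rw [← ha]; exact_mod_cast Rat.den_mul_eq_num a) hextra
    exact ⟨some q, ⟨m, zs⟩, ⟨CodeHasRoot.of_minpoly hβ hm, hP⟩, hdens, Or.inr ⟨q, rfl, hq⟩⟩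
  · obtain ⟨β, m, zs, hβ, hm, rfl, -, hval, hdens⟩ := main [] (by simp)
    refine ⟨none, ⟨m, zs⟩, ⟨CodeHasRoot.of_minpoly hβ hm, hP⟩, hdens, Or.inl ⟨rfl, ?_⟩⟩
    -- If the `n`-th power of the product were `1`, then `n` times the sum would be an even integer
    -- and the sum would be rational.
    refine CxNotUnity.of_pow_ne_one hβ hm fun n hn h1 => hrat ?_
    have hprod : cxVal β (cxProd zs) = halfTurn (∑ l ∈ Finset.range zs.length, δ l) := by
      rw [cxVal_cxProd, prod_map_eq_prod_range zs ([], []), halfTurn_sum]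
      exact Finset.prod_congr rfl fun l hl => hval l (Finset.mem_range.1 hl)
    rw [hprod, ← halfTurn_nat_mul] at h1
    obtain ⟨k, hk⟩ := exists_of_halfTurn_eq_one h1
    refine ⟨2 * k / n, ?_⟩
    have hn' : (n : ℝ) ≠ 0 := by exact_mod_cast hn.ne'
    push_cast
    rw [← hk, mul_div_cancel_left₀ _ hn']

end LRS

theorem theorem1p4 :
    (∃ f : LRS.Code →. Option LRS.RatCode, Partrec f ∧
      ∀ I : LRS.Code, I.Valid → LRS.HasOnePairSplitting I.seq →
        ∃ δ : ℝ, LRS.HasDensity (LRS.positivitySet I.seq) δ ∧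
          ((Irrational δ ∧ none ∈ f I) ∨
            ∃ q : LRS.RatCode, some q ∈ f I ∧ δ = (q.val : ℝ))) ∧
    (∀ I : LRS.Code, I.Valid → LRS.NonDegenerate I.seq → LRS.AtMostOneDominantPair I.seq →
      (∃ n, I.seq n ≠ 0) →
        ∃ σ c r : ℝ, (σ = 1 ∨ σ = -1) ∧ 0 ≤ r ∧ IsAlgebraic ℚ c ∧ IsAlgebraic ℚ r ∧
          LRS.HasDominantPart I.seq σ c r ∧
          (σ = 1 → |c| < r →
            LRS.HasDensity (LRS.positivitySet I.seq) (Real.arccos (-c / r) / Real.pi)) ∧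
          (σ = 1 → r ≤ c → LRS.HasDensity (LRS.positivitySet I.seq) 1) ∧
          (σ = 1 → r ≤ -c → LRS.HasDensity (LRS.positivitySet I.seq) 0) ∧
          (σ = -1 → LRS.HasDensity (LRS.positivitySet I.seq) (1 / 2))) := by
  -- The search for a certificate halts on admissible inputs by completeness. Whatever it returns is
  -- correct by soundness, which makes no use of the conditions on the input.
  obtain ⟨f, hf, hsound, hcomplete⟩ := LRS.semiDec_isOutput.exists_partrec
  refine ⟨⟨f, hf, fun I hI hsplit => ?_⟩,
    fun I hI hnd hone hne => LRS.exists_dominantPart hI hnd hone hne⟩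
  have hdom := hcomplete I (LRS.exists_isOutput hI hsplit)
  have hmem := Part.get_mem hdom
  obtain ⟨δ, hδ, hcase⟩ := (hsound I _ hmem).sound
  refine ⟨δ, hδ, ?_⟩
  rcases hcase with ⟨hirr, ho⟩ | ⟨q, ho, hq⟩
  · exact Or.inl ⟨hirr, ho ▸ hmem⟩
  · exact Or.inr ⟨q, ho ▸ hmem, hq⟩
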